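/- Let $G$ be a compact connected Lie group and let $\sigma_1,\sigma_2$ be commuting Lie group automorphisms of $G$ such that $\sigma_1$ is an involution and $\sigma_2$ has finite order. Let $K$ be the identity component of $G^{\sigma_1}\cap G^{\sigma_2}$, $S\subseteq K$ a maximal torus of $K$, $K_1$ the identity component of $G^{\sigma_1}$, $T_1=Z_{K_1}(S)$ the centralizer of $S$ in $K_1$, and $T=Z_G(T_1)$ the centralizer of $T_1$ in $G$ (a maximal torus of $G$ invariant under $\sigma_1$ and $\sigma_2$). Let $\mathfrak g_{\mathbb R}$ be the Lie algebra of $G$, and let $\mathfrak g,\mathfrak t,\mathfrak s$ be the complexifications of the Lie algebras of $G,T,S$. Let $\langle\cdot,\cdot\rangle$ be an $\mathrm{Ad}_G$-invariant negative-definite symmetric bilinear form on $\mathfrak g_{\mathbb R}$ that is invariant under $\sigma_1$ and $\sigma_2$, extended $\mathbb C$-bilinearly to $\mathfrak g$; for $\alpha\in\mathfrak t^*$ let $H_\alpha\in\mathfrak t$ be the vector with $\langle H_\alpha,X\rangle=\alpha(X)$ for all $X\in\mathfrak t$. Let $\Delta\subseteq\mathfrak t^*$ be the set of roots of $\mathfrak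 g$ with respect to $\mathfrak t$, let $\Omega\subseteq\Delta$ be the set of roots vanishing on $\mathfrak s$, and fix a disjoint decomposition $\Omega=\Omega^+\cup(-\Omega^+)$. Let $\sigma_2$ act on $\mathfrak t^*$ by $\sigma_2(\alpha)=\alpha\circ\sigma_2^{-1}$. Then for every $\alpha\in\Omega$ there is a largest integer $\ell$ such that $\alpha,\sigma_2(\alpha),\dots,\sigma_2^{\ell-1}(\alpha)$ are linearly independent over $\mathbb R$; it satisfies $\ell\ge 1$, these $\ell$ roots are also linearly independent over $\mathbb C$, and $\sigma_2^{\ell}(\alpha)=-\alpha$. Moreover, no nonzero vector of $\sum_{\alpha\in\Omega^+}\mathbb C H_\alpha\subseteq\mathfrak t$ is fixed by $\sigma_2$. -/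

import Mathlib

open scoped Manifold ContDiff TensorProduct Pointwise

noncomputable section

namespace LieTorus

instance instLEInftyMinSmoothness : ENat.LEInfty (minSmoothness ℝ 3) :=
  ⟨by rw [minSmoothness_of_isRCLikeNormedField]; exact WithTop.coe_le_coe.2 (le_top (a := (3 : ℕ∞)))⟩

/-! ### Subgroups of a topological group -/

section Subgroups

variable {G : Type*} [Group G]

/-- The fixed point subgroup of an automorphism. -/
def fixedSubgroup (μ : MulAut G) : Subgroup G := μ.toMonoidHom.eqLocus (MonoidHom.id G)

variable [TopologicalSpace G]

/-- The connected component of the identity of a subgroup `H` of a topological group `G`,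
as a subgroup of `G`. -/
def identityComponent [IsTopologicalGroup G] (H : Subgroup G) : Subgroup G :=
  (Subgroup.connectedComponentOfOne H).map H.subtype

/-- A torus in a Lie group: a compact connected abelian subgroup. -/
structure IsTorus (S : Subgroup G) : Prop where
  isCompact : IsCompact (S : Set G)
  isConnected : IsConnected (S : Set G)
  comm : ∀ x ∈ S, ∀ y ∈ S, x * y = y * x

/-- `S` is a maximal torus of the subgroup `K`. -/
def IsMaximalTorus (K S : Subgroup G) : Prop :=
  Maximal (fun S' : Subgroup G => IsTorus S' ∧ S' ≤ K) S

end Subgroups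

/-! ### Lie algebras of a Lie group and of its closed subgroups -/

section LieGroups

variable (n : ℕ) (G : Type*) [TopologicalSpace G] [ChartedSpace (EuclideanSpace ℝ (Fin n)) G]
  [Group G]

/-- The real Lie algebra of `G`, with Mathlib's Lie bracket of left invariant vector fields. -/
abbrev RealLie : Type := GroupLieAlgebra (𝓡 n) G

/-- The complexified Lie algebra of `G`. -/
abbrev ComplexLie : Type := ℂ ⊗[ℝ] RealLie n G

variable {G}

/-- A Lie group automorphism: a group automorphism which is a diffeomorphism. -/
structure IsLieAut (μ : MulAut G) : Prop where
  smooth : ContMDiff (𝓡 n) (𝓡 n) ∞ μ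
  smooth_symm : ContMDiff (𝓡 n) (𝓡 n) ∞ μ.symm

/-- The differential at the identity of a group automorphism, as a map of Lie algebras. -/
def differential (μ : MulAut G) : RealLie n G →ₗ[ℝ] RealLie n G :=
  (mfderiv (𝓡 n) (𝓡 n) μ (1 : G) :
    EuclideanSpace ℝ (Fin n) →L[ℝ] EuclideanSpace ℝ (Fin n)).toLinearMap

/-- `X` is the initial velocity of a one-parameter subgroup of `G` that is contained in `H`. -/
def IsVelocityIn (H : Subgroup G) (X : RealLie n G) : Prop :=
  ∃ γ : ℝ → G, ContMDiff 𝓘(ℝ, ℝ) (𝓡 n) ∞ γ ∧ (∀ s t, γ (s + t) = γ s * γ t) ∧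
    (∀ t, γ t ∈ H) ∧ (mfderiv 𝓘(ℝ, ℝ) (𝓡 n) γ 0 (1 : ℝ) : EuclideanSpace ℝ (Fin n)) = X

/-- The Lie algebra of a closed subgroup `H` of `G`, that is, the set of all `X` with
`exp (t X) ∈ H` for all real `t`.  (For closed `H` this set is already a linear subspace; the span
turns it into a term of type `Submodule`.) -/
def realLieOf (H : Subgroup G) : Submodule ℝ (RealLie n G) :=
  Submodule.span ℝ {X | IsVelocityIn n H X}

/-- The complexified Lie algebra of a closed subgroup `H` of `G`. -/
def complexLieOf (H : Subgroup G) : Submodule ℂ (ComplexLie n G) :=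
  (realLieOf n H).baseChange ℂ

variable {n}

lemma differential_comp {μ ν : MulAut G} (hμ : IsLieAut n μ) (hν : IsLieAut n ν) :
    differential n μ ∘ₗ differential n ν = differential n (μ * ν) := by
  have h1 : MDifferentiableAt (𝓡 n) (𝓡 n) μ (ν (1 : G)) :=
    hμ.smooth.mdifferentiableAt (by simp)
  have h2 : MDifferentiableAt (𝓡 n) (𝓡 n) ν (1 : G) := hν.smooth.mdifferentiableAt (by simp)
  have h := mfderiv_comp (1 : G) h1 h2
  ext1 X
  have h3 := congrArg (fun L : EuclideanSpace ℝ (Fin n) →L[ℝ] EuclideanSpace ℝ (Fin n) => L X) h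
  have h4 : ν (1 : G) = 1 := map_one ν
  simp only [differential]
  rw [h4] at h3
  exact h3.symm

lemma differential_one : differential n (1 : MulAut G) = LinearMap.id := by
  ext1 X
  have h := mfderiv_id (I := 𝓡 n) (x := (1 : G))
  exact congrArg (fun L : EuclideanSpace ℝ (Fin n) →L[ℝ] EuclideanSpace ℝ (Fin n) => L X) h

lemma IsLieAut.symm {μ : MulAut G} (hμ : IsLieAut n μ) : IsLieAut n μ⁻¹ :=
  ⟨hμ.smooth_symm, hμ.smooth⟩

/-- The differential of a Lie group automorphism, as a linear automorphism of the Lie algebra. -/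
def differentialEquiv {μ : MulAut G} (hμ : IsLieAut n μ) : RealLie n G ≃ₗ[ℝ] RealLie n G :=
  LinearEquiv.ofLinearMap (differential n μ) (differential n μ⁻¹)
    (by rw [differential_comp hμ hμ.symm, mul_inv_cancel, differential_one])
    (by rw [differential_comp hμ.symm hμ, inv_mul_cancel, differential_one])

/-- The `ℂ`-linear extension of the differential of a Lie group automorphism. -/
def complexDifferential {μ : MulAut G} (hμ : IsLieAut n μ) :
    ComplexLie n G ≃ₗ[ℂ] ComplexLie n G :=
  (differentialEquiv hμ).baseChange ℝ ℂ (RealLie n G) (RealLie n G)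

lemma IsVelocityIn.map {μ : MulAut G} (hμ : IsLieAut n μ) {H H' : Subgroup G}
    (h : ∀ x ∈ H, μ x ∈ H') {X : RealLie n G} (hX : IsVelocityIn n H X) :
    IsVelocityIn n H' (differential n μ X) := by
  obtain ⟨γ, hγ, hadd, hmem, hX⟩ := hX
  refine ⟨μ ∘ γ, hμ.smooth.comp hγ, fun s t => ?_, fun t => h _ (hmem t), ?_⟩
  · simp [hadd]
  · have h0 : γ 0 = 1 := by simpa using hadd 0 0
    have h1 : MDifferentiableAt (𝓡 n) (𝓡 n) μ (γ 0) := hμ.smooth.mdifferentiableAt (by simp)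
    have h2 : MDifferentiableAt 𝓘(ℝ, ℝ) (𝓡 n) γ 0 := hγ.mdifferentiableAt (by simp)
    have h3 := mfderiv_comp (0 : ℝ) h1 h2
    have h4 := congrArg (fun L : ℝ →L[ℝ] EuclideanSpace ℝ (Fin n) => L 1) h3
    rw [h0] at h4
    subst hX
    exact h4

lemma realLieOf_map_le {μ : MulAut G} (hμ : IsLieAut n μ) {H : Subgroup G}
    (h : ∀ x ∈ H, μ x ∈ H) :
    (realLieOf n H).map (differential n μ) ≤ realLieOf n H := by
  rw [realLieOf, Submodule.map_span, Submodule.span_le]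
  rintro _ ⟨X, hX, rfl⟩
  exact Submodule.subset_span (IsVelocityIn.map hμ h hX)

lemma complexLieOf_map_le {μ : MulAut G} (hμ : IsLieAut n μ) {H : Subgroup G}
    (h : ∀ x ∈ H, μ x ∈ H) :
    (complexLieOf n H).map (complexDifferential hμ).toLinearMap ≤ complexLieOf n H := by
  rw [complexLieOf, Submodule.baseChange_eq_span, Submodule.map_span, Submodule.span_le]
  rintro _ ⟨_, ⟨X, hX, rfl⟩, rfl⟩
  refine Submodule.subset_span ⟨differential n μ X, ?_, rfl⟩
  exact realLieOf_map_le hμ h ⟨X, hX, rfl⟩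

lemma complexLieOf_map_eq {μ : MulAut G} (hμ : IsLieAut n μ) {H : Subgroup G}
    (h : ∀ x, μ x ∈ H ↔ x ∈ H) :
    (complexLieOf n H).map (complexDifferential hμ).toLinearMap = complexLieOf n H := by
  refine le_antisymm (complexLieOf_map_le hμ fun x hx => (h x).2 hx) fun Z hZ => ?_
  have h' : ∀ x ∈ H, μ⁻¹ x ∈ H := fun x hx => (h _).1 (by simpa using hx)
  refine ⟨complexDifferential hμ.symm Z, complexLieOf_map_le hμ.symm h' ⟨Z, hZ, rfl⟩, ?_⟩
  exact (complexDifferential hμ).apply_symm_apply Z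

end LieGroups

/-! ### The data `(σ₁, σ₂, S)` and the tori `T₁` and `T` -/

/-- A Lie group `G` with two commuting Lie group automorphisms `σ₁`, `σ₂`, where `σ₁` is an
involution and `σ₂` has finite order, and a maximal torus `S` of the identity component `K` of
`G^σ₁ ∩ G^σ₂`. -/
structure SymmetricData (n : ℕ) (G : Type*) [TopologicalSpace G]
    [ChartedSpace (EuclideanSpace ℝ (Fin n)) G] [Group G] [IsTopologicalGroup G] where
  /-- the involution -/
  σ₁ : MulAut G
  /-- the finite-order automorphism -/
  σ₂ : MulAut G
  lieAut₁ : IsLieAut n σ₁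
  lieAut₂ : IsLieAut n σ₂
  involutive : Function.Involutive σ₁
  finOrder : IsOfFinOrder σ₂
  comm : Commute σ₁ σ₂
  /-- the maximal torus of `K` -/
  S : Subgroup G
  maximal : IsMaximalTorus (identityComponent (fixedSubgroup σ₁ ⊓ fixedSubgroup σ₂)) S

namespace SymmetricData

variable {n : ℕ} {G : Type*} [TopologicalSpace G] [ChartedSpace (EuclideanSpace ℝ (Fin n)) G]
  [Group G] [IsTopologicalGroup G] (D : SymmetricData n G)

/-- `K`, the identity component of `G^σ₁ ∩ G^σ₂`. -/
def K : Subgroup G := identityComponent (fixedSubgroup D.σ₁ ⊓ fixedSubgroup D.σ₂)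

/-- `K₁`, the identity component of `G^σ₁`. -/
def K₁ : Subgroup G := identityComponent (fixedSubgroup D.σ₁)

/-- `T₁ = Z_{K₁}(S)`, the centralizer of `S` in `K₁`. -/
def T₁ : Subgroup G := Subgroup.centralizer (D.S : Set G) ⊓ D.K₁

/-- `T = Z_G(T₁)`, the centralizer of `T₁` in `G`. -/
def T : Subgroup G := Subgroup.centralizer (D.T₁ : Set G)

lemma fixed_of_mem_S {x : G} (hx : x ∈ D.S) : D.σ₂ x = x := by
  obtain ⟨y, -, rfl⟩ := D.maximal.prop.2 hx
  exact y.2.2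

lemma map_mem_K₁ {μ : MulAut G} (hμ : Continuous μ) (hc : Commute D.σ₁ μ) {x : G}
    (hx : x ∈ D.K₁) : μ x ∈ D.K₁ := by
  obtain ⟨y, hy, rfl⟩ := hx
  have hmem : ∀ z : fixedSubgroup D.σ₁, μ z ∈ fixedSubgroup D.σ₁ := by
    intro z
    have h1 : D.σ₁ (z : G) = z := z.2
    have h2 : D.σ₁ (μ z) = μ (D.σ₁ z) := congrArg (fun f : MulAut G => f z) hc.eq
    change D.σ₁ (μ z) = μ z
    rw [h2, h1]
  let f : fixedSubgroup D.σ₁ → fixedSubgroup D.σ₁ := fun z => ⟨μ z, hmem z⟩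
  have hf : Continuous f := (hμ.comp continuous_subtype_val).subtype_mk _
  have h1 : f 1 = 1 := Subtype.ext (by simp [f])
  refine ⟨f y, ?_, rfl⟩
  have := hf.image_connectedComponent_subset 1 ⟨y, hy, rfl⟩
  rwa [h1] at this

lemma map_mem_T₁ {μ : MulAut G} (hμ : Continuous μ) (hc : Commute D.σ₁ μ)
    (hS : ∀ x ∈ D.S, μ x = x) {x : G} (hx : x ∈ D.T₁) : μ x ∈ D.T₁ := by
  refine ⟨?_, D.map_mem_K₁ hμ hc hx.2⟩
  have h := Subgroup.mem_centralizer_iff.1 hx.1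
  refine Subgroup.mem_centralizer_iff.2 fun s hs => ?_
  have := congrArg μ (h s hs)
  rwa [map_mul, map_mul, hS s hs] at this

lemma map_mem_T_iff (x : G) : D.σ₂ x ∈ D.T ↔ x ∈ D.T := by
  have hcont : Continuous D.σ₂ := D.lieAut₂.smooth.continuous
  have hcont' : Continuous (D.σ₂⁻¹ : MulAut G) := D.lieAut₂.smooth_symm.continuous
  have hS' : ∀ s ∈ D.S, D.σ₂⁻¹ s = s := fun s hs => by
    have h := MulAut.inv_apply_self G D.σ₂ s
    rwa [D.fixed_of_mem_S hs] at h
  constructor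
  · intro hx
    refine Subgroup.mem_centralizer_iff.2 fun t ht => D.σ₂.injective ?_
    rw [map_mul, map_mul]
    exact Subgroup.mem_centralizer_iff.1 hx _
      (D.map_mem_T₁ hcont D.comm (fun s hs => D.fixed_of_mem_S hs) ht)
  · intro hx
    refine Subgroup.mem_centralizer_iff.2 fun t ht => D.σ₂⁻¹.injective ?_
    rw [map_mul, map_mul]
    simpa using Subgroup.mem_centralizer_iff.1 hx _
      (D.map_mem_T₁ hcont' D.comm.inv_right hS' ht)

/-- `𝔰`, the complexified Lie algebra of `S`. -/
def s : Submodule ℂ (ComplexLie n G) := complexLieOf n D.S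

/-- `𝔱`, the complexified Lie algebra of `T`. -/
def t : Submodule ℂ (ComplexLie n G) := complexLieOf n D.T

/-- The restriction of (the complexified differential of) `σ₂` to `𝔱`. -/
def σ₂t : D.t ≃ₗ[ℂ] D.t :=
  (complexDifferential D.lieAut₂).ofSubmodules D.t D.t
    (complexLieOf_map_eq D.lieAut₂ D.map_mem_T_iff)

/-- The action of `σ₂` on `𝔱*`, given by `σ₂(α) = α ∘ σ₂⁻¹`. -/
def σ₂dual (α : Module.Dual ℂ D.t) : Module.Dual ℂ D.t := α ∘ₗ D.σ₂t.symm.toLinearMap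

/-- `Δ`, the `𝔱`-roots of `𝔤`: the nonzero `α ∈ 𝔱*` whose root space is nonzero. -/
def Δ [LieGroup (𝓡 n) ∞ G] : Set (Module.Dual ℂ D.t) :=
  {α | α ≠ 0 ∧ ∃ X : ComplexLie n G, X ≠ 0 ∧
    ∀ H : D.t, ⁅(H : ComplexLie n G), X⁆ = α H • X}

/-- `Ω`, the roots vanishing on `𝔰`. -/
def Ω [LieGroup (𝓡 n) ∞ G] : Set (Module.Dual ℂ D.t) :=
  {α | α ∈ D.Δ ∧ ∀ H : D.t, (H : ComplexLie n G) ∈ D.s → α H = 0}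

/-- An `Ad_G`-invariant negative-definite symmetric bilinear form on `𝔤_ℝ` which is invariant
under `σ₁` and `σ₂`. -/
structure InvariantForm where
  /-- the form on `𝔤_ℝ` -/
  form : LinearMap.BilinForm ℝ (RealLie n G)
  symm : ∀ X Y, form X Y = form Y X
  neg : ∀ X, X ≠ 0 → form X X < 0
  invariant : ∀ (g : G) (X Y : RealLie n G),
    form (differential n (MulAut.conj g) X) (differential n (MulAut.conj g) Y) = form X Y
  invariant₁ : ∀ X Y, form (differential n D.σ₁ X) (differential n D.σ₁ Y) = form X Y
  invariant₂ : ∀ X Y, form (differential n D.σ₂ X) (differential n D.σ₂ Y) = form X Y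

namespace InvariantForm

variable {D} (B : D.InvariantForm)

/-- The `ℂ`-bilinear extension of the form to `𝔤`, restricted to `𝔱`. -/
def formT : LinearMap.BilinForm ℂ D.t := (B.form.baseChange ℂ).restrict D.t

lemma exists_re_im {V : Type*} [AddCommGroup V] [Module ℝ V] (W : Submodule ℝ V)
    {z : ℂ ⊗[ℝ] V} (hz : z ∈ W.baseChange ℂ) :
    ∃ x ∈ W, ∃ y ∈ W, z = (1 : ℂ) ⊗ₜ[ℝ] x + Complex.I ⊗ₜ[ℝ] y := by
  rw [Submodule.baseChange_eq_span] at hz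
  induction hz using Submodule.span_induction with
  | mem z h =>
    obtain ⟨x, hx, rfl⟩ := h
    exact ⟨x, hx, 0, W.zero_mem, by simp⟩
  | zero => exact ⟨0, W.zero_mem, 0, W.zero_mem, by simp⟩
  | add z w _ _ hz hw =>
    obtain ⟨x, hx, y, hy, rfl⟩ := hz
    obtain ⟨x', hx', y', hy', rfl⟩ := hw
    refine ⟨x + x', W.add_mem hx hx', y + y', W.add_mem hy hy', ?_⟩
    simp only [TensorProduct.tmul_add]
    abel
  | smul c z _ hz =>
    obtain ⟨x, hx, y, hy, rfl⟩ := hz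
    refine ⟨c.re • x - c.im • y, W.sub_mem (W.smul_mem _ hx) (W.smul_mem _ hy),
      c.im • x + c.re • y, W.add_mem (W.smul_mem _ hx) (W.smul_mem _ hy), ?_⟩
    have h1 : c = c.re • (1 : ℂ) + c.im • Complex.I := by
      apply Complex.ext <;> simp
    have h2 : c * Complex.I = c.re • Complex.I - c.im • (1 : ℂ) := by
      apply Complex.ext <;> simp
    simp only [smul_add, TensorProduct.smul_tmul', smul_eq_mul, mul_one]
    rw [h2]
    nth_rewrite 1 [h1]
    simp only [TensorProduct.add_tmul, TensorProduct.sub_tmul, TensorProduct.tmul_add,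
      TensorProduct.tmul_sub, TensorProduct.smul_tmul]
    abel

lemma formT_symm (X Y : D.t) : B.formT X Y = B.formT Y X :=
  (LinearMap.BilinForm.IsSymm.baseChange ℂ ⟨B.symm⟩).eq (X : ComplexLie n G) Y

lemma formT_nondegenerate : B.formT.Nondegenerate := by
  have key : ∀ X : D.t, (∀ Y, B.formT X Y = 0) → X = 0 := by
    rintro ⟨z, hz⟩ h
    obtain ⟨x, hx, y, hy, rfl⟩ := exists_re_im (realLieOf n D.T) hz
    have h1 := h ⟨(1 : ℂ) ⊗ₜ[ℝ] x, Submodule.tmul_mem_baseChange_of_mem _ hx⟩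
    have h2 := h ⟨(1 : ℂ) ⊗ₜ[ℝ] y, Submodule.tmul_mem_baseChange_of_mem _ hy⟩
    have e : ∀ v w : RealLie n G, ∀ a : ℂ,
        (B.form.baseChange ℂ) (a ⊗ₜ[ℝ] v) ((1 : ℂ) ⊗ₜ[ℝ] w) = B.form v w • a := by
      intro v w a
      rw [LinearMap.BilinForm.baseChange_tmul, mul_one]
    simp only [formT, LinearMap.BilinForm.restrict_apply, LinearMap.domRestrict_apply, map_add,
      LinearMap.add_apply, e] at h1 h2
    have hx0 : B.form x x = 0 := by simpa using congrArg Complex.re h1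
    have hy0 : B.form y y = 0 := by simpa using congrArg Complex.im h2
    have hx' : x = 0 := by
      by_contra hne
      exact (B.neg x hne).ne hx0
    have hy' : y = 0 := by
      by_contra hne
      exact (B.neg y hne).ne hy0
    exact Subtype.ext (by simp [hx', hy'])
  refine ⟨key, fun Y h => key Y fun X => ?_⟩
  rw [formT_symm]
  exact h X

instance instFiniteDimensionalT : FiniteDimensional ℂ D.t := by
  have : FiniteDimensional ℝ (RealLie n G) :=
    inferInstanceAs (FiniteDimensional ℝ (EuclideanSpace ℝ (Fin n)))
  infer_instance

/-- `H_α ∈ 𝔱`, the vector dual to `α ∈ 𝔱*` with respect to the form: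
`⟨H_α, X⟩ = α X` for all `X ∈ 𝔱`. -/
def dualVector (α : Module.Dual ℂ D.t) : D.t :=
  (B.formT.toDual B.formT_nondegenerate).symm α

lemma formT_dualVector (α : Module.Dual ℂ D.t) (X : D.t) : B.formT (B.dualVector α) X = α X :=
  LinearMap.BilinForm.apply_toDual_symm_apply α X

end InvariantForm

end SymmetricData

end LieTorus

end

/-! Let `𝔨₁` be the Lie algebra of `K₁` and `𝔩` the centralizer of the Lie algebra of `S` in `𝔨₁`
(`centralizerS`). After complexification the theorem rests on three facts: the `σ₂`-fixed vectors of
`𝔩` lie in `𝔰`; `𝔩` is abelian; `𝔩 ⊆ 𝔱` and `[𝔱, 𝔩] = 0`.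

From the facts to the theorem. Let `X` be a root vector for `α ∈ Ω`. Then `X + σ₁X` is fixed by `σ₁`
and commutes with `𝔰`, so it lies in `𝔩` and commutes with `𝔱`; invariance of the form makes it
orthogonal to `X`, hence `σ₁X = -X` (`inv_eq_neg`). The bracket of two such root vectors is fixed by
`σ₁` again and lies in `𝔩`, where `𝔱` acts by zero, so it vanishes unless the roots are opposite
(`lie_eq_zero`). Hence roots of `Ω` that are neither equal nor opposite are orthogonal, and `H_α`, a
multiple of the bracket of `X` with its conjugate, lies in `𝔩`. The span of the `H_α` thus lies in
`𝔩` and is orthogonal to `𝔰`, while its fixed vectors lie in `𝔰`: they are zero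
(`eq_zero_of_fixed`). Now take the least `ℓ ≥ 1` with `σ₂^ℓ α = ±α`. The first `ℓ` roots of the
orbit are orthogonal and not isotropic, so independent; with the plus sign the sum of their `H`
would be a nonzero fixed vector (`exists_length`).

The three facts. If `X ∈ 𝔩` is fixed by `σ₂`, the closure of `S exp(ℝX)` is a torus in `K`, so `X`
is in the Lie algebra of `S` by maximality (`mem_lieOf_of_maximal`). So `σ₂` is a finite-order
automorphism of `𝔩` with central fixed points, and in compact type this forces `𝔩` to be abelian
(`lie_eq_zero_of_finite_order`). The relation `[𝔱, 𝔩] = 0` holds because `exp 𝔩 ⊆ T₁`. For `𝔩 ⊆ 𝔱`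
every `g ∈ T₁` has to fix `𝔩`, without appeal to connectedness of `T₁`
(`Ad_eq_of_mem_centralizerLie`): each element of `K₁` fixes a subspace of `𝔨₁` of dimension at least
`dim 𝔩`, and after multiplying `g` by a suitable `exp W`, with `W` in the Lie algebra of `S`, the
fixed space is contained in `𝔩`, hence equal to it.

The exponential map and the adjoint action are built from differential equations in a chart and
packaged, with the inner product `-B`, in `ExpData`. -/

noncomputable section

namespace LieTorus

set_option linter.unusedSectionVars false

open Set Filter Topology

/-! ### Multiplication and left invariant fields in a chart at the identity -/

section Chart

variable {n : ℕ} {G : Type*} [TopologicalSpace G] [ChartedSpace (EuclideanSpace ℝ (Fin n)) G]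
  [Group G]

variable (n G) in
/-- The preferred chart at the identity. -/
def chartOne : PartialEquiv G (EuclideanSpace ℝ (Fin n)) := extChartAt (𝓡 n) (1 : G)

variable (n G) in
/-- The image of the identity in the preferred chart. -/
def origin : EuclideanSpace ℝ (Fin n) := chartOne n G 1

variable (G) in
/-- The multiplication read in the chart at the identity. -/
def localMul (p : EuclideanSpace ℝ (Fin n) × EuclideanSpace ℝ (Fin n)) :
    EuclideanSpace ℝ (Fin n) :=
  chartOne n G ((chartOne n G).symm p.1 * (chartOne n G).symm p.2)

variable (G) in
/-- The left invariant vector fields read in the chart at the identity. -/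
def localField (x : EuclideanSpace ℝ (Fin n)) :
    EuclideanSpace ℝ (Fin n) →L[ℝ] EuclideanSpace ℝ (Fin n) :=
  (fderiv ℝ (localMul G) (x, origin n G)).comp
    (ContinuousLinearMap.inr ℝ (EuclideanSpace ℝ (Fin n)) (EuclideanSpace ℝ (Fin n)))

lemma one_mem_source : (1 : G) ∈ (chartOne n G).source := mem_extChartAt_source 1

lemma origin_mem_target : origin n G ∈ (chartOne n G).target := mem_extChartAt_target 1

@[simp] lemma chartOne_symm_origin : (chartOne n G).symm (origin n G) = 1 :=
  extChartAt_to_inv (1 : G)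

lemma isOpen_chartOne_target : IsOpen (chartOne n G).target := isOpen_extChartAt_target 1

lemma isOpen_chartOne_source : IsOpen (chartOne n G).source := isOpen_extChartAt_source 1

lemma continuousOn_chartOne_symm : ContinuousOn (chartOne n G).symm (chartOne n G).target :=
  continuousOn_extChartAt_symm 1

lemma continuousOn_chartOne : ContinuousOn (chartOne n G) (chartOne n G).source :=
  continuousOn_extChartAt 1

lemma localMul_left {x : EuclideanSpace ℝ (Fin n)} (hx : x ∈ (chartOne n G).target) :
    localMul G (x, origin n G) = x := by
  simp [localMul, (chartOne n G).right_inv hx]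

lemma localMul_right {x : EuclideanSpace ℝ (Fin n)} (hx : x ∈ (chartOne n G).target) :
    localMul G (origin n G, x) = x := by
  simp [localMul, (chartOne n G).right_inv hx]

variable (n G) in
/-- The domain of the local multiplication. -/
def localMulDomain : Set (EuclideanSpace ℝ (Fin n) × EuclideanSpace ℝ (Fin n)) :=
  ((chartOne n G).target ×ˢ (chartOne n G).target) ∩
    (fun p => (chartOne n G).symm p.1 * (chartOne n G).symm p.2) ⁻¹' (chartOne n G).source

lemma left_mem_localMulDomain {x : EuclideanSpace ℝ (Fin n)} (hx : x ∈ (chartOne n G).target) :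
    (x, origin n G) ∈ localMulDomain n G :=
  ⟨⟨hx, origin_mem_target⟩, by simpa using (chartOne n G).map_target hx⟩

lemma right_mem_localMulDomain {x : EuclideanSpace ℝ (Fin n)} (hx : x ∈ (chartOne n G).target) :
    (origin n G, x) ∈ localMulDomain n G :=
  ⟨⟨origin_mem_target, hx⟩, by simpa using (chartOne n G).map_target hx⟩

lemma isOpen_localMulDomain [IsTopologicalGroup G] : IsOpen (localMulDomain n G) := by
  refine ContinuousOn.isOpen_inter_preimage ?_
    (isOpen_chartOne_target.prod isOpen_chartOne_target) isOpen_chartOne_source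
  exact (continuousOn_chartOne_symm.comp continuousOn_fst fun p hp => hp.1).mul
    (continuousOn_chartOne_symm.comp continuousOn_snd fun p hp => hp.2)

variable [IsTopologicalGroup G] [LieGroup (𝓡 n) ∞ G]

lemma contMDiffOn_chartOne_symm :
    ContMDiffOn 𝓘(ℝ, EuclideanSpace ℝ (Fin n)) (𝓡 n) ∞ (chartOne n G).symm
      (chartOne n G).target :=
  contMDiffOn_extChartAt_symm 1

lemma contMDiffOn_chartOne :
    ContMDiffOn (𝓡 n) 𝓘(ℝ, EuclideanSpace ℝ (Fin n)) ∞ (chartOne n G) (chartOne n G).source := by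
  have := contMDiffOn_extChartAt (I := 𝓡 n) (n := ∞) (x := (1 : G))
  rwa [← extChartAt_source (𝓡 n)] at this

lemma contDiffOn_localMul : ContDiffOn ℝ ∞ (localMul G) (localMulDomain n G) := by
  rw [← contMDiffOn_iff_contDiffOn]
  refine contMDiffOn_chartOne.comp (t := (chartOne n G).source) (ContMDiffOn.mul
    (contMDiffOn_chartOne_symm.comp contDiff_fst.contMDiff.contMDiffOn ?_)
    (contMDiffOn_chartOne_symm.comp contDiff_snd.contMDiff.contMDiffOn ?_)) ?_
  · exact fun p hp => hp.1.1
  · exact fun p hp => hp.1.2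
  · exact fun p hp => hp.2

lemma contDiffAt_localMul_left {x : EuclideanSpace ℝ (Fin n)} (hx : x ∈ (chartOne n G).target) :
    ContDiffAt ℝ ∞ (localMul G) (x, origin n G) :=
  contDiffOn_localMul.contDiffAt (isOpen_localMulDomain.mem_nhds (left_mem_localMulDomain hx))

lemma contDiffOn_localField : ContDiffOn ℝ ∞ (localField G) (chartOne n G).target := by
  intro x hx
  have h := (contDiffAt_localMul_left hx).fderiv_right (m := ∞) (by simp)
  have h2 : ContDiffAt ℝ ∞ (fun x => fderiv ℝ (localMul G) (x, origin n G)) x :=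
    ContDiffAt.comp x (f := fun x => (x, origin n G)) h (by fun_prop)
  exact (h2.clm_comp contDiffAt_const).contDiffWithinAt

lemma localField_origin : localField G (origin n G) = ContinuousLinearMap.id ℝ _ := by
  have h1 := ((contDiffAt_localMul_left (origin_mem_target (n := n) (G := G))).differentiableAt
    (by simp)).hasFDerivAt
  have h2 := h1.comp (origin n G) (hasFDerivAt_prodMk_right (𝕜 := ℝ) (origin n G) (origin n G))
  have h3 : (localMul G ∘ fun y => (origin n G, y)) =ᶠ[𝓝 (origin n G)] id := by
    filter_upwards [isOpen_chartOne_target.mem_nhds origin_mem_target] with y hy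
    exact localMul_right hy
  exact h2.unique ((hasFDerivAt_id _).congr_of_eventuallyEq h3)

lemma mdifferentiableAt_chartOne_symm {x : EuclideanSpace ℝ (Fin n)}
    (hx : x ∈ (chartOne n G).target) :
    MDifferentiableAt 𝓘(ℝ, EuclideanSpace ℝ (Fin n)) (𝓡 n) (chartOne n G).symm x :=
  (contMDiffOn_chartOne_symm.contMDiffAt (isOpen_chartOne_target.mem_nhds hx)).mdifferentiableAt
    (by simp)

lemma mfderiv_chartOne_symm_origin (X : EuclideanSpace ℝ (Fin n)) :
    (mfderiv 𝓘(ℝ, EuclideanSpace ℝ (Fin n)) (𝓡 n) (chartOne n G).symm (origin n G) :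
      EuclideanSpace ℝ (Fin n) →L[ℝ] EuclideanSpace ℝ (Fin n)) X = X := by
  have h := mfderivWithin_range_extChartAt_symm (I := 𝓡 n) (x := (1 : G))
  rw [ModelWithCorners.range_eq_univ, mfderivWithin_univ] at h
  exact congrArg (fun L : EuclideanSpace ℝ (Fin n) →L[ℝ] EuclideanSpace ℝ (Fin n) => L X) h

/-- Near the origin the inverse chart intertwines `y ↦ localMul (x, y)` with left translation by the
point with coordinate `x`; this is the derivative of that relation. -/
lemma mfderiv_chartOne_symm_localField {x : EuclideanSpace ℝ (Fin n)}
    (hx : x ∈ (chartOne n G).target) (X : EuclideanSpace ℝ (Fin n)) :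
    mfderiv 𝓘(ℝ, EuclideanSpace ℝ (Fin n)) (𝓡 n) (chartOne n G).symm x (localField G x X) =
      mulInvariantVectorField (I := 𝓡 n) (G := G) X ((chartOne n G).symm x) := by
  set e := chartOne n G
  set a := origin n G
  have hea : e.symm a = 1 := chartOne_symm_origin
  have h1 := ((contDiffAt_localMul_left hx).differentiableAt (by simp)).hasFDerivAt
  have h2 := (h1.comp a (hasFDerivAt_prodMk_right (𝕜 := ℝ) x a)).hasMFDerivAt
  have h3 : HasMFDerivAt 𝓘(ℝ, EuclideanSpace ℝ (Fin n)) (𝓡 n) e.symm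
      ((localMul G ∘ fun y => (x, y)) a) (mfderiv 𝓘(ℝ, EuclideanSpace ℝ (Fin n)) (𝓡 n) e.symm x) := by
    have : (localMul G ∘ fun y => (x, y)) a = x := localMul_left hx
    rw [this]
    exact (mdifferentiableAt_chartOne_symm hx).hasMFDerivAt
  have h4 := h3.comp a h2
  have h5 : MDifferentiableAt (𝓡 n) (𝓡 n) (fun y => e.symm x * y) (e.symm a) :=
    (contMDiff_mul_left (n := ∞)).mdifferentiableAt (by simp)
  have h6 := h5.hasMFDerivAt.comp a (mdifferentiableAt_chartOne_symm origin_mem_target).hasMFDerivAt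
  have h7 : (e.symm ∘ (localMul G ∘ fun y => (x, y))) =ᶠ[𝓝 a] ((fun y => e.symm x * y) ∘ e.symm) := by
    have hop : ∀ᶠ y in 𝓝 a, (x, y) ∈ localMulDomain n G :=
      (Continuous.prodMk_right x).continuousAt.preimage_mem_nhds
        (isOpen_localMulDomain.mem_nhds (left_mem_localMulDomain hx))
    filter_upwards [hop] with y hy
    exact e.left_inv hy.2
  have h8 := hasMFDerivAt_unique (h4.congr_of_eventuallyEq h7.symm) h6
  have h9 := congrArg (fun L : EuclideanSpace ℝ (Fin n) →L[ℝ] EuclideanSpace ℝ (Fin n) => L X) h8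
  have h10 := mfderiv_chartOne_symm_origin (n := n) (G := G) X
  refine h9.trans ?_
  change (mfderiv (𝓡 n) (𝓡 n) (fun y => e.symm x * y) (e.symm a) :
    EuclideanSpace ℝ (Fin n) →L[ℝ] EuclideanSpace ℝ (Fin n))
    ((mfderiv 𝓘(ℝ, EuclideanSpace ℝ (Fin n)) (𝓡 n) e.symm a :
      EuclideanSpace ℝ (Fin n) →L[ℝ] EuclideanSpace ℝ (Fin n)) X) = _
  rw [h10, hea]
  rfl

end Chart

/-! ### Local integral curves of left invariant fields -/

section Exponential

variable {n : ℕ} {G : Type*} [TopologicalSpace G] [ChartedSpace (EuclideanSpace ℝ (Fin n)) G]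
  [Group G] [IsTopologicalGroup G] [LieGroup (𝓡 n) ∞ G]

local notation "𝔼" => EuclideanSpace ℝ (Fin n)

lemma comp_smulRight_one {F F' : Type*} [NormedAddCommGroup F] [NormedSpace ℝ F]
    [NormedAddCommGroup F'] [NormedSpace ℝ F'] (A : F →L[ℝ] F') (v : F) :
    A.comp ((1 : ℝ →L[ℝ] ℝ).smulRight v) = (1 : ℝ →L[ℝ] ℝ).smulRight (A v) := by
  ext
  simp

/-- The vector `X` is carried as a second coordinate with zero derivative, so a single
Picard–Lindelöf flow near `(origin, 0)` serves all small `X`. The curve for `X` is the curve for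
`η⁻¹ X` run at speed `η`, which makes the interval `(-2, 2)` available. -/
lemma exists_local_curve {N : Set 𝔼} (hN : N ∈ 𝓝 (origin n G)) :
    ∃ ρ > 0, ∀ X : 𝔼, ‖X‖ ≤ ρ → ∃ c : ℝ → 𝔼, c 0 = origin n G ∧
      ∀ t ∈ Ioo (-2 : ℝ) 2, c t ∈ N ∧ HasDerivAt c (localField G (c t) X) t := by
  have hF : ContDiffAt ℝ 1 (fun p : 𝔼 × 𝔼 => ((localField G p.1 p.2, 0) : 𝔼 × 𝔼))
      (origin n G, 0) := by
    have h1 : ContDiffAt ℝ 1 (localField G) (origin n G) :=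
      (contDiffOn_localField.contDiffAt
        (isOpen_chartOne_target.mem_nhds origin_mem_target)).of_le (by simp)
    have h2 : ContDiffAt ℝ 1 (fun p : 𝔼 × 𝔼 => localField G p.1) (origin n G, 0) :=
      ContDiffAt.comp (g := localField G) _ (f := Prod.fst) h1 contDiffAt_fst
    exact (h2.clm_apply contDiffAt_snd).prodMk contDiffAt_const
  obtain ⟨ε, hε, A, r, L, K, hr, hpl⟩ := IsPicardLindelof.of_contDiffAt_one hF
  obtain ⟨α, hα, hαc⟩ := (hpl 0).exists_forall_mem_closedBall_eq_hasDerivWithinAt_continuousOn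
  have hcont : ContinuousAt α ((origin n G, 0), 0) := by
    refine hαc.continuousAt (prod_mem_nhds (Metric.closedBall_mem_nhds _ (by exact_mod_cast hr)) ?_)
    exact Icc_mem_nhds (by simpa using hε) (by simpa using hε)
  have h0 : α ((origin n G, 0), 0) = (origin n G, 0) :=
    (hα _ (Metric.mem_closedBall_self r.2)).1
  have hN' : (Prod.fst : 𝔼 × 𝔼 → 𝔼) ⁻¹' N ∈ 𝓝 (α ((origin n G, 0), 0)) := by
    rw [h0]
    exact continuous_fst.continuousAt.preimage_mem_nhds hN
  obtain ⟨δ, hδ, hball⟩ := Metric.mem_nhds_iff.1 (hcont.preimage_mem_nhds hN')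
  set η := min δ (min ε r) / 4
  have hr' : (0 : ℝ) < r := by exact_mod_cast hr
  have hη : 0 < η := by positivity
  have hm : 4 * η = min δ (min ε r) := by simp only [η]; ring
  have hηδ : 4 * η ≤ δ := hm.le.trans (min_le_left _ _)
  have hηε : 4 * η ≤ ε := hm.le.trans ((min_le_right _ _).trans (min_le_left _ _))
  have hηr : 4 * η ≤ r := hm.le.trans ((min_le_right _ _).trans (min_le_right _ _))
  refine ⟨η * η, by positivity, fun X hX => ?_⟩
  set Y := η⁻¹ • X
  have hY : ‖Y‖ ≤ η := by
    rw [norm_smul, norm_inv, Real.norm_of_nonneg hη.le, inv_mul_le_iff₀ hη]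
    exact hX
  have hmem : ((origin n G, Y) : 𝔼 × 𝔼) ∈ Metric.closedBall (origin n G, (0 : 𝔼)) r := by
    rw [Metric.mem_closedBall, dist_prod_same_left, dist_zero_right]
    linarith
  obtain ⟨hα0, hαd⟩ := hα _ hmem
  have hd : ∀ t ∈ Ioo (-ε) ε, HasDerivAt (fun t => α ((origin n G, Y), t))
      (localField G (α ((origin n G, Y), t)).1 (α ((origin n G, Y), t)).2, 0) t := by
    intro t ht
    have ht' : t ∈ Icc (0 - ε) (0 + ε) := ⟨by linarith [ht.1], by linarith [ht.2]⟩
    exact (hαd t ht').hasDerivAt (Icc_mem_nhds (by linarith [ht.1]) (by linarith [ht.2]))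
  have hsnd : ∀ t ∈ Ioo (-ε) ε, (α ((origin n G, Y), t)).2 = Y := by
    intro t ht
    have h1 : ∀ u ∈ Ioo (-ε) ε, HasDerivAt (fun t => (α ((origin n G, Y), t)).2) 0 u :=
      fun u hu => (hd u hu).snd
    have h2 := (isOpen_Ioo (a := -ε) (b := ε)).is_const_of_deriv_eq_zero isPreconnected_Ioo
      (fun u hu => (h1 u hu).differentiableAt.differentiableWithinAt)
      (fun u hu => (h1 u hu).deriv) ht (⟨by linarith, hε⟩ : (0 : ℝ) ∈ Ioo (-ε) ε)
    simpa [hα0] using h2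
  refine ⟨fun t => (α ((origin n G, Y), η * t)).1, by simp [hα0], fun t ht => ?_⟩
  have habs : |η * t| < 2 * η := by
    rw [abs_mul, abs_of_pos hη, mul_comm]
    exact mul_lt_mul_of_pos_right (abs_lt.2 ⟨ht.1, ht.2⟩) hη
  have htε : η * t ∈ Ioo (-ε) ε := abs_lt.1 (by linarith)
  have hmb : ((origin n G, Y), η * t) ∈ Metric.ball (((origin n G, 0), 0) : (𝔼 × 𝔼) × ℝ) δ := by
    rw [Metric.mem_ball, Prod.dist_eq, Prod.dist_eq, dist_self, dist_zero_right, dist_zero_right,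
      Real.norm_eq_abs]
    exact max_lt (max_lt hδ (by linarith)) (by linarith)
  refine ⟨hball hmb, ?_⟩
  have h1 := (hd _ htε).fst
  rw [hsnd _ htε] at h1
  have h2 := HasDerivAt.scomp t h1 ((hasDerivAt_id t).const_mul η)
  have h3 : (η * 1) • localField G (α ((origin n G, Y), η * t)).1 Y =
      localField G (α ((origin n G, Y), η * t)).1 X := by
    simp [Y, hη.ne']
  exact h3 ▸ h2

lemma contMDiff_leftInvariant (X : 𝔼) :
    ContMDiff (𝓡 n) (𝓡 n).tangent 1
      (fun g : G => (⟨g, mulInvariantVectorField (I := 𝓡 n) (G := G) X g⟩ : TangentBundle (𝓡 n) G)) :=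
  (contMDiff_mulInvariantVectorField (I := 𝓡 n) (G := G) X).of_le (by
    rw [minSmoothness_of_isRCLikeNormedField]; norm_num)

lemma mulInvariantVectorField_mul (X : 𝔼) (g h : G) :
    mulInvariantVectorField (I := 𝓡 n) (G := G) X (g * h) =
      mfderiv (𝓡 n) (𝓡 n) (g * ·) h (mulInvariantVectorField (I := 𝓡 n) (G := G) X h) := by
  have h1 : MDifferentiableAt (𝓡 n) (𝓡 n) (g * · : G → G) (h * 1) :=
    (contMDiff_mul_left (n := ∞)).mdifferentiableAt (by simp)
  have h2 : MDifferentiableAt (𝓡 n) (𝓡 n) (h * · : G → G) 1 :=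
    (contMDiff_mul_left (n := ∞)).mdifferentiableAt (by simp)
  have h3 := mfderiv_comp (1 : G) h1 h2
  have h4 : ((g * · : G → G) ∘ (h * ·)) = (g * h * ·) := by ext x; simp [mul_assoc]
  rw [h4] at h3
  have h5 := congrArg (fun L : 𝔼 →L[ℝ] 𝔼 => L X) h3
  rw [mul_one] at h5
  exact h5

lemma IsMIntegralCurveOn.mul_left {X : 𝔼} {γ : ℝ → G} {s : Set ℝ}
    (hγ : IsMIntegralCurveOn γ (mulInvariantVectorField (I := 𝓡 n) (G := G) X) s) (g : G) :
    IsMIntegralCurveOn (fun t => g * γ t) (mulInvariantVectorField (I := 𝓡 n) (G := G) X) s := by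
  intro t ht
  have h1 : MDifferentiableAt (𝓡 n) (𝓡 n) (g * · : G → G) (γ t) :=
    (contMDiff_mul_left (n := ∞)).mdifferentiableAt (by simp)
  have h2 := h1.hasMFDerivAt.comp_hasMFDerivWithinAt t (hγ t ht)
  rw [mulInvariantVectorField_mul]
  refine h2.congr_mfderiv ?_
  exact comp_smulRight_one (F := 𝔼) (F' := 𝔼) _ _

end Exponential

/-! ### The exponential map and one-parameter subgroups -/

section OneParameter

variable {n : ℕ} {G : Type*} [TopologicalSpace G] [ChartedSpace (EuclideanSpace ℝ (Fin n)) G]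
  [Group G] [IsTopologicalGroup G] [LieGroup (𝓡 n) ∞ G]

local notation "𝔼" => EuclideanSpace ℝ (Fin n)

lemma isMIntegralCurveOn_of_hasDerivAt {X : 𝔼} {c : ℝ → 𝔼} {s : Set ℝ}
    (hc : ∀ t ∈ s, c t ∈ (chartOne n G).target ∧ HasDerivAt c (localField G (c t) X) t) :
    IsMIntegralCurveOn (fun t => (chartOne n G).symm (c t))
      (mulInvariantVectorField (I := 𝓡 n) (G := G) X) s := by
  intro t ht
  obtain ⟨h1, h2⟩ := hc t ht
  have h3 := ((mdifferentiableAt_chartOne_symm h1).hasMFDerivAt.comp t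
    h2.hasFDerivAt.hasMFDerivAt).hasMFDerivWithinAt (s := s)
  rw [← mfderiv_chartOne_symm_localField h1]
  refine h3.congr_mfderiv ?_
  exact comp_smulRight_one (F := 𝔼) (F' := 𝔼) _ _

variable [T2Space G]

/-- Left translation moves the local curve through `1` to any point without shortening its lifetime,
and a field with a uniform existence time is complete. -/
lemma exists_isMIntegralCurve_of_small {ρ : ℝ}
    (hρ : ∀ X : 𝔼, ‖X‖ ≤ ρ → ∃ c : ℝ → 𝔼, c 0 = origin n G ∧
      ∀ t ∈ Ioo (-2 : ℝ) 2, c t ∈ (chartOne n G).target ∧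
        HasDerivAt c (localField G (c t) X) t) {X : 𝔼} (hX : ‖X‖ ≤ ρ) :
    ∃ γ : ℝ → G, γ 0 = 1 ∧
      IsMIntegralCurve γ (mulInvariantVectorField (I := 𝓡 n) (G := G) X) := by
  refine exists_isMIntegralCurve_of_isMIntegralCurveOn (contMDiff_leftInvariant X)
    (ε := 2) (by norm_num) (fun x => ?_) 1
  obtain ⟨c, hc0, hc⟩ := hρ X hX
  refine ⟨fun t => x * (chartOne n G).symm (c t), by simp [hc0], ?_⟩
  exact IsMIntegralCurveOn.mul_left (isMIntegralCurveOn_of_hasDerivAt hc) x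

lemma IsMIntegralCurve.smul {X : 𝔼} {γ : ℝ → G}
    (hγ : IsMIntegralCurve γ (mulInvariantVectorField (I := 𝓡 n) (G := G) X)) (a : ℝ) :
    IsMIntegralCurve (fun t => γ (t * a))
      (mulInvariantVectorField (I := 𝓡 n) (G := G) (a • X)) := by
  have h := hγ.comp_mul a
  have h2 := mulInvariantVectorField_smul (I := 𝓡 n) (G := G) a X
  rw [← h2] at h
  exact h

lemma exists_small_smul {ρ : ℝ} (hρ : 0 < ρ) (X : 𝔼) :
    ∃ (a : ℝ) (Y : 𝔼), a ≠ 0 ∧ ‖Y‖ ≤ ρ ∧ a • Y = X := by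
  refine ⟨(‖X‖ + 1) / ρ, ((‖X‖ + 1) / ρ)⁻¹ • X, by positivity, ?_, ?_⟩
  · rw [norm_smul, norm_inv, Real.norm_of_nonneg (by positivity), inv_mul_le_iff₀ (by positivity),
      div_mul_cancel₀ _ hρ.ne']
    linarith
  · rw [smul_smul, mul_inv_cancel₀ (by positivity), one_smul]

lemma exists_small_smul' {ρ : ℝ} (hρ : 0 < ρ) (X : RealLie n G) :
    ∃ (a : ℝ) (Y : RealLie n G), a ≠ 0 ∧ norm (E := 𝔼) Y ≤ ρ ∧ a • Y = X :=
  exists_small_smul hρ X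

lemma exists_isMIntegralCurve (X : 𝔼) :
    ∃ γ : ℝ → G, γ 0 = 1 ∧
      IsMIntegralCurve γ (mulInvariantVectorField (I := 𝓡 n) (G := G) X) := by
  obtain ⟨ρ, hρ, h⟩ := exists_local_curve (n := n) (G := G)
    (isOpen_chartOne_target.mem_nhds origin_mem_target)
  obtain ⟨a, Y, -, hY, rfl⟩ := exists_small_smul hρ X
  obtain ⟨γ, h0, hγ⟩ := exists_isMIntegralCurve_of_small h hY
  exact ⟨fun t => γ (t * a), by simpa using h0, IsMIntegralCurve.smul hγ a⟩

lemma isMIntegralCurve_unique {X : 𝔼} {γ γ' : ℝ → G} (h : γ 0 = γ' 0)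
    (hγ : IsMIntegralCurve γ (mulInvariantVectorField (I := 𝓡 n) (G := G) X))
    (hγ' : IsMIntegralCurve γ' (mulInvariantVectorField (I := 𝓡 n) (G := G) X)) : γ = γ' :=
  isMIntegralCurve_Ioo_eq_of_contMDiff_boundaryless (contMDiff_leftInvariant X) hγ hγ' h

/-- The exponential map of a Lie group. -/
def lieExp (X : RealLie n G) : G := (exists_isMIntegralCurve (n := n) (G := G) X).choose 1

lemma lieExp_smul_eq {X : RealLie n G} {γ : ℝ → G} (h0 : γ 0 = 1)
    (hγ : IsMIntegralCurve γ (mulInvariantVectorField (I := 𝓡 n) (G := G) X)) (t : ℝ) :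
    lieExp (t • X) = γ t := by
  obtain ⟨h1, h2⟩ := (exists_isMIntegralCurve (n := n) (G := G) (t • X : 𝔼)).choose_spec
  have h3 := IsMIntegralCurve.smul hγ t
  have h4 := isMIntegralCurve_unique (by simp [h1, h0]) h2 h3
  have h5 := congrFun h4 1
  rw [one_mul] at h5
  exact h5

lemma isMIntegralCurve_lieExp (X : RealLie n G) :
    IsMIntegralCurve (fun t : ℝ => (lieExp (t • X) : G))
      (mulInvariantVectorField (I := 𝓡 n) (G := G) X) := by
  obtain ⟨γ, h0, hγ⟩ := exists_isMIntegralCurve (n := n) (G := G) X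
  have : (fun t : ℝ => (lieExp (t • X) : G)) = γ := funext fun t => lieExp_smul_eq h0 hγ t
  rwa [this]

@[simp] lemma lieExp_zero : lieExp (0 : RealLie n G) = 1 := by
  obtain ⟨γ, h0, hγ⟩ := exists_isMIntegralCurve (n := n) (G := G) 0
  have := lieExp_smul_eq (X := (0 : RealLie n G)) h0 hγ 0
  rwa [h0, zero_smul] at this

/-- As functions of `t`, both sides are integral curves of the same field with the same value at
`0`. -/
lemma lieExp_add_smul (X : RealLie n G) (s t : ℝ) :
    lieExp ((s + t) • X) = lieExp (s • X) * lieExp (t • X) := by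
  have h1 : IsMIntegralCurve (fun u : ℝ => (lieExp ((u + s) • X) : G))
      (mulInvariantVectorField (I := 𝓡 n) (G := G) X) := (isMIntegralCurve_lieExp X).comp_add s
  have h2 : IsMIntegralCurve (fun u : ℝ => lieExp (s • X) * lieExp (u • X))
      (mulInvariantVectorField (I := 𝓡 n) (G := G) X) :=
    isMIntegralCurve_iff_isMIntegralCurveOn.2 (IsMIntegralCurveOn.mul_left
      (isMIntegralCurve_iff_isMIntegralCurveOn.1 (isMIntegralCurve_lieExp X)) _)
  have h3 := isMIntegralCurve_unique (by simp) h1 h2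
  rw [add_comm]
  exact congrFun h3 t

lemma mfderiv_lieExp_smul (X : RealLie n G) :
    (mfderiv 𝓘(ℝ, ℝ) (𝓡 n) (fun t : ℝ => (lieExp (t • X) : G)) 0 (1 : ℝ) : 𝔼) = X := by
  have h := (isMIntegralCurve_lieExp X 0).mfderiv
  have h2 := congrArg (fun A : ℝ →L[ℝ] 𝔼 => A 1) h
  refine h2.trans ?_
  have h3 : mulInvariantVectorField (I := 𝓡 n) (G := G) X 1 = X := by
    have key : ∀ f : G → G, f = id → (mfderiv (𝓡 n) (𝓡 n) f 1 : 𝔼 →L[ℝ] 𝔼) X = X := by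
      rintro _ rfl
      exact congrArg (fun A : 𝔼 →L[ℝ] 𝔼 => A X) (mfderiv_id (I := 𝓡 n) (x := (1 : G)))
    exact key (fun b => 1 * b) (funext one_mul)
  have h4 : (lieExp ((0 : ℝ) • X) : G) = 1 := by rw [zero_smul, lieExp_zero]
  have h5 : ∀ g : G, g = 1 → (mulInvariantVectorField (I := 𝓡 n) (G := G) X g : 𝔼) = X := by
    rintro _ rfl
    exact h3
  have h6 : ((1 : ℝ →L[ℝ] ℝ).smulRight
      (mulInvariantVectorField (I := 𝓡 n) (G := G) X (lieExp ((0 : ℝ) • X)) : 𝔼)) 1 = X := by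
    rw [ContinuousLinearMap.smulRight_apply, one_apply_eq_self, one_smul, h5 _ h4]
  exact h6

lemma eqOn_lieExp_of_curve {X : RealLie n G} {c : ℝ → 𝔼} (hc0 : c 0 = origin n G)
    (hc : ∀ t ∈ Ioo (-2 : ℝ) 2, c t ∈ (chartOne n G).target ∧
        HasDerivAt c (localField G (c t) X) t) :
    EqOn (fun t : ℝ => (lieExp (t • X) : G)) (fun t => (chartOne n G).symm (c t))
      (Ioo (-2 : ℝ) 2) := by
  refine isMIntegralCurveOn_Ioo_eqOn_of_contMDiff_boundaryless (t₀ := 0)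
    ⟨by norm_num, by norm_num⟩ (contMDiff_leftInvariant X)
    ((isMIntegralCurve_lieExp X).isMIntegralCurveOn _)
    (isMIntegralCurveOn_of_hasDerivAt hc) ?_
  simp only [hc0, chartOne_symm_origin]
  rw [zero_smul, lieExp_zero]

/-- For small `X` the curve solves a smooth equation in the chart, so it is smooth near time `0`;
the homomorphism property carries this to all times, and rescaling time to all `X`. -/
lemma contMDiff_lieExp_smul (X : RealLie n G) :
    ContMDiff 𝓘(ℝ, ℝ) (𝓡 n) ∞ (fun t : ℝ => (lieExp (t • X) : G)) := by
  obtain ⟨ρ, hρ, h⟩ := exists_local_curve (n := n) (G := G)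
    (isOpen_chartOne_target.mem_nhds origin_mem_target)
  obtain ⟨a, Y, ha, hY, rfl⟩ := exists_small_smul' hρ X
  obtain ⟨c, hc0, hc⟩ := h Y hY
  have hsub : Icc (-1 : ℝ) 1 ⊆ Ioo (-2) 2 := fun t ht => ⟨by linarith [ht.1], by linarith [ht.2]⟩
  have hcs : ContDiffOn ℝ ∞ c (Icc (-1 : ℝ) 1) := by
    refine ODE.contDiffOn_enat_Icc_of_hasDerivWithinAt (n := ⊤) (f := fun _ x => localField G x Y)
      (u := (chartOne n G).target) ?_ (fun t ht => (hc t (hsub ht)).2.hasDerivWithinAt)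
      (fun t ht => (hc t (hsub ht)).1)
    exact (contDiffOn_localField.comp contDiffOn_snd fun p hp => hp.2).clm_apply contDiffOn_const
  have hγ0 : ContMDiffOn 𝓘(ℝ, ℝ) (𝓡 n) ∞ (fun t => (chartOne n G).symm (c t)) (Icc (-1 : ℝ) 1) :=
    contMDiffOn_chartOne_symm.comp hcs.contMDiffOn fun t ht => (hc t (hsub ht)).1
  have heq := eqOn_lieExp_of_curve hc0 hc
  have h0 : ContMDiffAt 𝓘(ℝ, ℝ) (𝓡 n) ∞ (fun t : ℝ => (lieExp (t • Y) : G)) 0 := by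
    refine (hγ0.contMDiffAt (Icc_mem_nhds (by norm_num) (by norm_num))).congr_of_eventuallyEq ?_
    exact heq.eventuallyEq_of_mem (Ioo_mem_nhds (by norm_num) (by norm_num))
  have hY' : ContMDiff 𝓘(ℝ, ℝ) (𝓡 n) ∞ (fun t : ℝ => (lieExp (t • Y) : G)) := by
    intro s
    have e : (fun t : ℝ => (lieExp (t • Y) : G)) =
        (fun t => lieExp (s • Y) * lieExp ((t - s) • Y)) := by
      ext t
      have := lieExp_add_smul (n := n) (G := G) Y s (t - s)
      rwa [add_sub_cancel] at this
    rw [e]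
    have hm : ContMDiff 𝓘(ℝ, ℝ) 𝓘(ℝ, ℝ) ∞ fun t : ℝ => t - s :=
      (contDiff_id.sub contDiff_const).contMDiff
    have h1 : ContMDiffAt 𝓘(ℝ, ℝ) (𝓡 n) ∞ (fun t : ℝ => (lieExp (t • Y) : G)) (s - s) := by
      rwa [sub_self]
    have h2 := ContMDiffAt.comp s (f := fun t => t - s) h1 hm.contMDiffAt
    have hl : ContMDiff (𝓡 n) (𝓡 n) ∞ (lieExp (s • Y) * · : G → G) := contMDiff_mul_left
    exact hl.contMDiffAt.comp s h2
  have e : (fun t : ℝ => (lieExp (t • a • Y) : G)) =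
      (fun t : ℝ => (lieExp (t • Y) : G)) ∘ fun t => t * a := by
    ext t
    exact congrArg lieExp (smul_smul t a Y)
  rw [e]
  have hm : ContMDiff 𝓘(ℝ, ℝ) 𝓘(ℝ, ℝ) ∞ fun t : ℝ => t * a :=
    (contDiff_id.mul contDiff_const).contMDiff
  exact hY'.comp hm

/-- Translation by `γ t` carries the curve at time `0` to the curve at time `t`, so
differentiability at `0` is enough. -/
lemma isMIntegralCurve_of_hom {γ : ℝ → G} (hγ : MDifferentiableAt 𝓘(ℝ, ℝ) (𝓡 n) γ 0)
    (hadd : ∀ s t, γ (s + t) = γ s * γ t) :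
    IsMIntegralCurve γ (mulInvariantVectorField (I := 𝓡 n) (G := G)
      (mfderiv 𝓘(ℝ, ℝ) (𝓡 n) γ 0 (1 : ℝ) : 𝔼)) := by
  have h0 : γ 0 = 1 := by simpa using hadd 0 0
  intro t
  have e : γ = (γ t * ·) ∘ (γ ∘ fun u => u - t) := by
    ext u
    simp [← hadd]
  have h1 : HasMFDerivAt 𝓘(ℝ, ℝ) (𝓡 n) γ (t - t) (mfderiv 𝓘(ℝ, ℝ) (𝓡 n) γ 0) := by
    rw [sub_self]
    exact hγ.hasMFDerivAt
  have h2 : HasMFDerivAt 𝓘(ℝ, ℝ) 𝓘(ℝ, ℝ) (fun u => u - t) t (ContinuousLinearMap.id ℝ ℝ) :=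
    ((hasFDerivAt_id t).sub_const t).hasMFDerivAt
  have h3 := HasMFDerivAt.comp t (g := γ) (f := fun u => u - t) h1 h2
  have h4 : MDifferentiableAt (𝓡 n) (𝓡 n) (γ t * · : G → G) 1 :=
    (contMDiff_mul_left (n := ∞)).mdifferentiableAt (by simp)
  have h5 : HasMFDerivAt (𝓡 n) (𝓡 n) (γ t * · : G → G) ((γ ∘ fun u => u - t) t)
      (mfderiv (𝓡 n) (𝓡 n) (γ t * · : G → G) 1) := by
    have : (γ ∘ fun u => u - t) t = 1 := by simp [h0]
    rw [this]
    exact h4.hasMFDerivAt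
  have h6 := h5.comp t h3
  rw [← e] at h6
  refine h6.congr_mfderiv ?_
  have : ∀ (A : 𝔼 →L[ℝ] 𝔼) (B : ℝ →L[ℝ] 𝔼), A.comp (B.comp (ContinuousLinearMap.id ℝ ℝ)) =
      (1 : ℝ →L[ℝ] ℝ).smulRight (A (B 1)) := fun A B => by ext; simp
  exact this _ _

lemma eq_lieExp_of_hom {γ : ℝ → G} (hγ : MDifferentiableAt 𝓘(ℝ, ℝ) (𝓡 n) γ 0)
    (hadd : ∀ s t, γ (s + t) = γ s * γ t) {X : RealLie n G}
    (hX : (mfderiv 𝓘(ℝ, ℝ) (𝓡 n) γ 0 (1 : ℝ) : 𝔼) = X) (t : ℝ) : γ t = lieExp (t • X) := by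
  subst hX
  exact (lieExp_smul_eq (by simpa using hadd 0 0) (isMIntegralCurve_of_hom hγ hadd) t).symm

lemma isVelocityIn_iff {H : Subgroup G} {X : RealLie n G} :
    IsVelocityIn n H X ↔ ∀ t : ℝ, lieExp (t • X) ∈ H := by
  constructor
  · rintro ⟨γ, hγ, hadd, hmem, hX⟩ t
    rw [← eq_lieExp_of_hom (hγ.mdifferentiableAt (by simp)) hadd hX]
    exact hmem t
  · intro h
    exact ⟨fun t => lieExp (t • X), contMDiff_lieExp_smul X, lieExp_add_smul X, h,
      mfderiv_lieExp_smul X⟩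

lemma map_lieExp {μ : MulAut G} (hμ : IsLieAut n μ) (X : RealLie n G) :
    μ (lieExp X) = lieExp (differential n μ X) := by
  have h1 : MDifferentiableAt 𝓘(ℝ, ℝ) (𝓡 n) (fun t : ℝ => (lieExp (t • X) : G)) 0 :=
    (contMDiff_lieExp_smul X).mdifferentiableAt (by simp)
  have h2 : MDifferentiableAt (𝓡 n) (𝓡 n) μ (1 : G) := hμ.smooth.mdifferentiableAt (by simp)
  have h3 : HasMFDerivAt (𝓡 n) (𝓡 n) μ ((fun t : ℝ => (lieExp (t • X) : G)) 0)
      (mfderiv (𝓡 n) (𝓡 n) μ (1 : G)) := by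
    have key : ∀ g : G, g = 1 →
        HasMFDerivAt (𝓡 n) (𝓡 n) μ g (mfderiv (𝓡 n) (𝓡 n) μ (1 : G) : 𝔼 →L[ℝ] 𝔼) := by
      rintro _ rfl
      exact h2.hasMFDerivAt
    exact key _ (by simp)
  have h4 := h3.comp 0 h1.hasMFDerivAt
  have h5 := eq_lieExp_of_hom (γ := μ ∘ fun t : ℝ => (lieExp (t • X) : G))
    (X := differential n μ X) h4.mdifferentiableAt (fun s t => by simp [lieExp_add_smul]) ?_ 1
  · simpa using h5
  · rw [h4.mfderiv]
    exact congrArg (differential n μ) (mfderiv_lieExp_smul X)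

end OneParameter

/-! ### The exponential map as a local homeomorphism -/

section LocalExponential

variable {n : ℕ} {G : Type*} [TopologicalSpace G] [ChartedSpace (EuclideanSpace ℝ (Fin n)) G]
  [Group G] [IsTopologicalGroup G] [LieGroup (𝓡 n) ∞ G] [T2Space G]

local notation "𝔼" => EuclideanSpace ℝ (Fin n)

/-- Let `M` be the maximum of `‖c - d‖` on `[0, 1]`. The mean value inequality bounds `‖c t - d t -
t (X - Y)‖` by `ε ‖X - Y‖ + η M`. At the maximum point this yields `M ≤ 4 ‖X - Y‖`, and inserting
that bound at `t = 1` gives the claim. -/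
lemma norm_curve_sub_curve_le {N : Set 𝔼} {K : NNReal} {ε η : ℝ} (hε1 : ε ≤ 1)
    (hη : η ≤ 1 / 2)
    (hN : ∀ x ∈ N, ‖localField G x - ContinuousLinearMap.id ℝ 𝔼‖ ≤ ε)
    (hK : LipschitzOnWith K (localField G) N) {X Y : 𝔼} (hY : K * ‖Y‖ ≤ η) {c d : ℝ → 𝔼}
    (h0 : c 0 = d 0)
    (hc : ∀ t ∈ Ioo (-2 : ℝ) 2, c t ∈ N ∧ HasDerivAt c (localField G (c t) X) t)
    (hd : ∀ t ∈ Ioo (-2 : ℝ) 2, d t ∈ N ∧ HasDerivAt d (localField G (d t) Y) t) :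
    ‖c 1 - d 1 - (X - Y)‖ ≤ (ε + 4 * η) * ‖X - Y‖ := by
  have hsub : Icc (0 : ℝ) 1 ⊆ Ioo (-2) 2 := fun t ht => ⟨by linarith [ht.1], by linarith [ht.2]⟩
  have hcont : ContinuousOn (fun t => ‖c t - d t‖) (Icc (0 : ℝ) 1) := fun t ht =>
    ((hc t (hsub ht)).2.continuousAt.sub
      (hd t (hsub ht)).2.continuousAt).norm.continuousWithinAt
  obtain ⟨t₀, ht₀, hmax⟩ := isCompact_Icc.exists_isMaxOn ⟨0, by simp⟩ hcont
  set M := ‖c t₀ - d t₀‖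
  have hM : ∀ t ∈ Icc (0 : ℝ) 1, ‖c t - d t‖ ≤ M := fun t ht => hmax ht
  have hderiv : ∀ t ∈ Icc (0 : ℝ) 1, HasDerivWithinAt (fun t => c t - d t - t • (X - Y))
      (localField G (c t) X - localField G (d t) Y - (1 : ℝ) • (X - Y)) (Icc (0 : ℝ) 1) t :=
    fun t ht => (((hc t (hsub ht)).2.sub (hd t (hsub ht)).2).sub
      ((hasDerivAt_id t).smul_const (X - Y))).hasDerivWithinAt
  have hbound : ∀ t ∈ Icc (0 : ℝ) 1,
      ‖localField G (c t) X - localField G (d t) Y - (1 : ℝ) • (X - Y)‖ ≤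
        ε * ‖X - Y‖ + η * M := by
    intro t ht
    have e : localField G (c t) X - localField G (d t) Y - (1 : ℝ) • (X - Y) =
        (localField G (c t) - ContinuousLinearMap.id ℝ 𝔼) (X - Y) +
          (localField G (c t) - localField G (d t)) Y := by
      simp only [sub_apply, map_sub, ContinuousLinearMap.id_apply, one_smul]
      abel
    rw [e]
    have h1 := hK.dist_le_mul _ (hc t (hsub ht)).1 _ (hd t (hsub ht)).1
    rw [dist_eq_norm, dist_eq_norm] at h1
    calc _ ≤ ‖localField G (c t) - ContinuousLinearMap.id ℝ 𝔼‖ * ‖X - Y‖ +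
          ‖localField G (c t) - localField G (d t)‖ * ‖Y‖ :=
          (norm_add_le _ _).trans (add_le_add (ContinuousLinearMap.le_opNorm _ _)
            (ContinuousLinearMap.le_opNorm _ _))
      _ ≤ ε * ‖X - Y‖ + (K * M) * ‖Y‖ := by
          gcongr
          · exact hN _ (hc t (hsub ht)).1
          · exact h1.trans (mul_le_mul_of_nonneg_left (hM t ht) K.2)
      _ = ε * ‖X - Y‖ + (K * ‖Y‖) * M := by ring
      _ ≤ _ := by gcongr
  have hmv : ∀ t ∈ Icc (0 : ℝ) 1, ‖c t - d t - t • (X - Y)‖ ≤ ε * ‖X - Y‖ + η * M := by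
    intro t ht
    have h1 := (convex_Icc (0 : ℝ) 1).norm_image_sub_le_of_norm_hasDerivWithin_le hderiv hbound
      (⟨le_rfl, zero_le_one⟩ : (0 : ℝ) ∈ Icc (0 : ℝ) 1) ht
    have h2 : 0 ≤ ε * ‖X - Y‖ + η * M := (norm_nonneg _).trans (hbound t ht)
    simp only [h0, sub_self, zero_smul, sub_zero] at h1
    refine h1.trans (mul_le_of_le_one_right h2 ?_)
    rw [Real.norm_of_nonneg ht.1]
    exact ht.2
  have hM4 : M ≤ 4 * ‖X - Y‖ := by
    have h1 := hmv t₀ ht₀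
    have h2 : M ≤ ‖c t₀ - d t₀ - t₀ • (X - Y)‖ + ‖t₀ • (X - Y)‖ := by
      simpa using norm_add_le (c t₀ - d t₀ - t₀ • (X - Y)) (t₀ • (X - Y))
    have h3 : ‖t₀ • (X - Y)‖ ≤ ‖X - Y‖ := by
      rw [norm_smul, Real.norm_of_nonneg ht₀.1]
      exact mul_le_of_le_one_left (norm_nonneg _) ht₀.2
    have h4 : η * M ≤ 1 / 2 * M := mul_le_mul_of_nonneg_right hη (norm_nonneg _)
    have h5 : ε * ‖X - Y‖ ≤ 1 * ‖X - Y‖ := mul_le_mul_of_nonneg_right hε1 (norm_nonneg _)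
    linarith
  have hη0 : 0 ≤ η := (mul_nonneg K.2 (norm_nonneg Y)).trans hY
  have h1 := hmv 1 ⟨zero_le_one, le_rfl⟩
  rw [one_smul] at h1
  have h2 : η * M ≤ η * (4 * ‖X - Y‖) := mul_le_mul_of_nonneg_left hM4 hη0
  linarith

variable (n G) in
/-- The exponential map read in the chart at the identity. -/
def chartExp (X : 𝔼) : 𝔼 := chartOne n G (lieExp (n := n) (G := G) X)

lemma exists_curve_chartExp {N : Set 𝔼} (hN : N ∈ 𝓝 (origin n G)) :
    ∃ ρ > 0, ∀ X : 𝔼, ‖X‖ ≤ ρ → lieExp (n := n) (G := G) X ∈ (chartOne n G).source ∧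
      ∃ c : ℝ → 𝔼, c 0 = origin n G ∧ chartExp n G X = c 1 ∧
      ∀ t ∈ Ioo (-2 : ℝ) 2, c t ∈ N ∧ HasDerivAt c (localField G (c t) X) t := by
  obtain ⟨ρ, hρ, h⟩ := exists_local_curve (inter_mem hN
    (isOpen_chartOne_target.mem_nhds origin_mem_target))
  refine ⟨ρ, hρ, fun X hX => ?_⟩
  obtain ⟨c, hc0, hc⟩ := h X hX
  have h1 : (1 : ℝ) ∈ Ioo (-2 : ℝ) 2 := by norm_num
  have h2 := eqOn_lieExp_of_curve (G := G) (X := X) hc0 (fun t ht => ⟨(hc t ht).1.2, (hc t ht).2⟩) h1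
  have h3 : lieExp (n := n) (G := G) X = (chartOne n G).symm (c 1) := by
    exact (congrArg lieExp (one_smul ℝ (X : RealLie n G)).symm).trans h2
  refine ⟨?_, c, hc0, ?_, fun t ht => ⟨(hc t ht).1.1, (hc t ht).2⟩⟩
  · rw [h3]
    exact (chartOne n G).map_target (hc 1 h1).1.2
  · rw [chartExp, h3, (chartOne n G).right_inv (hc 1 h1).1.2]

/-- Strict differentiability at the single point `0` suffices for the inverse function theorem, so
smooth dependence of the flow on `X` is not needed. -/
lemma hasStrictFDerivAt_chartExp :
    HasStrictFDerivAt (chartExp n G) (ContinuousLinearMap.id ℝ 𝔼) 0 := by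
  rw [hasStrictFDerivAt_iff_isLittleO, Asymptotics.isLittleO_iff]
  intro ε hε
  have hVat : ContDiffAt ℝ 1 (localField G) (origin n G) :=
    (contDiffOn_localField.contDiffAt
      (isOpen_chartOne_target.mem_nhds origin_mem_target)).of_le (by simp)
  obtain ⟨K, s, hs, hK⟩ := hVat.exists_lipschitzOnWith
  set ε' := min (ε / 2) 1
  have hε' : 0 < ε' := by positivity
  have hnear : {x | ‖localField G x - ContinuousLinearMap.id ℝ 𝔼‖ ≤ ε'} ∈ 𝓝 (origin n G) := by
    have h1 : ContinuousAt (fun x => ‖localField G x - ContinuousLinearMap.id ℝ 𝔼‖) (origin n G) :=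
      (hVat.continuousAt.sub continuousAt_const).norm
    have h2 : ‖localField G (origin n G) - ContinuousLinearMap.id ℝ 𝔼‖ < ε' := by
      rw [localField_origin, sub_self, norm_zero]
      exact hε'
    filter_upwards [h1.eventually_lt_const h2] with x hx using hx.le
  obtain ⟨ρ, hρ, h⟩ := exists_curve_chartExp (inter_mem hnear hs)
  -- `4 * (ε / 8) = ε / 2`, which together with `ε' ≤ ε / 2` adds up to `ε`.
  set η := min (ε / 8) (1 / 2)
  have hη : 0 < η := by positivity
  set δ := min ρ (η / (K + 1))
  have hδ : 0 < δ := by positivity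
  filter_upwards [prod_mem_nhds (Metric.closedBall_mem_nhds (0 : 𝔼) hδ)
    (Metric.closedBall_mem_nhds (0 : 𝔼) hδ)] with p hp
  have hp1 : ‖p.1‖ ≤ δ := by simpa using hp.1
  have hp2 : ‖p.2‖ ≤ δ := by simpa using hp.2
  obtain ⟨-, c, hc0, hc1, hc⟩ := h p.1 (hp1.trans (min_le_left _ _))
  obtain ⟨-, d, hd0, hd1, hd⟩ := h p.2 (hp2.trans (min_le_left _ _))
  have hKp : K * ‖p.2‖ ≤ η := by
    have h1 : ‖p.2‖ ≤ η / (K + 1) := hp2.trans (min_le_right _ _)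
    have hK0 : (0 : ℝ) ≤ K := K.2
    have hK1 : (0 : ℝ) < K + 1 := by linarith
    rw [le_div_iff₀ hK1] at h1
    nlinarith [norm_nonneg p.2]
  have h1 := norm_curve_sub_curve_le (N := {x | ‖localField G x - ContinuousLinearMap.id ℝ 𝔼‖ ≤ ε'} ∩ s)
    (min_le_right _ _) (min_le_right _ _) (fun x hx => hx.1)
    (hK.mono inter_subset_right) hKp (hc0.trans hd0.symm) hc hd
  rw [hc1, hd1]
  refine h1.trans (mul_le_mul_of_nonneg_right ?_ (norm_nonneg _))
  have := min_le_left (ε / 2) 1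
  have := min_le_left (ε / 8) (1 / 2)
  linarith

lemma exists_injOn_lieExp : ∃ U ∈ 𝓝 (0 : 𝔼), InjOn (fun X : 𝔼 => lieExp (n := n) (G := G) X) U := by
  have h : HasStrictFDerivAt (chartExp n G) ((ContinuousLinearEquiv.refl ℝ 𝔼 : 𝔼 ≃L[ℝ] 𝔼) :
    𝔼 →L[ℝ] 𝔼) 0 := hasStrictFDerivAt_chartExp
  refine ⟨_, (h.toOpenPartialHomeomorph _).open_source.mem_nhds
    h.mem_toOpenPartialHomeomorph_source, fun X hX Y hY hXY => ?_⟩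
  exact (h.toOpenPartialHomeomorph _).injOn hX hY (congrArg (chartOne n G) hXY)

lemma chartExp_zero : chartExp n G 0 = origin n G :=
  congrArg (chartOne n G) (lieExp_zero (n := n) (G := G))

lemma lieExp_mem_source_eventually :
    ∀ᶠ X : 𝔼 in 𝓝 0, lieExp (n := n) (G := G) X ∈ (chartOne n G).source := by
  obtain ⟨ρ, hρ, h⟩ := exists_curve_chartExp (n := n) (G := G) univ_mem
  filter_upwards [Metric.closedBall_mem_nhds (0 : 𝔼) hρ] with X hX
  exact (h X (by simpa using hX)).1

lemma lieExp_image_mem_nhds {U : Set 𝔼} (hU : U ∈ 𝓝 (0 : 𝔼)) :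
    (fun X : 𝔼 => lieExp (n := n) (G := G) X) '' U ∈ 𝓝 (1 : G) := by
  have h : HasStrictFDerivAt (chartExp n G) ((ContinuousLinearEquiv.refl ℝ 𝔼 : 𝔼 ≃L[ℝ] 𝔼) :
    𝔼 →L[ℝ] 𝔼) 0 := hasStrictFDerivAt_chartExp
  have h1 := h.map_nhds_eq_of_equiv
  have h2 : chartExp n G '' (U ∩ {X | lieExp (n := n) (G := G) X ∈ (chartOne n G).source}) ∈
      𝓝 (chartOne n G 1) := by
    have := image_mem_map (m := chartExp n G) (inter_mem hU (lieExp_mem_source_eventually (n := n) (G := G)))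
    rwa [h1, chartExp_zero] at this
  have h3 := ((continuousOn_chartOne (n := n) (G := G)).continuousAt
    (isOpen_chartOne_source.mem_nhds (one_mem_source (n := n)))).preimage_mem_nhds h2
  filter_upwards [h3, isOpen_chartOne_source.mem_nhds (one_mem_source (n := n))] with g hg hgs
  obtain ⟨X, ⟨hXU, hXs⟩, hX⟩ := hg
  exact ⟨X, hXU, (chartOne n G).injOn hXs hgs hX⟩

lemma lieExp_natCast_smul (X : RealLie n G) (k : ℕ) : lieExp ((k : ℝ) • X) = lieExp X ^ k := by
  induction k with
  | zero => simp
  | succ k ih =>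
    rw [Nat.cast_succ, lieExp_add_smul, ih, one_smul, pow_succ]

/-- Strict differentiability gives continuity near `0` only; `exp X = exp (X / k) ^ k` with `k`
large spreads it. -/
lemma continuous_lieExp : Continuous (fun X : 𝔼 => lieExp (n := n) (G := G) X) := by
  have h0 : ∀ᶠ X : 𝔼 in 𝓝 0, ContinuousAt (fun X : 𝔼 => lieExp (n := n) (G := G) X) X := by
    obtain ⟨K, s, hs, hK⟩ := (hasStrictFDerivAt_chartExp (n := n) (G := G)).exists_lipschitzOnWith
    filter_upwards [eventually_mem_nhds_iff.2 hs,
      eventually_mem_nhds_iff.2 (lieExp_mem_source_eventually (n := n) (G := G))] with X hX hXs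
    have hXs' : lieExp (n := n) (G := G) X ∈ (chartOne n G).source := by
      have h := mem_of_mem_nhds hXs
      exact h
    have h1 : ContinuousAt (chartExp n G) X := hK.continuousOn.continuousAt hX
    have h2 : ContinuousAt (chartOne n G).symm (chartExp n G X) :=
      continuousOn_chartOne_symm.continuousAt (isOpen_chartOne_target.mem_nhds
        ((chartOne n G).map_source hXs'))
    refine (ContinuousAt.comp h2 h1).congr ?_
    filter_upwards [hXs] with Y hY
    exact (chartOne n G).left_inv hY
  rw [continuous_iff_continuousAt]
  intro X
  have hlim : Tendsto (fun k : ℕ => ((k : ℝ)⁻¹) • X) atTop (𝓝 0) := by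
    have := (tendsto_inv_atTop_nhds_zero_nat (𝕜 := ℝ)).smul_const X
    rwa [zero_smul] at this
  obtain ⟨k, hk, hk0⟩ := ((hlim.eventually h0).and (eventually_gt_atTop 0)).exists
  have e : (fun X : 𝔼 => lieExp (n := n) (G := G) X) =
      fun X : 𝔼 => (lieExp (n := n) (G := G) ((k : ℝ)⁻¹ • X)) ^ k := by
    ext Y
    have h1 := lieExp_natCast_smul (n := n) (G := G) ((k : ℝ)⁻¹ • Y) k
    have h2 : (k : ℝ) • ((k : ℝ)⁻¹ • Y) = Y := by
      rw [smul_smul, mul_inv_cancel₀ (by exact_mod_cast hk0.ne'), one_smul]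
    exact (congrArg (fun Z : 𝔼 => lieExp (n := n) (G := G) Z) h2.symm).trans h1
  rw [e]
  exact (ContinuousAt.comp (f := fun X : 𝔼 => (k : ℝ)⁻¹ • X) hk (by fun_prop)).pow k

end LocalExponential

/-! ### The adjoint action and its derivative, the Lie bracket -/

section Adjoint

variable {n : ℕ} {G : Type*} [TopologicalSpace G] [ChartedSpace (EuclideanSpace ℝ (Fin n)) G]
  [Group G] [IsTopologicalGroup G] [LieGroup (𝓡 n) ∞ G]

local notation "𝔼" => EuclideanSpace ℝ (Fin n)

lemma isLieAut_conj (g : G) : IsLieAut n (MulAut.conj g) := by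
  have h : ∀ g : G, ContMDiff (𝓡 n) (𝓡 n) ∞ (MulAut.conj g) := by
    intro g
    have h1 : ContMDiff (𝓡 n) (𝓡 n) ∞ (g * · : G → G) := contMDiff_mul_left
    have h2 : ContMDiff (𝓡 n) (𝓡 n) ∞ (· * g⁻¹ : G → G) := contMDiff_mul_right
    exact h2.comp h1
  refine ⟨h g, ?_⟩
  have := h g⁻¹
  rwa [map_inv] at this

variable (n) in
/-- The adjoint representation of a Lie group. -/
def lieAd (g : G) : RealLie n G →ₗ[ℝ] RealLie n G := differential n (MulAut.conj g)

lemma lieAd_mul (g h : G) : lieAd n (g * h) = lieAd n g ∘ₗ lieAd n h := by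
  rw [lieAd, map_mul]
  exact (differential_comp (isLieAut_conj g) (isLieAut_conj h)).symm

@[simp] lemma lieAd_one : lieAd n (1 : G) = LinearMap.id := by
  rw [lieAd, map_one, differential_one]

variable (G) in
/-- Conjugation read in the chart at the identity. -/
def localConj (p : 𝔼 × 𝔼) : 𝔼 :=
  chartOne n G ((chartOne n G).symm p.1 * (chartOne n G).symm p.2 * ((chartOne n G).symm p.1)⁻¹)

variable (n G) in
/-- The domain of the local conjugation. -/
def localConjDomain : Set (𝔼 × 𝔼) :=
  ((chartOne n G).target ×ˢ (chartOne n G).target) ∩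
    (fun p => (chartOne n G).symm p.1 * (chartOne n G).symm p.2 * ((chartOne n G).symm p.1)⁻¹) ⁻¹'
      (chartOne n G).source

lemma mem_localConjDomain {x : 𝔼} (hx : x ∈ (chartOne n G).target) :
    (x, origin n G) ∈ localConjDomain n G :=
  ⟨⟨hx, origin_mem_target⟩, by simpa using one_mem_source⟩

lemma isOpen_localConjDomain : IsOpen (localConjDomain n G) := by
  refine ContinuousOn.isOpen_inter_preimage ?_
    (isOpen_chartOne_target.prod isOpen_chartOne_target) isOpen_chartOne_source
  have h : ContinuousOn (fun p : 𝔼 × 𝔼 => (chartOne n G).symm p.1)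
      ((chartOne n G).target ×ˢ (chartOne n G).target) :=
    continuousOn_chartOne_symm.comp continuousOn_fst fun p hp => hp.1
  exact (h.mul (continuousOn_chartOne_symm.comp continuousOn_snd fun p hp => hp.2)).mul h.inv

lemma contDiffOn_localConj : ContDiffOn ℝ ∞ (localConj G) (localConjDomain n G) := by
  rw [← contMDiffOn_iff_contDiffOn]
  have h : ContMDiffOn 𝓘(ℝ, 𝔼 × 𝔼) (𝓡 n) ∞ (fun p : 𝔼 × 𝔼 => (chartOne n G).symm p.1)
      (localConjDomain n G) :=
    contMDiffOn_chartOne_symm.comp contDiff_fst.contMDiff.contMDiffOn fun p hp => hp.1.1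
  refine contMDiffOn_chartOne.comp (t := (chartOne n G).source) (ContMDiffOn.mul (ContMDiffOn.mul h
    (contMDiffOn_chartOne_symm.comp contDiff_snd.contMDiff.contMDiffOn ?_)) h.inv) ?_
  · exact fun p hp => hp.1.2
  · exact fun p hp => hp.2

variable (G) in
/-- The adjoint representation read in the chart at the identity. -/
def localAd (x : 𝔼) : 𝔼 →L[ℝ] 𝔼 :=
  (fderiv ℝ (localConj G) (x, origin n G)).comp (ContinuousLinearMap.inr ℝ 𝔼 𝔼)

lemma contDiffAt_localConj {x : 𝔼} (hx : x ∈ (chartOne n G).target) :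
    ContDiffAt ℝ ∞ (localConj G) (x, origin n G) :=
  contDiffOn_localConj.contDiffAt (isOpen_localConjDomain.mem_nhds (mem_localConjDomain hx))

lemma contDiffAt_localAd {x : 𝔼} (hx : x ∈ (chartOne n G).target) :
    ContDiffAt ℝ ∞ (localAd G) x := by
  have h := (contDiffAt_localConj hx).fderiv_right (m := ∞) (by simp)
  have h2 : ContDiffAt ℝ ∞ (fun x => fderiv ℝ (localConj G) (x, origin n G)) x :=
    ContDiffAt.comp x (f := fun x => (x, origin n G)) h (by fun_prop)
  exact h2.clm_comp contDiffAt_const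

lemma localConj_origin {x : 𝔼} : localConj G (x, origin n G) = origin n G := by
  rw [localConj]
  simp only [chartOne_symm_origin]
  simp [origin]

lemma hasFDerivAt_localConj {x : 𝔼} (hx : x ∈ (chartOne n G).target) :
    HasFDerivAt (fun y => localConj G (x, y)) (localAd G x) (origin n G) :=
  (((contDiffAt_localConj hx).differentiableAt (by simp)).hasFDerivAt).comp (origin n G)
    (hasFDerivAt_prodMk_right (𝕜 := ℝ) x (origin n G))

lemma localConj_eventually {x : 𝔼} (hx : x ∈ (chartOne n G).target) :
    ∀ᶠ y in 𝓝 (origin n G), (x, y) ∈ localConjDomain n G :=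
  (Continuous.prodMk_right x).continuousAt.preimage_mem_nhds
    (isOpen_localConjDomain.mem_nhds (mem_localConjDomain hx))

lemma lieAd_chartOne_symm {x : 𝔼} (hx : x ∈ (chartOne n G).target) (Y : 𝔼) :
    lieAd n ((chartOne n G).symm x) Y = localAd G x Y := by
  set e := chartOne n G
  set a := origin n G
  have hea : e.symm a = 1 := chartOne_symm_origin
  have h2 := (hasFDerivAt_localConj hx).hasMFDerivAt
  have hs := (mdifferentiableAt_chartOne_symm (origin_mem_target (n := n) (G := G))).hasMFDerivAt
  have h3 : HasMFDerivAt 𝓘(ℝ, 𝔼) (𝓡 n) e.symm ((fun y => localConj G (x, y)) a)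
      (mfderiv 𝓘(ℝ, 𝔼) (𝓡 n) e.symm a : 𝔼 →L[ℝ] 𝔼) := by
    have key : ∀ b, b = a → HasMFDerivAt 𝓘(ℝ, 𝔼) (𝓡 n) e.symm b
        (mfderiv 𝓘(ℝ, 𝔼) (𝓡 n) e.symm a : 𝔼 →L[ℝ] 𝔼) := by
      rintro _ rfl
      exact hs
    exact key _ localConj_origin
  have h4 := h3.comp a h2
  have h5 : HasMFDerivAt (𝓡 n) (𝓡 n) (MulAut.conj (e.symm x)) (e.symm a)
      (mfderiv (𝓡 n) (𝓡 n) (MulAut.conj (e.symm x)) (1 : G) : 𝔼 →L[ℝ] 𝔼) := by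
    have key : ∀ b : G, b = 1 → HasMFDerivAt (𝓡 n) (𝓡 n) (MulAut.conj (e.symm x)) b
        (mfderiv (𝓡 n) (𝓡 n) (MulAut.conj (e.symm x)) (1 : G) : 𝔼 →L[ℝ] 𝔼) := by
      rintro _ rfl
      exact ((isLieAut_conj (e.symm x)).smooth.mdifferentiableAt (by simp)).hasMFDerivAt
    exact key _ hea
  have h6 := h5.comp a hs
  have h7 : (e.symm ∘ fun y => localConj G (x, y)) =ᶠ[𝓝 a] (MulAut.conj (e.symm x) ∘ e.symm) := by
    filter_upwards [localConj_eventually hx] with y hy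
    exact e.left_inv hy.2
  have h8 := hasMFDerivAt_unique (h4.congr_of_eventuallyEq h7.symm) h6
  have h9 := congrArg (fun L : 𝔼 →L[ℝ] 𝔼 => L Y) h8
  have hid := mfderiv_chartOne_symm_origin (n := n) (G := G)
  have h10 : (mfderiv 𝓘(ℝ, 𝔼) (𝓡 n) e.symm a : 𝔼 →L[ℝ] 𝔼) (localAd G x Y) =
      lieAd n (e.symm x) ((mfderiv 𝓘(ℝ, 𝔼) (𝓡 n) e.symm a : 𝔼 →L[ℝ] 𝔼) Y) := h9
  rw [hid, hid] at h10
  exact h10.symm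

variable (G) in
/-- The right invariant vector fields read in the chart at the identity. -/
def localRightField (x : 𝔼) : 𝔼 →L[ℝ] 𝔼 :=
  (fderiv ℝ (localMul G) (origin n G, x)).comp (ContinuousLinearMap.inl ℝ 𝔼 𝔼)

lemma contDiffAt_localMul_right {x : 𝔼} (hx : x ∈ (chartOne n G).target) :
    ContDiffAt ℝ ∞ (localMul G) (origin n G, x) :=
  contDiffOn_localMul.contDiffAt (isOpen_localMulDomain.mem_nhds (right_mem_localMulDomain hx))

lemma localRightField_origin : localRightField G (origin n G) = ContinuousLinearMap.id ℝ _ := by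
  have h1 := ((contDiffAt_localMul_left (origin_mem_target (n := n) (G := G))).differentiableAt
    (by simp)).hasFDerivAt
  have h2 := HasFDerivAt.comp (origin n G) (f := fun y => (y, origin n G)) h1
    (hasFDerivAt_prodMk_left (𝕜 := ℝ) (origin n G) (origin n G))
  have h3 : (localMul G ∘ fun y => (y, origin n G)) =ᶠ[𝓝 (origin n G)] id := by
    filter_upwards [isOpen_chartOne_target.mem_nhds origin_mem_target] with y hy
    exact localMul_left hy
  exact h2.unique ((hasFDerivAt_id _).congr_of_eventuallyEq h3)

/-- The derivative at `y = 1` of `(x y x⁻¹) x = x y`. -/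
lemma localRightField_localAd {x : 𝔼} (hx : x ∈ (chartOne n G).target) (Y : 𝔼) :
    localRightField G x (localAd G x Y) = localField G x Y := by
  have h1 : HasFDerivAt (localMul G) (fderiv ℝ (localMul G) (origin n G, x))
      (localConj G (x, origin n G), x) := by
    rw [localConj_origin]
    exact ((contDiffAt_localMul_right hx).differentiableAt (by simp)).hasFDerivAt
  have h2 := h1.comp (origin n G)
    ((hasFDerivAt_localConj hx).prodMk (hasFDerivAt_const x (origin n G)))
  have h3 := (((contDiffAt_localMul_left hx).differentiableAt (by simp)).hasFDerivAt).comp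
    (origin n G) (hasFDerivAt_prodMk_right (𝕜 := ℝ) x (origin n G))
  have h4 : (localMul G ∘ fun y => (localConj G (x, y), x)) =ᶠ[𝓝 (origin n G)]
      (localMul G ∘ fun y => (x, y)) := by
    filter_upwards [localConj_eventually hx] with y hy
    simp only [localMul, localConj, Function.comp_apply]
    rw [(chartOne n G).left_inv hy.2]
    simp
  have h5 := h2.unique (h3.congr_of_eventuallyEq h4)
  exact congrArg (fun L : 𝔼 →L[ℝ] 𝔼 => L Y) h5

lemma localAd_origin : localAd G (origin n G) = ContinuousLinearMap.id ℝ 𝔼 := by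
  ext1 Y
  have h := localRightField_localAd (origin_mem_target (n := n) (G := G)) Y
  rwa [localRightField_origin, localField_origin] at h

/-- Both sides are mixed second derivatives of the multiplication at the identity, taken in opposite
orders. -/
lemma fderiv_localRightField (X Y : 𝔼) :
    fderiv ℝ (localRightField G) (origin n G) X Y =
      fderiv ℝ (localField G) (origin n G) Y X := by
  set a := origin n G
  have ha : a ∈ (chartOne n G).target := origin_mem_target
  have h0 : DifferentiableAt ℝ (fderiv ℝ (localMul G)) (a, a) :=
    ((contDiffAt_localMul_left ha).fderiv_right (m := ∞) (by simp)).differentiableAt (by simp)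
  have hR : HasFDerivAt (localRightField G) _ a :=
    (HasFDerivAt.comp a (f := fun x => (a, x)) h0.hasFDerivAt
      (hasFDerivAt_prodMk_right (𝕜 := ℝ) a a)).clm_comp (hasFDerivAt_const _ a)
  have hL : HasFDerivAt (localField G) _ a :=
    (HasFDerivAt.comp a (f := fun x => (x, a)) h0.hasFDerivAt
      (hasFDerivAt_prodMk_left (𝕜 := ℝ) a a)).clm_comp (hasFDerivAt_const _ a)
  rw [hR.fderiv, hL.fderiv]
  have hsymm := ((contDiffAt_localMul_left ha).isSymmSndFDerivAt
    (by rw [minSmoothness_of_isRCLikeNormedField]; exact WithTop.coe_le_coe.2 le_top)).eq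
      ((0, X) : 𝔼 × 𝔼) (Y, 0)
  simpa using hsymm

/-- The product rule applied to `localRightField_localAd` at the origin, where both factors are the
identity. -/
lemma fderiv_localAd (X Y : 𝔼) :
    fderiv ℝ (localAd G) (origin n G) X Y =
      fderiv ℝ (localField G) (origin n G) X Y - fderiv ℝ (localField G) (origin n G) Y X := by
  set a := origin n G
  have ha : a ∈ (chartOne n G).target := origin_mem_target
  have hA : HasFDerivAt (localAd G) (fderiv ℝ (localAd G) a) a :=
    ((contDiffAt_localAd ha).differentiableAt (by simp)).hasFDerivAt
  have hV : HasFDerivAt (localField G) (fderiv ℝ (localField G) a) a :=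
    ((contDiffOn_localField.contDiffAt (isOpen_chartOne_target.mem_nhds ha)).differentiableAt
      (by simp)).hasFDerivAt
  have hW : HasFDerivAt (localRightField G) (fderiv ℝ (localRightField G) a) a := by
    have h0 : DifferentiableAt ℝ (fderiv ℝ (localMul G)) (a, a) :=
      ((contDiffAt_localMul_left ha).fderiv_right (m := ∞) (by simp)).differentiableAt (by simp)
    exact ((HasFDerivAt.comp a (f := fun x => (a, x)) h0.hasFDerivAt
      (hasFDerivAt_prodMk_right (𝕜 := ℝ) a a)).clm_comp
        (hasFDerivAt_const _ a)).differentiableAt.hasFDerivAt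
  have h1 := hW.clm_apply (hA.clm_apply (hasFDerivAt_const Y a))
  have h2 := hV.clm_apply (hasFDerivAt_const Y a)
  have h3 : (fun x => localRightField G x (localAd G x Y)) =ᶠ[𝓝 a] fun x => localField G x Y := by
    filter_upwards [isOpen_chartOne_target.mem_nhds ha] with x hx
    exact localRightField_localAd hx Y
  have h4 := congrArg (fun L : 𝔼 →L[ℝ] 𝔼 => L X) (h1.unique (h2.congr_of_eventuallyEq h3))
  have hWa : localRightField G a = ContinuousLinearMap.id ℝ 𝔼 := localRightField_origin
  have hAa : localAd G a = ContinuousLinearMap.id ℝ 𝔼 := localAd_origin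
  simp [hWa, hAa] at h4
  rw [fderiv_localRightField] at h4
  rw [← h4]
  abel

/-- In the chart the left invariant fields become `x ↦ localField G x X`, with value `X` at the
origin, so this is the coordinate formula for the bracket of vector fields. Compared with
`fderiv_localAd`, it says that the derivative of `Ad` is the bracket. -/
lemma bracket_eq (X Y : RealLie n G) :
    ⁅X, Y⁆ = fderiv ℝ (localField G) (origin n G) X Y - fderiv ℝ (localField G) (origin n G) Y X := by
  set a := origin n G
  have ha : a ∈ (chartOne n G).target := origin_mem_target
  have hV : DifferentiableAt ℝ (localField G) a :=
    (contDiffOn_localField.contDiffAt (isOpen_chartOne_target.mem_nhds ha)).differentiableAt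
      (by simp)
  rw [GroupLieAlgebra.bracket_def, ← VectorField.mlieBracketWithin_univ,
    VectorField.mlieBracketWithin_apply]
  have hpull : ∀ Z : 𝔼, (VectorField.mpullbackWithin 𝓘(ℝ, 𝔼) (𝓡 n) (extChartAt (𝓡 n) (1 : G)).symm
      (mulInvariantVectorField (I := 𝓡 n) (G := G) Z) (range (𝓡 n)) : 𝔼 → 𝔼) =ᶠ[𝓝 a]
        fun x => localField G x Z := by
    intro Z
    filter_upwards [isOpen_chartOne_target.mem_nhds ha] with x hx
    have h1 := mfderiv_chartOne_symm_localField hx Z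
    have h2 := isInvertible_mfderivWithin_extChartAt_symm (I := 𝓡 n) (x := (1 : G)) hx
    rw [VectorField.mpullbackWithin_apply]
    rw [ModelWithCorners.range_eq_univ, mfderivWithin_univ] at h2 ⊢
    have key : ∀ A : 𝔼 →L[ℝ] 𝔼, A.IsInvertible → ∀ v w, A v = w → A.inverse w = v := by
      rintro _ ⟨A, rfl⟩ v _ rfl
      simp
    exact key _ h2 _ _ h1
  have hs : (extChartAt (𝓡 n) (1 : G)).symm ⁻¹' univ ∩ range (𝓡 n) = univ := by
    rw [ModelWithCorners.range_eq_univ, preimage_univ, univ_inter]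
  rw [hs]
  have hbr : ∀ (X Y : 𝔼) (P Q : 𝔼 → 𝔼), P =ᶠ[𝓝 a] (fun x => localField G x X) →
      Q =ᶠ[𝓝 a] (fun x => localField G x Y) →
      VectorField.lieBracketWithin ℝ P Q univ a =
        fderiv ℝ (localField G) a X Y - fderiv ℝ (localField G) a Y X := by
    intro X Y P Q hP hQ
    have hVa : localField G a = ContinuousLinearMap.id ℝ 𝔼 := localField_origin
    have hd : ∀ Z : 𝔼, ∀ W : 𝔼,
        fderiv ℝ (fun x => localField G x Z) a W = fderiv ℝ (localField G) a W Z := by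
      intro Z W
      rw [(hV.hasFDerivAt.clm_apply (hasFDerivAt_const Z a)).fderiv]
      simp
    rw [VectorField.lieBracketWithin_univ, VectorField.lieBracket, hP.fderiv_eq, hQ.fderiv_eq,
      hP.eq_of_nhds, hQ.eq_of_nhds, hd, hd, hVa]
    rfl
  have hid : ∀ A : 𝔼 →L[ℝ] 𝔼, A = ContinuousLinearMap.id ℝ 𝔼 → ∀ v, A.inverse v = v := by
    rintro _ rfl v
    simp
  exact (hid _ (mfderiv_extChartAt_self (I := 𝓡 n) (x := (1 : G))) _).trans
    (hbr _ _ _ _ (hpull X) (hpull Y))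

/-- The adjoint representation, as a continuous linear endomorphism of the model space. -/
def adjointMap (g : G) : 𝔼 →L[ℝ] 𝔼 := mfderiv (𝓡 n) (𝓡 n) (MulAut.conj g) (1 : G)

lemma adjointMap_mul (g h : G) : adjointMap (n := n) (g * h) = adjointMap g * adjointMap h := by
  ext1 Y
  exact congrArg (fun B : RealLie n G →ₗ[ℝ] RealLie n G => B Y) (lieAd_mul (n := n) g h)

lemma adjointMap_one : adjointMap (n := n) (1 : G) = 1 := by
  ext1 Y
  exact congrArg (fun B : RealLie n G →ₗ[ℝ] RealLie n G => B Y) (lieAd_one (n := n) (G := G))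

lemma adjointMap_chartOne_symm {x : 𝔼} (hx : x ∈ (chartOne n G).target) (Y : 𝔼) :
    adjointMap ((chartOne n G).symm x) Y = localAd G x Y :=
  lieAd_chartOne_symm hx Y

variable (n G) in
/-- The Lie bracket as a bilinear map on the model space. -/
def bracketMap : 𝔼 →ₗ[ℝ] 𝔼 →ₗ[ℝ] 𝔼 :=
  LinearMap.mk₂ ℝ (fun X Y : 𝔼 => (Bracket.bracket : RealLie n G → RealLie n G → RealLie n G) X Y)
    (fun X Y Z => add_lie (L := RealLie n G) (M := RealLie n G) X Y Z)
    (fun c X Y => smul_lie (R := ℝ) (L := RealLie n G) (M := RealLie n G) c X Y)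
    (fun X Y Z => lie_add (L := RealLie n G) (M := RealLie n G) X Y Z)
    (fun c X Y => lie_smul (R := ℝ) (L := RealLie n G) (M := RealLie n G) c X Y)

lemma bracketMap_eq (X Y : 𝔼) :
    bracketMap n G X Y = fderiv ℝ (localAd G) (origin n G) X Y :=
  (bracket_eq (G := G) X Y).trans (fderiv_localAd X Y).symm

lemma continuous_adjointMap (Y : 𝔼) : Continuous (fun g : G => adjointMap g Y) := by
  have h1 : ContinuousAt (fun g : G => adjointMap g Y) 1 := by
    have h2 : ContinuousAt (fun x => localAd G x Y) (chartOne n G 1) :=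
      ((contDiffAt_localAd origin_mem_target).continuousAt).clm_apply continuousAt_const
    have h3 : ContinuousAt (chartOne n G) 1 :=
      continuousOn_chartOne.continuousAt (isOpen_chartOne_source.mem_nhds one_mem_source)
    refine (ContinuousAt.comp h2 h3).congr ?_
    filter_upwards [isOpen_chartOne_source.mem_nhds (one_mem_source (n := n))] with g hg
    have h4 := adjointMap_chartOne_symm ((chartOne n G).map_source hg) Y
    rw [(chartOne n G).left_inv hg] at h4
    exact h4.symm
  rw [continuous_iff_continuousAt]
  intro g
  have e : (fun h : G => adjointMap h Y) = fun h => adjointMap g (adjointMap (g⁻¹ * h) Y) := by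
    ext1 h
    rw [← mul_apply_eq_comp, ← adjointMap_mul, mul_inv_cancel_left]
  rw [e]
  have h2 : ContinuousAt (fun h : G => g⁻¹ * h) g := (continuous_const_mul g⁻¹).continuousAt
  have h3 : ContinuousAt (fun g : G => adjointMap g Y) (g⁻¹ * g) := by
    rwa [inv_mul_cancel]
  exact (adjointMap g).continuous.continuousAt.comp
    (ContinuousAt.comp (f := fun h => g⁻¹ * h) h3 h2)

variable [T2Space G]

variable (n G) in
/-- The exponential map on the model space. -/
def expMap (X : 𝔼) : G := lieExp (n := n) (G := G) X

lemma hasDerivAt_adjointMap_zero (X Y : 𝔼) :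
    HasDerivAt (fun t : ℝ => adjointMap (expMap n G (t • X)) Y) (bracketMap n G X Y) 0 := by
  have hA : HasFDerivAt (localAd G) (fderiv ℝ (localAd G) (origin n G))
      (chartExp n G ((0 : ℝ) • X)) := by
    rw [zero_smul, chartExp_zero]
    exact ((contDiffAt_localAd origin_mem_target).differentiableAt (by simp)).hasFDerivAt
  have hE : HasFDerivAt (chartExp n G) (ContinuousLinearMap.id ℝ 𝔼) ((0 : ℝ) • X) := by
    rw [zero_smul]
    exact hasStrictFDerivAt_chartExp.hasFDerivAt
  have hl : HasDerivAt (fun t : ℝ => t • X) X 0 := by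
    have := (hasDerivAt_id (0 : ℝ)).smul_const X
    rwa [one_smul] at this
  have hB : HasDerivAt (fun t : ℝ => chartExp n G (t • X)) X 0 :=
    HasFDerivAt.comp_hasDerivAt (l := chartExp n G) (f := fun t : ℝ => t • X) (0 : ℝ) hE hl
  have hC : HasDerivAt (fun t : ℝ => localAd G (chartExp n G (t • X)))
      (fderiv ℝ (localAd G) (origin n G) X) 0 :=
    HasFDerivAt.comp_hasDerivAt (f := fun t : ℝ => chartExp n G (t • X)) (0 : ℝ) hA hB
  have h1 : HasDerivAt (fun t : ℝ => localAd G (chartExp n G (t • X)) Y)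
      (fderiv ℝ (localAd G) (origin n G) X Y) 0 := by
    have := hC.clm_apply (hasDerivAt_const (0 : ℝ) Y)
    rwa [map_zero, add_zero] at this
  have hsrc : ∀ᶠ t : ℝ in 𝓝 0, expMap n G (t • X) ∈ (chartOne n G).source := by
    have h2 : Tendsto (fun t : ℝ => t • X) (𝓝 0) (𝓝 0) := by
      have := hl.continuousAt.tendsto
      rwa [zero_smul] at this
    exact h2.eventually (lieExp_mem_source_eventually (n := n) (G := G))
  have h3 : (fun t : ℝ => adjointMap (expMap n G (t • X)) Y) =ᶠ[𝓝 0]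
      fun t : ℝ => localAd G (chartExp n G (t • X)) Y := by
    filter_upwards [hsrc] with t ht
    have h4 := adjointMap_chartOne_symm ((chartOne n G).map_source ht) Y
    rw [(chartOne n G).left_inv ht] at h4
    exact h4
  refine HasDerivAt.congr_of_eventuallyEq ?_ h3
  rw [bracketMap_eq]
  exact h1

end Adjoint

/-! ### Formal Lie theory from an exponential map with isometric adjoint action -/

/-- A topological group with an exponential map from a Euclidean space `E`, on which it acts by
isometries through its adjoint representation. -/
structure ExpData (G E : Type*) [Group G] [TopologicalSpace G] [NormedAddCommGroup E]
    [InnerProductSpace ℝ E] where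
  /-- the exponential map -/
  exp : E → G
  /-- the adjoint representation -/
  Ad : G →* (E →L[ℝ] E)
  /-- the bracket -/
  br : E →ₗ[ℝ] E →ₗ[ℝ] E
  br_skew : ∀ X Y, br X Y = -br Y X
  exp_add_smul : ∀ X (s t : ℝ), exp ((s + t) • X) = exp (s • X) * exp (t • X)
  continuous_exp : Continuous exp
  exists_injOn : ∃ U ∈ 𝓝 (0 : E), InjOn exp U
  image_mem_nhds : ∀ U ∈ 𝓝 (0 : E), exp '' U ∈ 𝓝 (1 : G)
  conj_exp : ∀ g X, g * exp X * g⁻¹ = exp (Ad g X)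
  continuous_Ad : ∀ Y, Continuous fun g => Ad g Y
  hasDerivAt_Ad_zero : ∀ X Y, HasDerivAt (fun t : ℝ => Ad (exp (t • X)) Y) (br X Y) 0
  inner_Ad : ∀ g X Y, inner ℝ (Ad g X) (Ad g Y) = inner ℝ X Y
  exp_add_of_commute : ∀ X Y, (∀ s t : ℝ, Commute (exp (s • X)) (exp (t • Y))) →
    exp (X + Y) = exp X * exp Y

/-- An automorphism of a topological group compatible with its exponential map. -/
structure ExpData.Aut {G E : Type*} [Group G] [TopologicalSpace G] [NormedAddCommGroup E]
    [InnerProductSpace ℝ E] (𝒟 : ExpData G E) where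
  /-- the automorphism of the group -/
  toAut : MulAut G
  /-- the differential -/
  diff : E →L[ℝ] E
  continuous_toAut : Continuous toAut
  map_exp : ∀ X, toAut (𝒟.exp X) = 𝒟.exp (diff X)
  inner_diff : ∀ X Y, inner ℝ (diff X) (diff Y) = inner ℝ X Y

namespace ExpData

variable {G E : Type*} [Group G] [TopologicalSpace G] [NormedAddCommGroup E]
    [InnerProductSpace ℝ E] (𝒟 : ExpData G E)

lemma exp_zero : 𝒟.exp 0 = 1 := by
  have := 𝒟.exp_add_smul 0 0 0
  simpa using this

lemma exp_neg (X : E) : 𝒟.exp (-X) = (𝒟.exp X)⁻¹ := by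
  have := 𝒟.exp_add_smul X (-1) 1
  rw [eq_inv_iff_mul_eq_one]
  simpa [𝒟.exp_zero] using this.symm

lemma exp_natCast_smul (X : E) (k : ℕ) : 𝒟.exp ((k : ℝ) • X) = 𝒟.exp X ^ k := by
  induction k with
  | zero => simp [𝒟.exp_zero]
  | succ k ih => rw [Nat.cast_succ, 𝒟.exp_add_smul, ih, one_smul, pow_succ]

lemma eq_of_exp_smul_eq {X Y : E} (h : ∀ t : ℝ, 𝒟.exp (t • X) = 𝒟.exp (t • Y)) : X = Y := by
  obtain ⟨U, hU, hinj⟩ := 𝒟.exists_injOn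
  have h1 : ∀ Z : E, ∀ᶠ t : ℝ in 𝓝 0, t • Z ∈ U := fun Z => by
    have : ContinuousAt (fun t : ℝ => t • Z) 0 := by fun_prop
    exact this.eventually_mem (by simpa using hU)
  have h2 : ∀ᶠ t : ℝ in 𝓝[≠] 0, t • X ∈ U ∧ t • Y ∈ U :=
    ((h1 X).and (h1 Y)).filter_mono nhdsWithin_le_nhds
  obtain ⟨t, ⟨hX, hY⟩, ht⟩ := (h2.and self_mem_nhdsWithin).exists
  exact smul_right_injective E ht (hinj hX hY (h t))

lemma continuous_exp_smul (X : E) : Continuous fun t : ℝ => 𝒟.exp (t • X) :=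
  𝒟.continuous_exp.comp (by fun_prop)

lemma Ad_mul_apply (g h : G) (X : E) : 𝒟.Ad (g * h) X = 𝒟.Ad g (𝒟.Ad h X) := by
  rw [map_mul]; rfl

lemma Ad_one_apply (X : E) : 𝒟.Ad 1 X = X := by
  rw [map_one]; rfl

lemma Ad_inv_Ad (g : G) (X : E) : 𝒟.Ad g⁻¹ (𝒟.Ad g X) = X := by
  rw [← 𝒟.Ad_mul_apply, inv_mul_cancel, 𝒟.Ad_one_apply]

lemma Ad_Ad_inv (g : G) (X : E) : 𝒟.Ad g (𝒟.Ad g⁻¹ X) = X := by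
  rw [← 𝒟.Ad_mul_apply, mul_inv_cancel, 𝒟.Ad_one_apply]

lemma inner_Ad_left (g : G) (X Y : E) : inner ℝ (𝒟.Ad g X) Y = inner ℝ X (𝒟.Ad g⁻¹ Y) := by
  rw [← 𝒟.inner_Ad g X, 𝒟.Ad_Ad_inv]

lemma norm_Ad (g : G) (X : E) : ‖𝒟.Ad g X‖ = ‖X‖ := by
  rw [norm_eq_sqrt_real_inner, norm_eq_sqrt_real_inner, 𝒟.inner_Ad]

lemma commute_exp_iff {g : G} {X : E} :
    (∀ t : ℝ, Commute g (𝒟.exp (t • X))) ↔ 𝒟.Ad g X = X := by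
  have key : ∀ t : ℝ, Commute g (𝒟.exp (t • X)) ↔ 𝒟.exp (t • 𝒟.Ad g X) = 𝒟.exp (t • X) := by
    intro t
    rw [← map_smul, ← 𝒟.conj_exp, mul_inv_eq_iff_eq_mul]
    rfl
  simp only [key]
  exact ⟨fun h => 𝒟.eq_of_exp_smul_eq h, fun h t => by rw [h]⟩

lemma hasDerivAt_Ad_exp (X Y : E) (t : ℝ) :
    HasDerivAt (fun t : ℝ => 𝒟.Ad (𝒟.exp (t • X)) Y) (𝒟.Ad (𝒟.exp (t • X)) (𝒟.br X Y)) t := by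
  have h1 : HasDerivAt (fun u : ℝ => 𝒟.Ad (𝒟.exp ((u - t) • X)) Y) (𝒟.br X Y) t := by
    have h := 𝒟.hasDerivAt_Ad_zero X Y
    rw [← sub_self t] at h
    exact h.comp_sub_const t t
  have h2 := (𝒟.Ad (𝒟.exp (t • X))).hasFDerivAt.comp_hasDerivAt t h1
  refine h2.congr_of_eventuallyEq (Eventually.of_forall fun u => ?_)
  simp only [Function.comp_apply, ← 𝒟.Ad_mul_apply, ← 𝒟.exp_add_smul, add_sub_cancel]

/-- The derivative at `t = 0` of the invariance of the inner product under `Ad (exp (t X))`. -/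
lemma inner_br (X Y Z : E) : inner ℝ (𝒟.br X Y) Z = -inner ℝ Y (𝒟.br X Z) := by
  have h := (𝒟.hasDerivAt_Ad_zero X Y).inner ℝ (𝒟.hasDerivAt_Ad_zero X Z)
  simp only [𝒟.inner_Ad, zero_smul, 𝒟.exp_zero, 𝒟.Ad_one_apply] at h
  have := h.unique (hasDerivAt_const (0 : ℝ) _)
  linarith

lemma Ad_exp_smul_eq_iff {X Y : E} :
    (∀ t : ℝ, 𝒟.Ad (𝒟.exp (t • X)) Y = Y) ↔ 𝒟.br X Y = 0 := by
  constructor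
  · intro h
    have h1 := 𝒟.hasDerivAt_Ad_zero X Y
    simp only [h] at h1
    exact h1.unique (hasDerivAt_const (0 : ℝ) _)
  · intro h t
    have h1 : ∀ t, HasDerivAt (fun t : ℝ => 𝒟.Ad (𝒟.exp (t • X)) Y) 0 t := fun t => by
      simpa [h] using 𝒟.hasDerivAt_Ad_exp X Y t
    have h2 := is_const_of_deriv_eq_zero (fun t => (h1 t).differentiableAt)
      (fun t => (h1 t).deriv) t 0
    simpa [𝒟.exp_zero, 𝒟.Ad_one_apply] using h2

lemma Ad_exp_of_br {X Y : E} (h : 𝒟.br X Y = 0) : 𝒟.Ad (𝒟.exp X) Y = Y := by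
  simpa using 𝒟.Ad_exp_smul_eq_iff.2 h 1

lemma br_eq_zero_iff {X Y : E} :
    𝒟.br X Y = 0 ↔ ∀ s t : ℝ, Commute (𝒟.exp (s • X)) (𝒟.exp (t • Y)) := by
  simp only [𝒟.commute_exp_iff, 𝒟.Ad_exp_smul_eq_iff]

lemma br_comm_zero {X Y : E} (h : 𝒟.br X Y = 0) : 𝒟.br Y X = 0 := by
  rw [𝒟.br_skew, h, neg_zero]

lemma exp_add {X Y : E} (h : 𝒟.br X Y = 0) : 𝒟.exp (X + Y) = 𝒟.exp X * 𝒟.exp Y :=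
  𝒟.exp_add_of_commute X Y (𝒟.br_eq_zero_iff.1 h)

lemma Ad_br (g : G) (X Y : E) : 𝒟.Ad g (𝒟.br X Y) = 𝒟.br (𝒟.Ad g X) (𝒟.Ad g Y) := by
  have h1 := (𝒟.Ad g).hasFDerivAt.comp_hasDerivAt 0 (𝒟.hasDerivAt_Ad_zero X Y)
  refine h1.unique ((𝒟.hasDerivAt_Ad_zero (𝒟.Ad g X) (𝒟.Ad g Y)).congr_of_eventuallyEq
    (Eventually.of_forall fun t => ?_))
  simp only [Function.comp_apply]
  rw [← map_smul, ← 𝒟.conj_exp, 𝒟.Ad_mul_apply, 𝒟.Ad_mul_apply, 𝒟.Ad_inv_Ad]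

lemma exists_injOn_ball : ∃ δ > 0, InjOn 𝒟.exp (Metric.ball 0 δ) := by
  obtain ⟨U, hU, hinj⟩ := 𝒟.exists_injOn
  obtain ⟨δ, hδ, h⟩ := Metric.mem_nhds_iff.1 hU
  exact ⟨δ, hδ, hinj.mono h⟩

/-- The radius of a ball on which the exponential map is injective. -/
def radius : ℝ := 𝒟.exists_injOn_ball.choose

lemma radius_pos : 0 < 𝒟.radius := 𝒟.exists_injOn_ball.choose_spec.1

lemma eq_of_exp_eq {X Y : E} (hX : ‖X‖ < 𝒟.radius) (hY : ‖Y‖ < 𝒟.radius)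
    (h : 𝒟.exp X = 𝒟.exp Y) : X = Y :=
  𝒟.exists_injOn_ball.choose_spec.2 (mem_ball_zero_iff.2 hX) (mem_ball_zero_iff.2 hY) h

/-- `Ad g` is an isometry, so `Ad g X` stays in the ball where `exp` is injective. For short `X`,
commuting with the one element `exp X` thus replaces commuting with the whole one-parameter group.
-/
lemma Ad_eq_of_commute {g : G} {X : E} (hX : ‖X‖ < 𝒟.radius) (h : Commute g (𝒟.exp X)) :
    𝒟.Ad g X = X := by
  refine 𝒟.eq_of_exp_eq (by rwa [𝒟.norm_Ad]) hX ?_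
  rw [← 𝒟.conj_exp, mul_inv_eq_iff_eq_mul]
  exact h

lemma br_eq_zero_of_Ad_exp {X Y : E} (hX : ‖X‖ < 𝒟.radius) (h : 𝒟.Ad (𝒟.exp X) Y = Y) :
    𝒟.br X Y = 0 := by
  refine 𝒟.br_comm_zero (𝒟.Ad_exp_smul_eq_iff.1 fun t => 𝒟.Ad_eq_of_commute hX ?_)
  exact (𝒟.commute_exp_iff.2 h t).symm

lemma exists_exp_eq {ε : ℝ} (hε : 0 < ε) :
    ∃ U ∈ 𝓝 (1 : G), ∀ x ∈ U, ∃ X, ‖X‖ < ε ∧ 𝒟.exp X = x := by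
  refine ⟨_, 𝒟.image_mem_nhds _ (Metric.ball_mem_nhds 0 hε), ?_⟩
  rintro _ ⟨X, hX, rfl⟩
  exact ⟨X, mem_ball_zero_iff.1 hX, rfl⟩

namespace Aut

variable {𝒟} (σ : 𝒟.Aut)

lemma diff_Ad (g : G) (Y : E) : σ.diff (𝒟.Ad g Y) = 𝒟.Ad (σ.toAut g) (σ.diff Y) := by
  refine 𝒟.eq_of_exp_smul_eq fun t => ?_
  simp only [← map_smul, ← σ.map_exp, ← 𝒟.conj_exp, map_mul, map_inv]

lemma norm_diff (X : E) : ‖σ.diff X‖ = ‖X‖ := by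
  rw [norm_eq_sqrt_real_inner, norm_eq_sqrt_real_inner, σ.inner_diff]

lemma diff_br (X Y : E) : σ.diff (𝒟.br X Y) = 𝒟.br (σ.diff X) (σ.diff Y) := by
  have h1 := σ.diff.hasFDerivAt.comp_hasDerivAt 0 (𝒟.hasDerivAt_Ad_zero X Y)
  refine h1.unique ((𝒟.hasDerivAt_Ad_zero (σ.diff X) (σ.diff Y)).congr_of_eventuallyEq
    (Eventually.of_forall fun t => ?_))
  simp only [Function.comp_apply, σ.diff_Ad, σ.map_exp, map_smul]

lemma exp_mem_fixedSubgroup {X : E} (h : σ.diff X = X) : 𝒟.exp X ∈ fixedSubgroup σ.toAut := by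
  change σ.toAut (𝒟.exp X) = 𝒟.exp X
  rw [σ.map_exp, h]

lemma diff_eq_of_exp_mem {X : E} (hX : ‖X‖ < 𝒟.radius) (h : 𝒟.exp X ∈ fixedSubgroup σ.toAut) :
    σ.diff X = X :=
  𝒟.eq_of_exp_eq (by rwa [σ.norm_diff]) hX (by rw [← σ.map_exp]; exact h)

lemma diff_eq_of_forall {X : E} (h : ∀ t : ℝ, 𝒟.exp (t • X) ∈ fixedSubgroup σ.toAut) :
    σ.diff X = X := by
  refine 𝒟.eq_of_exp_smul_eq fun t => ?_
  rw [← map_smul, ← σ.map_exp]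
  exact h t

end Aut

end ExpData

/-! ### Identity components -/

section Components

variable {G : Type*} [Group G] [TopologicalSpace G] [IsTopologicalGroup G]

lemma identityComponent_le_self (H : Subgroup G) : identityComponent H ≤ H := by
  rintro _ ⟨y, -, rfl⟩
  exact y.2

/-- `M ∩ H` is a neighbourhood of `1` in `H`, hence an open and closed subgroup of `H`. -/
lemma identityComponent_le {H M : Subgroup G} {U : Set G} (hU : U ∈ 𝓝 (1 : G))
    (h : ∀ x ∈ H, x ∈ U → x ∈ M) : identityComponent H ≤ M := by
  have hopen : IsOpen ((M.subgroupOf H : Subgroup H) : Set H) := by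
    refine Subgroup.isOpen_of_mem_nhds (g := 1) _ ?_
    have h1 : ((↑) : H → G) ⁻¹' U ∈ 𝓝 (1 : H) :=
      continuous_subtype_val.continuousAt.preimage_mem_nhds hU
    exact mem_of_superset h1 fun x hx => h x x.2 hx
  have hclopen : IsClopen ((M.subgroupOf H : Subgroup H) : Set H) :=
    ⟨Subgroup.isClosed_of_isOpen _ hopen, hopen⟩
  have h2 := hclopen.connectedComponent_subset (x := 1) (one_mem _)
  rintro _ ⟨y, hy, rfl⟩
  exact h2 hy

lemma subset_identityComponent {H : Subgroup G} {A : Set G} (hA : IsPreconnected A)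
    (h1 : (1 : G) ∈ A) (hAH : A ⊆ H) : A ⊆ identityComponent H := by
  intro x hx
  have hp : IsPreconnected (((↑) : H → G) ⁻¹' A) := by
    refine Topology.IsInducing.subtypeVal.isPreconnected_image.1 ?_
    convert hA
    ext y
    exact ⟨by rintro ⟨z, hz, rfl⟩; exact hz, fun hy => ⟨⟨y, hAH hy⟩, hy, rfl⟩⟩
  exact ⟨⟨x, hAH hx⟩, hp.subset_connectedComponent (x := (1 : H)) h1 hx, rfl⟩

lemma le_of_isPreconnected {H M : Subgroup G} {U : Set G} (hH : IsPreconnected (H : Set G))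
    (hU : U ∈ 𝓝 (1 : G)) (h : ∀ x ∈ H, x ∈ U → x ∈ M) : H ≤ M :=
  le_trans (subset_identityComponent hH H.one_mem subset_rfl) (identityComponent_le hU h)

end Components

lemma isClosed_fixedSubgroup {G : Type*} [Group G] [TopologicalSpace G] [T2Space G] {μ : MulAut G}
    (hμ : Continuous μ) : IsClosed (fixedSubgroup μ : Set G) :=
  isClosed_eq hμ continuous_id

/-! ### Closed commutative subgroups and their Lie algebras -/

namespace ExpData

variable {G E : Type*} [Group G] [TopologicalSpace G] [NormedAddCommGroup E]
    [InnerProductSpace ℝ E] (𝒟 : ExpData G E)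

/-- The Lie algebra of a commutative subgroup. -/
def lieOf (S : Subgroup G) (hS : ∀ x ∈ S, ∀ y ∈ S, x * y = y * x) : Submodule ℝ E where
  carrier := {X | ∀ t : ℝ, 𝒟.exp (t • X) ∈ S}
  zero_mem' t := by simp [𝒟.exp_zero]
  smul_mem' c X hX t := by
    have := hX (t * c)
    rwa [mul_smul] at this
  -- Commutativity makes `exp` additive on these vectors, so no closedness is needed here.
  add_mem' {X Y} hX hY t := by
    rw [smul_add, 𝒟.exp_add]
    · exact S.mul_mem (hX t) (hY t)
    · rw [𝒟.br_eq_zero_iff]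
      intro u v
      rw [smul_smul, smul_smul]
      exact hS _ (hX _) _ (hY _)

variable {𝒟} {S : Subgroup G} {hS : ∀ x ∈ S, ∀ y ∈ S, x * y = y * x}

lemma exp_mem_of_mem_lieOf {X : E} (h : X ∈ 𝒟.lieOf S hS) : 𝒟.exp X ∈ S := by
  simpa using h 1

lemma br_eq_zero_of_mem_lieOf {X Y : E} (hX : X ∈ 𝒟.lieOf S hS) (hY : Y ∈ 𝒟.lieOf S hS) :
    𝒟.br X Y = 0 :=
  𝒟.br_eq_zero_iff.2 fun s t => hS _ (hX s) _ (hY t)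

variable [FiniteDimensional ℝ E]

/-- Cartan's argument: if `u` is a limit of the directions of the `B k`, then along a subsequence `τ
u` is the limit of the integer multiples `⌊τ / ‖B k‖⌋ B k`, which all exponentiate into the closed
group `S`. -/
lemma exists_mem_lieOf_of_tendsto (hcl : IsClosed (S : Set G)) {B : ℕ → E} (hB : ∀ k, B k ≠ 0)
    (hlim : Tendsto B atTop (𝓝 0)) (hmem : ∀ k, 𝒟.exp (B k) ∈ S) {N : Submodule ℝ E}
    (hN : ∀ k, B k ∈ N) : ∃ u ∈ N, u ≠ 0 ∧ u ∈ 𝒟.lieOf S hS := by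
  have hsph : ∀ k, ‖B k‖⁻¹ • B k ∈ Metric.sphere (0 : E) 1 := fun k => by
    rw [mem_sphere_zero_iff_norm, norm_smul, norm_inv, norm_norm,
      inv_mul_cancel₀ (norm_ne_zero_iff.2 (hB k))]
  obtain ⟨u, hu, φ, hφ, htend⟩ := (isCompact_sphere (0 : E) 1).tendsto_subseq hsph
  have huN : u ∈ N := (Submodule.closed_of_finiteDimensional N).mem_of_tendsto htend
    (Eventually.of_forall fun k => N.smul_mem _ (hN _))
  refine ⟨u, huN, ?_, fun τ => ?_⟩
  · rintro rfl
    simp at hu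
  have hnorm : Tendsto (fun k => ‖B (φ k)‖) atTop (𝓝 0) := by
    simpa using (hlim.comp hφ.tendsto_atTop).norm
  have hfloor : Tendsto (fun k => (⌊τ / ‖B (φ k)‖⌋ : ℝ) * ‖B (φ k)‖) atTop (𝓝 τ) := by
    have h1 : Tendsto (fun k => τ - ‖B (φ k)‖) atTop (𝓝 τ) := by
      simpa using tendsto_const_nhds.sub hnorm
    refine tendsto_of_tendsto_of_tendsto_of_le_of_le h1 tendsto_const_nhds (fun k => ?_) fun k => ?_
    · have hpos := norm_pos_iff.2 (hB (φ k))
      have := (Int.sub_one_lt_floor (τ / ‖B (φ k)‖)).le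
      have := mul_le_mul_of_nonneg_right this hpos.le
      rwa [sub_mul, div_mul_cancel₀ _ hpos.ne', one_mul] at this
    · have hpos := norm_pos_iff.2 (hB (φ k))
      have := mul_le_mul_of_nonneg_right (Int.floor_le (τ / ‖B (φ k)‖)) hpos.le
      rwa [div_mul_cancel₀ _ hpos.ne'] at this
  have h2 := hfloor.smul htend
  have h3 := (𝒟.continuous_exp.tendsto (τ • u)).comp h2
  refine hcl.mem_of_tendsto h3 (Eventually.of_forall fun k => ?_)
  have h4 : ∀ (m : ℤ) (X : E), 𝒟.exp X ∈ S → 𝒟.exp ((m : ℝ) • X) ∈ S := by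
    intro m X hX
    obtain ⟨j, rfl | rfl⟩ := m.eq_nat_or_neg
    · rw [Int.cast_natCast, 𝒟.exp_natCast_smul]
      exact S.pow_mem hX _
    · rw [Int.cast_neg, Int.cast_natCast, neg_smul, 𝒟.exp_neg, 𝒟.exp_natCast_smul]
      exact S.inv_mem (S.pow_mem hX _)
  have h5 := h4 ⌊τ / ‖B (φ k)‖⌋ _ (hmem (φ k))
  simp only [Function.comp_apply, smul_smul]
  rwa [mul_assoc, mul_inv_cancel₀ (norm_ne_zero_iff.2 (hB (φ k))), mul_one]

lemma exists_orthogonal_eq_zero (hcl : IsClosed (S : Set G)) :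
    ∃ ε > 0, ∀ B ∈ (𝒟.lieOf S hS)ᗮ, ‖B‖ < ε → 𝒟.exp B ∈ S → B = 0 := by
  by_contra! hcon
  choose B hB1 hB2 hB3 hB4 using fun k : ℕ => hcon (1 / ((k : ℝ) + 1)) (by positivity)
  have hlim : Tendsto B atTop (𝓝 0) :=
    squeeze_zero_norm (fun k => (hB2 k).le) tendsto_one_div_add_atTop_nhds_zero_nat
  obtain ⟨u, hu1, hu2, hu3⟩ := exists_mem_lieOf_of_tendsto (hS := hS) hcl hB4 hlim hB3 hB1
  exact hu2 (inner_self_eq_zero.1 ((Submodule.mem_orthogonal _ _).1 hu1 u hu3))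

-- Split a short logarithm `C` of `x` as `A + B` along the Lie algebra of `S` and its orthogonal
-- complement. Since `exp C` commutes with all `exp (t A)`, one has `[A, C] = 0`, so `exp B = exp
-- (-A) exp C` lies in `S`; then `B = 0` by `exists_orthogonal_eq_zero`.
variable (hS) in
lemma exists_nhds_eq_exp (hcl : IsClosed (S : Set G)) :
    ∃ U ∈ 𝓝 (1 : G), ∀ x ∈ S, x ∈ U → ∃ X ∈ 𝒟.lieOf S hS, 𝒟.exp X = x := by
  obtain ⟨ε, hε, h⟩ := exists_orthogonal_eq_zero (hS := hS) (𝒟 := 𝒟) hcl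
  obtain ⟨U, hU, hexp⟩ := 𝒟.exists_exp_eq (lt_min hε 𝒟.radius_pos)
  refine ⟨U, hU, fun x hx hxU => ?_⟩
  obtain ⟨C, hC, rfl⟩ := hexp x hxU
  obtain ⟨A, hA, B, hB, rfl⟩ := (𝒟.lieOf S hS).exists_add_mem_mem_orthogonal C
  have hAB : inner ℝ A B = 0 := (Submodule.mem_orthogonal _ _).1 hB A hA
  have hBC : ‖B‖ ≤ ‖A + B‖ := by
    rw [← abs_of_nonneg (norm_nonneg B), ← abs_of_nonneg (norm_nonneg (A + B)), ← sq_le_sq,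
      sq, sq, norm_add_sq_eq_norm_sq_add_norm_sq_of_inner_eq_zero _ _ hAB]
    nlinarith [norm_nonneg A]
  have hbr : 𝒟.br A (A + B) = 0 := by
    refine 𝒟.Ad_exp_smul_eq_iff.1 fun t => 𝒟.Ad_eq_of_commute (hC.trans_le (min_le_right _ _)) ?_
    exact hS _ (hA t) _ hx
  have hB0 : B = 0 := by
    refine h B hB ((hBC.trans_lt hC).trans_le (min_le_left _ _)) ?_
    have h1 : 𝒟.exp (-A + (A + B)) = 𝒟.exp (-A) * 𝒟.exp (A + B) := by
      refine 𝒟.exp_add ?_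
      rw [map_neg, LinearMap.neg_apply, hbr, neg_zero]
    rw [neg_add_cancel_left] at h1
    rw [h1]
    exact S.mul_mem (exp_mem_of_mem_lieOf (neg_mem hA)) hx
  exact ⟨A, hA, by rw [hB0, add_zero]⟩

variable [IsTopologicalGroup G]

lemma commute_of_Ad_eq (hcl : IsClosed (S : Set G)) (hconn : IsPreconnected (S : Set G)) {g : G}
    (hg : ∀ X ∈ 𝒟.lieOf S hS, 𝒟.Ad g X = X) : ∀ x ∈ S, Commute g x := by
  obtain ⟨U, hU, h⟩ := exists_nhds_eq_exp (𝒟 := 𝒟) hS hcl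
  have : S ≤ Subgroup.centralizer {g} := by
    refine le_of_isPreconnected hconn hU fun x hx hxU => ?_
    obtain ⟨X, hX, rfl⟩ := h x hx hxU
    rw [Subgroup.mem_centralizer_singleton_iff]
    simpa using (𝒟.commute_exp_iff.2 (hg X hX) 1).eq.symm
  intro x hx
  exact (Subgroup.mem_centralizer_singleton_iff.1 (this hx)).symm

lemma exp_mem_identityComponent {H : Subgroup G} {X : E} (h : ∀ t : ℝ, 𝒟.exp (t • X) ∈ H) :
    𝒟.exp X ∈ identityComponent H := by
  have hc : IsPreconnected (range fun t : ℝ => 𝒟.exp (t • X)) :=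
    isPreconnected_range (𝒟.continuous_exp_smul X)
  refine subset_identityComponent hc ⟨0, by simp [𝒟.exp_zero]⟩ ?_ ⟨1, by simp⟩
  rintro _ ⟨t, rfl⟩
  exact h t

lemma identityComponent_fixedSubgroup_le (σ : 𝒟.Aut) :
    identityComponent (fixedSubgroup σ.toAut) ≤
      Subgroup.closure (𝒟.exp '' {X | σ.diff X = X}) := by
  obtain ⟨U, hU, hexp⟩ := 𝒟.exists_exp_eq 𝒟.radius_pos
  refine identityComponent_le hU fun x hx hxU => ?_
  obtain ⟨X, hX, rfl⟩ := hexp x hxU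
  exact Subgroup.subset_closure ⟨X, σ.diff_eq_of_exp_mem hX hx, rfl⟩

/-- The closure of `S exp(ℝX)` is a torus in the identity component of `H` that contains `S`, so it
equals `S`. -/
lemma mem_lieOf_of_maximal [CompactSpace G] [T2Space G] {H : Subgroup G}
    (hH : IsClosed (H : Set G)) (hmax : IsMaximalTorus (identityComponent H) S) {X : E}
    (hXH : ∀ t : ℝ, 𝒟.exp (t • X) ∈ H) (hX : ∀ t : ℝ, ∀ x ∈ S, Commute (𝒟.exp (t • X)) x) :
    X ∈ 𝒟.lieOf S hS := by
  have hXX : ∀ s t : ℝ, Commute (𝒟.exp (s • X)) (𝒟.exp (t • X)) := fun s t => by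
    rw [commute_iff_eq, ← 𝒟.exp_add_smul, ← 𝒟.exp_add_smul, add_comm]
  let N : Subgroup G :=
    { carrier := (fun p : G × ℝ => p.1 * 𝒟.exp (p.2 • X)) '' ((S : Set G) ×ˢ univ)
      one_mem' := ⟨(1, 0), ⟨S.one_mem, trivial⟩, by simp [𝒟.exp_zero]⟩
      mul_mem' := by
        rintro _ _ ⟨⟨x, s⟩, ⟨hx, -⟩, rfl⟩ ⟨⟨y, t⟩, ⟨hy, -⟩, rfl⟩
        refine ⟨(x * y, s + t), ⟨S.mul_mem hx hy, trivial⟩, ?_⟩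
        simp only [𝒟.exp_add_smul]
        exact ((hX s y hy).mul_mul_mul_comm _ _).symm
      inv_mem' := by
        rintro _ ⟨⟨x, s⟩, ⟨hx, -⟩, rfl⟩
        refine ⟨(x⁻¹, -s), ⟨S.inv_mem hx, trivial⟩, ?_⟩
        simp only [neg_smul, 𝒟.exp_neg, mul_inv_rev]
        exact ((hX s x hx).inv_inv).eq.symm }
  have hN : (N : Set G) = (fun p : G × ℝ => p.1 * 𝒟.exp (p.2 • X)) '' ((S : Set G) ×ˢ univ) := rfl
  have hNcomm : ∀ x ∈ N, ∀ y ∈ N, x * y = y * x := by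
    rintro _ ⟨⟨x, s⟩, ⟨hx, -⟩, rfl⟩ _ ⟨⟨y, t⟩, ⟨hy, -⟩, rfl⟩
    have h1 : Commute x (y * 𝒟.exp (t • X)) :=
      Commute.mul_right (hS x hx y hy) (hX t x hx).symm
    have h2 : Commute (𝒟.exp (s • X)) (y * 𝒟.exp (t • X)) :=
      Commute.mul_right (hX s y hy) (hXX s t)
    exact h1.mul_left h2
  have hNconn : IsConnected (N : Set G) := by
    rw [hN]
    refine (hmax.prop.1.isConnected.prod isConnected_univ).image _ ?_
    exact (continuous_fst.mul ((𝒟.continuous_exp_smul X).comp continuous_snd)).continuousOn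
  have hNH : N ≤ H := by
    rintro _ ⟨⟨x, s⟩, ⟨hx, -⟩, rfl⟩
    exact H.mul_mem (identityComponent_le_self H (hmax.prop.2 hx)) (hXH s)
  have hcl : N.topologicalClosure ≤ H := N.topologicalClosure_minimal hNH hH
  have hconn : IsConnected (N.topologicalClosure : Set G) := hNconn.closure
  have hcomm : ∀ x ∈ N.topologicalClosure, ∀ y ∈ N.topologicalClosure, x * y = y * x := by
    intro x hx y hy
    have h1 : ∀ y ∈ N, N.topologicalClosure ≤ Subgroup.centralizer {y} := fun y hy =>
      N.topologicalClosure_minimal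
        (fun x hx => Subgroup.mem_centralizer_singleton_iff.2 (hNcomm x hx y hy))
        (Set.isClosed_centralizer {y})
    have h2 : N.topologicalClosure ≤ Subgroup.centralizer {x} :=
      N.topologicalClosure_minimal
        (fun z hz => Subgroup.mem_centralizer_singleton_iff.2
          (Subgroup.mem_centralizer_singleton_iff.1 (h1 z hz hx)).symm)
        (Set.isClosed_centralizer {x})
    exact (Subgroup.mem_centralizer_singleton_iff.1 (h2 hy)).symm
  have hle : N.topologicalClosure ≤ S := by
    refine hmax.2 ⟨⟨N.isClosed_topologicalClosure.isCompact, hconn, hcomm⟩, ?_⟩ ?_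
    · exact subset_identityComponent hconn.isPreconnected (one_mem _) hcl
    · intro x hx
      exact N.le_topologicalClosure ⟨(x, 0), ⟨hx, trivial⟩, by simp [𝒟.exp_zero]⟩
  intro t
  exact hle (N.le_topologicalClosure ⟨(1, t), ⟨S.one_mem, trivial⟩, by simp⟩)

end ExpData

/-! ### Linear algebra: orthogonal families and kernel dimensions -/

section Auxiliary

variable {E : Type*} [NormedAddCommGroup E] [InnerProductSpace ℝ E] [FiniteDimensional ℝ E]

lemma exists_eq_bot_of_pairwise_isOrtho {ι : Type*} [Infinite ι] (W : ι → Submodule ℝ E)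
    (h : Pairwise fun i j => W i ⟂ W j) : ∃ i, W i = ⊥ := by
  have hfam : OrthogonalFamily ℝ (fun i => W i) fun i => (W i).subtypeₗᵢ :=
    OrthogonalFamily.of_pairwise h
  by_contra! hne
  have hfin := WellFoundedGT.finite_ne_bot_of_iSupIndep hfam.independent
  have : {i | W i ≠ ⊥} = univ := eq_univ_of_forall hne
  rw [this] at hfin
  exact infinite_univ hfin

/-- The hypothesis makes the kernel the whole generalized eigenspace of `0`, whose dimension is the
multiplicity of `0` as a root of the characteristic polynomial. -/
lemma finrank_ker_eq_of_semisimple {V : Type*} [AddCommGroup V] [Module ℝ V]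
    [FiniteDimensional ℝ V] {f : Module.End ℝ V} (h : ∀ x, f (f x) = 0 → f x = 0) :
    Module.finrank ℝ (LinearMap.ker f) = f.charpoly.natTrailingDegree := by
  rw [← LinearMap.finrank_maxGenEigenspace_zero_eq]
  suffices LinearMap.ker f = f.maxGenEigenspace 0 by rw [this]
  ext x
  rw [Module.End.mem_maxGenEigenspace, LinearMap.mem_ker]
  simp only [zero_smul, sub_zero]
  constructor
  · intro hx
    exact ⟨1, by simpa using hx⟩
  · rintro ⟨k, hk⟩
    induction k with
    | zero => simp_all
    | succ k ih =>
      cases k with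
      | zero => simpa using hk
      | succ k =>
        refine ih ?_
        rw [pow_succ', Module.End.mul_apply]
        apply h
        simpa only [pow_succ', Module.End.mul_apply] using hk

/-- Expresses a lower bound for the kernel dimension by vanishing coefficients; for an analytic
family of operators the identity theorem then applies. -/
lemma le_finrank_ker_iff {V : Type*} [AddCommGroup V] [Module ℝ V]
    [FiniteDimensional ℝ V] {f : Module.End ℝ V} (h : ∀ x, f (f x) = 0 → f x = 0) (r : ℕ) :
    r ≤ Module.finrank ℝ (LinearMap.ker f) ↔ ∀ j < r, f.charpoly.coeff j = 0 := by
  rw [finrank_ker_eq_of_semisimple h]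
  constructor
  · intro hr j hj
    exact Polynomial.coeff_eq_zero_of_lt_natTrailingDegree (hj.trans_le hr)
  · intro hr
    by_contra! hlt
    exact Polynomial.coeff_natTrailingDegree_ne_zero.2 f.charpoly_monic.ne_zero (hr _ hlt)

lemma analyticAt_charpoly_coeff {f : ℝ → E →L[ℝ] E} {t : ℝ} (hf : AnalyticAt ℝ f t) (j : ℕ) :
    AnalyticAt ℝ (fun t => (f t : E →ₗ[ℝ] E).charpoly.coeff j) t := by
  classical
  let b := Module.finBasis ℝ E
  have h1 : ∀ t, (f t : E →ₗ[ℝ] E).charpoly.coeff j =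
      MvPolynomial.aeval (fun p : Fin _ × Fin _ => LinearMap.toMatrix b b (f t : E →ₗ[ℝ] E) p.1 p.2)
        ((Matrix.charpoly.univ ℝ (Fin (Module.finrank ℝ E))).coeff j) := by
    intro t
    have h := Matrix.charpoly.univ_coeff_eval₂Hom _ (RingHom.id ℝ)
      (fun p : Fin (Module.finrank ℝ E) × Fin (Module.finrank ℝ E) =>
        LinearMap.toMatrix b b (f t : E →ₗ[ℝ] E) p.1 p.2) j
    rw [← LinearMap.charpoly_toMatrix _ b]
    exact h.symm
  simp only [h1]
  refine AnalyticAt.aeval_mvPolynomial (fun p => ?_) _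
  simp only [LinearMap.toMatrix_apply]
  have h2 : AnalyticAt ℝ (fun t => f t (b p.2)) t :=
    ((ContinuousLinearMap.apply ℝ E (b p.2)).analyticAt _).comp hf
  exact ((LinearMap.toContinuousLinearMap (b.coord p.1)).analyticAt _).comp h2

end Auxiliary

/-! ### Analyticity of `Ad` and generic elements of abelian subalgebras -/

namespace ExpData

variable {G E : Type*} [Group G] [TopologicalSpace G] [NormedAddCommGroup E]
    [InnerProductSpace ℝ E] [FiniteDimensional ℝ E] (𝒟 : ExpData G E)

/-- The adjoint representation of the Lie algebra. -/
def ad (X : E) : E →L[ℝ] E := LinearMap.toContinuousLinearMap (𝒟.br X)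

lemma br_self (X : E) : 𝒟.br X X = 0 := by
  have h : (2 : ℝ) • 𝒟.br X X = 0 := by
    rw [two_smul]
    nth_rewrite 1 [𝒟.br_skew]
    exact neg_add_cancel _
  exact (smul_eq_zero.1 h).resolve_left two_ne_zero

lemma br_br_comm {X Y : E} (h : 𝒟.br X Y = 0) (Z : E) :
    𝒟.br X (𝒟.br Y Z) = 𝒟.br Y (𝒟.br X Z) := by
  have h1 := 𝒟.hasDerivAt_Ad_zero X (𝒟.br Y Z)
  have h2 := (𝒟.ad Y).hasFDerivAt.comp_hasDerivAt 0 (𝒟.hasDerivAt_Ad_zero X Z)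
  refine h1.unique (h2.congr_of_eventuallyEq (Eventually.of_forall fun t => ?_))
  simp only [𝒟.Ad_br, 𝒟.Ad_exp_smul_eq_iff.2 h]
  rfl

/-- `exp (t ad X) Ad (exp (-t X)) Y` has derivative zero in `t`. The formula is what makes `t ↦ Ad
(exp (t X))` analytic. -/
lemma Ad_exp_smul (X : E) (t : ℝ) : 𝒟.Ad (𝒟.exp (t • X)) = NormedSpace.exp (t • 𝒟.ad X) := by
  have h1 : ∀ t, HasDerivAt (fun t : ℝ => NormedSpace.exp (t • 𝒟.ad X))
      (NormedSpace.exp (t • 𝒟.ad X) * 𝒟.ad X) t := fun t => hasDerivAt_exp_smul_const (𝒟.ad X) t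
  ext Y
  have h2 : ∀ t, HasDerivAt (fun t : ℝ => NormedSpace.exp (t • 𝒟.ad X)
      (𝒟.Ad (𝒟.exp ((-t) • X)) Y)) 0 t := by
    intro t
    have h3 := (𝒟.hasDerivAt_Ad_exp X Y (-t)).scomp t (hasDerivAt_neg t)
    have h4 := (h1 t).clm_apply h3
    refine h4.congr_deriv ?_
    have h5 : 𝒟.Ad (𝒟.exp ((-t) • X)) (𝒟.br X Y) = 𝒟.ad X (𝒟.Ad (𝒟.exp ((-t) • X)) Y) := by
      rw [𝒟.Ad_br]
      congr 2
      refine 𝒟.Ad_exp_of_br ?_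
      simp [𝒟.br_self]
    change NormedSpace.exp (t • 𝒟.ad X) (𝒟.ad X (𝒟.Ad (𝒟.exp ((-t) • X)) Y)) + _ = 0
    rw [← h5]
    simp
  have h3 : ∀ t : ℝ, NormedSpace.exp (t • 𝒟.ad X) (𝒟.Ad (𝒟.exp ((-t) • X)) Y) = Y := by
    intro t
    have := is_const_of_deriv_eq_zero (fun t => (h2 t).differentiableAt) (fun t => (h2 t).deriv) t 0
    simpa [𝒟.exp_zero] using this
  have h4 := h3 (-t)
  rw [neg_neg] at h4
  have h5 : NormedSpace.exp (t • 𝒟.ad X) * NormedSpace.exp ((-t) • 𝒟.ad X) = 1 := by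
    let _ : NormedAlgebra ℚ (E →L[ℝ] E) := NormedAlgebra.restrictScalars ℚ ℝ _
    rw [← NormedSpace.exp_add_of_commute, ← add_smul, add_neg_cancel, zero_smul,
      NormedSpace.exp_zero]
    exact ((Commute.refl _).smul_left _).smul_right _
  have h6 := congrArg (fun L : E →L[ℝ] E => L (𝒟.Ad (𝒟.exp (t • X)) Y)) h5
  change NormedSpace.exp (t • 𝒟.ad X) (NormedSpace.exp ((-t) • 𝒟.ad X) _) = _ at h6
  rw [h4] at h6
  exact h6.symm

lemma analyticAt_Ad_exp (X : E) (t : ℝ) :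
    AnalyticAt ℝ (fun t : ℝ => 𝒟.Ad (𝒟.exp (t • X))) t := by
  simp only [𝒟.Ad_exp_smul]
  have h1 : AnalyticAt ℝ (NormedSpace.exp : (E →L[ℝ] E) → _) (t • 𝒟.ad X) :=
    NormedSpace.exp_analytic _
  exact h1.comp_of_eq (analyticAt_id.smul analyticAt_const) rfl

/-- On the kernel of `ad (X + ε Y)` one has `ad X = -ε ad Y`. As `ad X` and `ad Y` are commuting
skew operators, the images under `ad X` of these kernels are orthogonal for different `ε`; among
infinitely many `ε`, one image is zero. -/
lemma exists_ker_le {X Y : E} (h : 𝒟.br X Y = 0) :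
    ∃ ε : ℝ, ∀ Z, 𝒟.br (X + ε • Y) Z = 0 → 𝒟.br X Z = 0 ∧ 𝒟.br Y Z = 0 := by
  -- The shift by one keeps `ε` nonzero, which is needed to deduce `[Y, Z] = 0` from `ε [Y, Z] = 0`.
  let W : ℕ → Submodule ℝ E := fun k =>
    (LinearMap.ker (𝒟.br (X + ((k : ℝ) + 1) • Y))).map (𝒟.br X)
  have key : ∀ (ε : ℝ) Z, 𝒟.br (X + ε • Y) Z = 0 → 𝒟.br X Z = -(ε • 𝒟.br Y Z) := by
    intro ε Z hZ
    simp only [map_add, map_smul, LinearMap.add_apply, LinearMap.smul_apply] at hZ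
    exact eq_neg_of_add_eq_zero_left hZ
  obtain ⟨k, hk⟩ := exists_eq_bot_of_pairwise_isOrtho W (by
    intro i j hij
    rw [Submodule.isOrtho_iff_inner_eq]
    rintro _ ⟨Z, hZ, rfl⟩ _ ⟨Z', hZ', rfl⟩
    have hi := key _ _ hZ
    have hj := key _ _ hZ'
    have h1 : inner ℝ (𝒟.br X Z) (𝒟.br Y Z') = inner ℝ (𝒟.br Y Z) (𝒟.br X Z') := by
      have e1 := 𝒟.inner_br X Z (𝒟.br Y Z')
      have e2 := 𝒟.inner_br Y Z (𝒟.br X Z')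
      rw [e1, e2, 𝒟.br_br_comm h]
    have h2 : inner ℝ (𝒟.br X Z) (𝒟.br X Z') = -(((j : ℝ) + 1) *
        inner ℝ (𝒟.br X Z) (𝒟.br Y Z')) := by
      rw [hj, inner_neg_right, inner_smul_right]
    have h3 : inner ℝ (𝒟.br X Z) (𝒟.br X Z') = -(((i : ℝ) + 1) *
        inner ℝ (𝒟.br Y Z) (𝒟.br X Z')) := by
      rw [hi, inner_neg_left, real_inner_smul_left]
    have hij' : ((i : ℝ) - j) ≠ 0 := sub_ne_zero.2 (by exact_mod_cast hij)
    have h4 : ((i : ℝ) - j) * inner ℝ (𝒟.br Y Z) (𝒟.br X Z') = 0 := by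
      rw [h1] at h2
      linarith
    rw [h3, (mul_eq_zero.1 h4).resolve_left hij', mul_zero, neg_zero])
  refine ⟨(k : ℝ) + 1, fun Z hZ => ?_⟩
  have h1 : 𝒟.br X Z = 0 := (Submodule.eq_bot_iff _).1 hk _ ⟨Z, hZ, rfl⟩
  refine ⟨h1, ?_⟩
  have h2 := key _ _ hZ
  rw [h1, eq_comm, neg_eq_zero] at h2
  exact (smul_eq_zero.1 h2).resolve_left (by positivity)

/-- An `X` in `N` whose centralizer has least dimension works: by `exists_ker_le`, any `Y ∈ N` that
failed to kill the centralizer would allow a smaller one. -/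
lemma exists_generic (N : Submodule ℝ E) (hN : ∀ X ∈ N, ∀ Y ∈ N, 𝒟.br X Y = 0) :
    ∃ X ∈ N, ∀ Z, 𝒟.br X Z = 0 → ∀ Y ∈ N, 𝒟.br Y Z = 0 := by
  have hwf := wellFounded_lt (α := ℕ)
  obtain ⟨X, hX, hmin⟩ := (InvImage.wf (fun X : E => Module.finrank ℝ (LinearMap.ker (𝒟.br X)))
    hwf).has_min (N : Set E) ⟨0, N.zero_mem⟩
  refine ⟨X, hX, fun Z hZ Y hY => ?_⟩
  obtain ⟨ε, hε⟩ := 𝒟.exists_ker_le (hN X hX Y hY)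
  have hle : LinearMap.ker (𝒟.br (X + ε • Y)) ≤ LinearMap.ker (𝒟.br X) := fun Z hZ => (hε Z hZ).1
  have hmin' := hmin _ (N.add_mem hX (N.smul_mem ε hY))
  have heq := Submodule.eq_of_le_of_finrank_le hle (not_lt.1 hmin')
  have hZ' : Z ∈ LinearMap.ker (𝒟.br (X + ε • Y)) := heq ▸ hZ
  exact (hε Z hZ').2

end ExpData

/-! ### Elements of `K₁` centralizing `S` act trivially on `𝔩` -/

namespace ExpData

variable {G E : Type*} [Group G] [TopologicalSpace G] [NormedAddCommGroup E]
    [InnerProductSpace ℝ E] {𝒟 : ExpData G E}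

/-- The centralizer of the Lie algebra of `S` in the fixed space of `σ`. -/
def centralizerLie (σ : 𝒟.Aut) (S : Subgroup G) (hS : ∀ x ∈ S, ∀ y ∈ S, x * y = y * x) :
    Submodule ℝ E where
  carrier := {X | σ.diff X = X ∧ ∀ Y ∈ 𝒟.lieOf S hS, 𝒟.br Y X = 0}
  zero_mem' := by simp
  add_mem' {X Y} hX hY := ⟨by rw [map_add, hX.1, hY.1], fun Z hZ => by
    rw [map_add, hX.2 Z hZ, hY.2 Z hZ, add_zero]⟩
  smul_mem' c X hX := ⟨by rw [map_smul, hX.1], fun Z hZ => by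
    rw [map_smul, hX.2 Z hZ, smul_zero]⟩

/-- The vectors fixed by `σ` and by `Ad h`. -/
def fixedSpace (σ : 𝒟.Aut) (h : G) : Submodule ℝ E where
  carrier := {X | σ.diff X = X ∧ 𝒟.Ad h X = X}
  zero_mem' := by simp
  add_mem' {X Y} hX hY := ⟨by rw [map_add, hX.1, hY.1], by rw [map_add, hX.2, hY.2]⟩
  smul_mem' c X hX := ⟨by rw [map_smul, hX.1], by rw [map_smul, hX.2]⟩

variable {σ : 𝒟.Aut} {S : Subgroup G} {hS : ∀ x ∈ S, ∀ y ∈ S, x * y = y * x}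

lemma mem_fixedSpace {h : G} {X : E} : X ∈ fixedSpace σ h ↔ σ.diff X = X ∧ 𝒟.Ad h X = X := Iff.rfl

lemma diff_Ad_of_mem {k : G} (hk : k ∈ fixedSubgroup σ.toAut) {X : E} (hX : σ.diff X = X) :
    σ.diff (𝒟.Ad k X) = 𝒟.Ad k X := by
  have : σ.toAut k = k := hk
  rw [σ.diff_Ad, this, hX]

lemma diff_br_of_eq {X Y : E} (hX : σ.diff X = X) (hY : σ.diff Y = Y) :
    σ.diff (𝒟.br X Y) = 𝒟.br X Y := by
  rw [σ.diff_br, hX, hY]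

/-- Choose `k` to maximize `⟨Ad k Z, W⟩` on the compact fixed subgroup. Criticality gives `⟨[V, Ad k
Z], W⟩ = 0` for every fixed `V`, and `V = [W, Ad k Z]` turns this into the vanishing of its own
norm. -/
lemma exists_br_Ad_eq_zero [CompactSpace G] [T2Space G] {Z W : E} (hZ : σ.diff Z = Z)
    (hW : σ.diff W = W) : ∃ k ∈ fixedSubgroup σ.toAut, 𝒟.br W (𝒟.Ad k Z) = 0 := by
  have hcomp : IsCompact (fixedSubgroup σ.toAut : Set G) :=
    (isClosed_fixedSubgroup σ.continuous_toAut).isCompact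
  obtain ⟨k, hk, hmax⟩ := hcomp.exists_isMaxOn ⟨1, one_mem _⟩
    (f := fun k => inner ℝ (𝒟.Ad k Z) W) ((𝒟.continuous_Ad Z).inner continuous_const).continuousOn
  refine ⟨k, hk, ?_⟩
  have h1 : ∀ V, σ.diff V = V → inner ℝ (𝒟.br V (𝒟.Ad k Z)) W = 0 := by
    intro V hV
    have hd := (𝒟.hasDerivAt_Ad_zero V (𝒟.Ad k Z)).inner ℝ (hasDerivAt_const (0 : ℝ) W)
    simp only [inner_zero_right, zero_add] at hd
    refine IsLocalMax.hasDerivAt_eq_zero (Eventually.of_forall fun t => ?_) hd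
    have hmem : 𝒟.exp (t • V) * k ∈ fixedSubgroup σ.toAut :=
      mul_mem (σ.exp_mem_fixedSubgroup (by rw [map_smul, hV])) hk
    have := hmax hmem
    simpa [𝒟.exp_zero, 𝒟.Ad_mul_apply] using this
  have h2 := h1 (𝒟.br W (𝒟.Ad k Z)) (diff_br_of_eq hW (diff_Ad_of_mem hk hZ))
  rw [𝒟.br_skew, inner_neg_left, 𝒟.inner_br, neg_neg, 𝒟.br_skew (𝒟.Ad k Z), inner_neg_right,
    neg_eq_zero] at h2
  exact inner_self_eq_zero.1 h2

/-- The orthogonal projection to the fixed space of an involution `σ`. -/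
def fixedProj (σ : 𝒟.Aut) : E →L[ℝ] E := (2⁻¹ : ℝ) • (ContinuousLinearMap.id ℝ E + σ.diff)

lemma fixedProj_apply (X : E) : fixedProj σ X = (2⁻¹ : ℝ) • (X + σ.diff X) := rfl

lemma fixedProj_of_eq {X : E} (hX : σ.diff X = X) : fixedProj σ X = X := by
  rw [fixedProj_apply, hX, ← two_smul ℝ, smul_smul]
  norm_num

lemma diff_fixedProj (hσ : ∀ X, σ.diff (σ.diff X) = X) (X : E) :
    σ.diff (fixedProj σ X) = fixedProj σ X := by
  rw [fixedProj_apply, map_smul, map_add, hσ, add_comm]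

lemma inner_fixedProj (hσ : ∀ X, σ.diff (σ.diff X) = X) (X Y : E) :
    inner ℝ (fixedProj σ X) Y = inner ℝ X (fixedProj σ Y) := by
  have : inner ℝ (σ.diff X) Y = inner ℝ X (σ.diff Y) := by
    rw [← σ.inner_diff X, hσ]
  simp only [fixedProj_apply, real_inner_smul_left, real_inner_smul_right, inner_add_left,
    inner_add_right, this]

/-- An operator with kernel `fixedSpace σ h`. -/
def fixedOp (σ : 𝒟.Aut) (h : G) : E →L[ℝ] E :=
  𝒟.Ad h * fixedProj σ - 1

lemma fixedOp_apply (h : G) (X : E) : fixedOp σ h X = 𝒟.Ad h (fixedProj σ X) - X := rfl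

lemma fixedOp_eq_zero_iff (hσ : ∀ X, σ.diff (σ.diff X) = X) {h : G}
    (hh : h ∈ fixedSubgroup σ.toAut) {X : E} : fixedOp σ h X = 0 ↔ X ∈ fixedSpace σ h := by
  rw [fixedOp_apply, sub_eq_zero, mem_fixedSpace]
  constructor
  · intro hX
    have h1 : σ.diff X = X := by
      rw [← hX]
      exact diff_Ad_of_mem hh (diff_fixedProj hσ X)
    rw [fixedProj_of_eq h1] at hX
    exact ⟨h1, hX⟩
  · rintro ⟨h1, h2⟩
    rw [fixedProj_of_eq h1, h2]

/-- Vectors fixed by `σ` and `Ad h` are orthogonal to the image of `Ad h ∘ fixedProj σ - 1`, because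
`fixedProj σ` is self-adjoint and `Ad h` is orthogonal. An image vector in the kernel is therefore
zero, as `le_finrank_ker_iff` requires. -/
lemma fixedOp_fixedOp (hσ : ∀ X, σ.diff (σ.diff X) = X) {h : G}
    (hh : h ∈ fixedSubgroup σ.toAut) {X : E} (hX : fixedOp σ h (fixedOp σ h X) = 0) :
    fixedOp σ h X = 0 := by
  obtain ⟨h1, h2⟩ := (fixedOp_eq_zero_iff hσ hh).1 hX
  have h3 : 𝒟.Ad h⁻¹ (fixedOp σ h X) = fixedOp σ h X := by
    nth_rewrite 1 [← h2]
    rw [𝒟.Ad_inv_Ad]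
  have h4 : inner ℝ (fixedOp σ h X) (fixedOp σ h X) = 0 := by
    nth_rewrite 1 [fixedOp_apply]
    rw [inner_sub_left, 𝒟.inner_Ad_left, h3, inner_fixedProj hσ, fixedProj_of_eq h1, sub_self]
  exact inner_self_eq_zero.1 h4

variable [FiniteDimensional ℝ E]

lemma le_finrank_fixedSpace_iff (hσ : ∀ X, σ.diff (σ.diff X) = X) {h : G}
    (hh : h ∈ fixedSubgroup σ.toAut) (r : ℕ) : r ≤ Module.finrank ℝ (fixedSpace σ h) ↔
      ∀ j < r, (fixedOp σ h : E →ₗ[ℝ] E).charpoly.coeff j = 0 := by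
  rw [← le_finrank_ker_iff (f := (fixedOp σ h : E →ₗ[ℝ] E)) fun X hX => fixedOp_fixedOp hσ hh hX]
  have : LinearMap.ker (fixedOp σ h : E →ₗ[ℝ] E) = fixedSpace σ h := by
    ext X
    exact fixedOp_eq_zero_iff hσ hh
  rw [this]

lemma exists_analytic_path [IsTopologicalGroup G] {h : G} (hh : h ∈ Subgroup.closure (𝒟.exp '' {X | σ.diff X = X})) :
    ∃ γ : ℝ → G, γ 0 = 1 ∧ γ 1 = h ∧ ContinuousAt γ 0 ∧ (∀ t, γ t ∈ fixedSubgroup σ.toAut) ∧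
      ∀ t, AnalyticAt ℝ (fun t => 𝒟.Ad (γ t)) t := by
  induction hh using Subgroup.closure_induction with
  | mem x hx =>
    obtain ⟨X, hX, rfl⟩ := hx
    refine ⟨fun t => 𝒟.exp (t • X), by simp [𝒟.exp_zero], by simp,
      (𝒟.continuous_exp_smul X).continuousAt, fun t => ?_, 𝒟.analyticAt_Ad_exp X⟩
    exact σ.exp_mem_fixedSubgroup (by rw [map_smul, hX])
  | one =>
    exact ⟨fun _ => 1, rfl, rfl, continuousAt_const, fun _ => one_mem _, fun _ => analyticAt_const⟩
  | mul x y _ _ hx hy =>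
    obtain ⟨γ, h0, h1, hc, hm, ha⟩ := hx
    obtain ⟨γ', h0', h1', hc', hm', ha'⟩ := hy
    refine ⟨fun t => γ t * γ' t, by simp [h0, h0'], by simp [h1, h1'], hc.mul hc',
      fun t => mul_mem (hm t) (hm' t), fun t => ?_⟩
    simp only [map_mul]
    exact (ha t).mul (ha' t)
  | inv x _ hx =>
    obtain ⟨γ, h0, h1, hc, hm, ha⟩ := hx
    refine ⟨fun t => (γ t)⁻¹, by simp [h0], by simp [h1], hc.inv, fun t => inv_mem (hm t),
      fun t => ?_⟩
    have e : ∀ t, 𝒟.Ad (γ t)⁻¹ = Ring.inverse (𝒟.Ad (γ t)) := fun t =>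
      (Ring.inverse_unit (Units.map 𝒟.Ad (toUnits (γ t)))).symm
    simp only [e]
    have h : AnalyticAt ℝ Ring.inverse (𝒟.Ad (γ t)) :=
      analyticAt_inverse (𝕜 := ℝ) (Units.map 𝒟.Ad (toUnits (γ t)))
    exact AnalyticAt.comp (g := Ring.inverse) (f := fun t => 𝒟.Ad (γ t)) h (ha t)

/-- Analytic continuation along a path from `1` to `h`: near time `0` the path consists of
exponentials of fixed vectors, so the relevant coefficients vanish there, hence also at time `1`.
This takes the place of surjectivity of `exp` onto `K₁`. -/
lemma le_finrank_fixedSpace [IsTopologicalGroup G] (hσ : ∀ X, σ.diff (σ.diff X) = X) {r : ℕ}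
    (hr : ∀ Z, σ.diff Z = Z → r ≤ Module.finrank ℝ (fixedSpace σ (𝒟.exp Z))) {h : G}
    (hh : h ∈ Subgroup.closure (𝒟.exp '' {X | σ.diff X = X})) :
    r ≤ Module.finrank ℝ (fixedSpace σ h) := by
  obtain ⟨γ, h0, h1, hcont, hmem, han⟩ := exists_analytic_path hh
  have hmem' := hmem 1
  rw [h1] at hmem'
  rw [le_finrank_fixedSpace_iff hσ hmem']
  intro j hj
  have han' : AnalyticOnNhd ℝ (fun t => (fixedOp σ (γ t) : E →ₗ[ℝ] E).charpoly.coeff j) univ := by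
    intro t _
    refine analyticAt_charpoly_coeff ?_ j
    exact ((han t).mul analyticAt_const).sub analyticAt_const
  have hev : ∀ᶠ t in 𝓝 (0 : ℝ), (fixedOp σ (γ t) : E →ₗ[ℝ] E).charpoly.coeff j = 0 := by
    obtain ⟨U, hU, hexp⟩ := 𝒟.exists_exp_eq 𝒟.radius_pos
    rw [← h0] at hU
    filter_upwards [hcont.preimage_mem_nhds hU] with t ht
    obtain ⟨Z, hZ, hZt⟩ := hexp _ ht
    have hZ' : σ.diff Z = Z := σ.diff_eq_of_exp_mem hZ (hZt ▸ hmem t)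
    have := hr Z hZ'
    rw [hZt] at this
    exact (le_finrank_fixedSpace_iff hσ (hmem t) r).1 this j hj
  have := han'.eqOn_zero_of_preconnected_of_eventuallyEq_zero isPreconnected_univ (mem_univ 0) hev
    (mem_univ 1)
  simpa [h1] using this

/-- Some `Ad k` moves `Z` into `𝔩`. As `𝔩` is abelian, `exp (Ad k Z)` fixes it, so `exp Z` fixes the
conjugate `Ad k⁻¹ 𝔩` of the same dimension. -/
lemma finrank_centralizerLie_le [CompactSpace G] [T2Space G] (hSσ : S ≤ fixedSubgroup σ.toAut)
    (hab : ∀ X ∈ centralizerLie σ S hS, ∀ Y ∈ centralizerLie σ S hS, 𝒟.br X Y = 0) {Z : E}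
    (hZ : σ.diff Z = Z) :
    Module.finrank ℝ (centralizerLie σ S hS) ≤ Module.finrank ℝ (fixedSpace σ (𝒟.exp Z)) := by
  obtain ⟨W, hW, hgen⟩ := 𝒟.exists_generic (𝒟.lieOf S hS)
    fun X hX Y hY => br_eq_zero_of_mem_lieOf hX hY
  obtain ⟨k, hk, hk0⟩ := exists_br_Ad_eq_zero hZ
    (σ.diff_eq_of_forall fun t => hSσ (hW t))
  have hZ' : 𝒟.Ad k Z ∈ centralizerLie σ S hS := ⟨diff_Ad_of_mem hk hZ, hgen _ hk0⟩
  have hmaps : ∀ X ∈ centralizerLie σ S hS,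
      (𝒟.Ad k⁻¹ : E →ₗ[ℝ] E) X ∈ fixedSpace σ (𝒟.exp Z) := by
    intro X hX
    refine ⟨diff_Ad_of_mem (inv_mem hk) hX.1, ?_⟩
    have h1 : 𝒟.exp Z = k⁻¹ * 𝒟.exp (𝒟.Ad k Z) * k := by
      rw [← 𝒟.conj_exp]
      group
    change 𝒟.Ad (𝒟.exp Z) (𝒟.Ad k⁻¹ X) = 𝒟.Ad k⁻¹ X
    rw [h1, 𝒟.Ad_mul_apply, 𝒟.Ad_Ad_inv, 𝒟.Ad_mul_apply, 𝒟.Ad_exp_of_br (hab _ hZ' _ hX)]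
  refine LinearMap.finrank_le_finrank_of_injective (f := (𝒟.Ad k⁻¹ : E →ₗ[ℝ] E).restrict hmaps) ?_
  intro X Y hXY
  have h1 : 𝒟.Ad k⁻¹ (X : E) = 𝒟.Ad k⁻¹ (Y : E) := congrArg Subtype.val hXY
  have h2 := congrArg (𝒟.Ad k) h1
  rw [𝒟.Ad_Ad_inv, 𝒟.Ad_Ad_inv] at h2
  exact Subtype.ext h2

/-- With `W` generic in the Lie algebra of `S`, let `F k` be the fixed space of `g exp (τ k W)` in
`𝔨₁`. The spaces `ad W (F k)` are pairwise orthogonal, so one of them is zero, and then `F k ⊆ 𝔩`.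
The dimension bound `le_finrank_fixedSpace` gives equality. Since `exp (τ k W)` fixes `𝔩`, so does
`g`. -/
lemma Ad_eq_of_mem_centralizerLie [CompactSpace G] [T2Space G] [IsTopologicalGroup G]
    (hσ : ∀ X, σ.diff (σ.diff X) = X) (hSσ : S ≤ fixedSubgroup σ.toAut)
    (hab : ∀ X ∈ centralizerLie σ S hS, ∀ Y ∈ centralizerLie σ S hS, 𝒟.br X Y = 0) {g : G}
    (hg : g ∈ identityComponent (fixedSubgroup σ.toAut))
    (hgS : ∀ X ∈ 𝒟.lieOf S hS, 𝒟.Ad g X = X) {X : E} (hX : X ∈ centralizerLie σ S hS) :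
    𝒟.Ad g X = X := by
  obtain ⟨W, hW, hgen⟩ := 𝒟.exists_generic (𝒟.lieOf S hS)
    fun X hX Y hY => br_eq_zero_of_mem_lieOf hX hY
  have hWσ : σ.diff W = W := σ.diff_eq_of_forall fun t => hSσ (hW t)
  have hcomm : ∀ t : ℝ, Commute g (𝒟.exp (t • W)) := 𝒟.commute_exp_iff.2 (hgS W hW)
  obtain ⟨c, hc0, hc⟩ : ∃ c : ℝ, 0 < c ∧ ∀ t : ℝ, |t| < c → ‖t • W‖ < 𝒟.radius := by
    refine ⟨𝒟.radius / (‖W‖ + 1), div_pos 𝒟.radius_pos (by positivity), fun t ht => ?_⟩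
    rw [lt_div_iff₀ (by positivity)] at ht
    rw [norm_smul, Real.norm_eq_abs]
    nlinarith [abs_nonneg t]
  -- Distinct values strictly between `0` and `c`: the differences are nonzero, and their multiples
  -- of `W` are shorter than the injectivity radius.
  let τ : ℕ → ℝ := fun k => c / (k + 2)
  have hτ : ∀ i j, |τ i - τ j| < c := by
    have h1 : ∀ k, 0 < τ k ∧ τ k < c := fun k => by
      refine ⟨by positivity, ?_⟩
      rw [div_lt_iff₀ (by positivity)]
      nlinarith [(Nat.cast_nonneg k : (0 : ℝ) ≤ k)]
    intro i j
    rw [abs_lt]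
    constructor <;> linarith [h1 i, h1 j, (h1 i).1, (h1 j).1, (h1 i).2, (h1 j).2]
  have hτinj : ∀ i j, i ≠ j → τ i - τ j ≠ 0 := by
    intro i j hij h
    rw [sub_eq_zero, div_eq_div_iff (by positivity) (by positivity)] at h
    have h2 := mul_left_cancel₀ hc0.ne' h
    exact hij (by exact_mod_cast (by linarith : (i : ℝ) = j))
  let F : ℕ → Submodule ℝ E := fun k => fixedSpace σ (g * 𝒟.exp (τ k • W))
  -- the operator `ad W` preserves each of the spaces `F k`
  have hgW : ∀ X, 𝒟.Ad g (𝒟.br W X) = 𝒟.br W (𝒟.Ad g X) := fun X => by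
    rw [𝒟.Ad_br, hgS W hW]
  have heW : ∀ (t : ℝ) X, 𝒟.Ad (𝒟.exp (t • W)) (𝒟.br W X) = 𝒟.br W (𝒟.Ad (𝒟.exp (t • W)) X) :=
    fun t X => by rw [𝒟.Ad_br, 𝒟.Ad_exp_smul_eq_iff.2 (𝒟.br_self W)]
  have hF : ∀ k, ∀ X ∈ F k, 𝒟.br W X ∈ F k := by
    rintro k X ⟨h1, h2⟩
    refine ⟨diff_br_of_eq hWσ h1, ?_⟩
    rw [𝒟.Ad_mul_apply] at h2 ⊢
    rw [heW, hgW, h2]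
  have hFe : ∀ (t : ℝ) k, ∀ X ∈ F k, 𝒟.Ad (𝒟.exp (t • W)) X ∈ F k := by
    rintro t k X ⟨h1, h2⟩
    refine ⟨diff_Ad_of_mem (σ.exp_mem_fixedSubgroup (by rw [map_smul, hWσ])) h1, ?_⟩
    rw [← 𝒟.Ad_mul_apply, mul_assoc, ← 𝒟.exp_add_smul, add_comm, 𝒟.exp_add_smul, ← mul_assoc,
      (hcomm t).eq, mul_assoc, 𝒟.Ad_mul_apply, h2]
  obtain ⟨k, hk⟩ := exists_eq_bot_of_pairwise_isOrtho (fun k => (F k).map (𝒟.br W)) (by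
    intro i j hij
    set δ := τ i - τ j
    -- `Ad (exp (δ W)) - 1` is bijective on the image of `F i`
    let A : (F i).map (𝒟.br W) →ₗ[ℝ] (F i).map (𝒟.br W) :=
      ((𝒟.Ad (𝒟.exp (δ • W)) : E →ₗ[ℝ] E) - LinearMap.id).restrict (by
        rintro _ ⟨X, hX, rfl⟩
        refine ⟨𝒟.Ad (𝒟.exp (δ • W)) X - X, sub_mem (hFe δ i X hX) hX, ?_⟩
        rw [map_sub, ← heW]
        rfl)
    have hAinj : Function.Injective A := by
      rw [← LinearMap.ker_eq_bot, LinearMap.ker_eq_bot']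
      rintro ⟨_, X, hX, rfl⟩ h0
      have h1 : 𝒟.Ad (𝒟.exp (δ • W)) (𝒟.br W X) = 𝒟.br W X :=
        sub_eq_zero.1 (congrArg Subtype.val h0)
      have h2 := 𝒟.br_eq_zero_of_Ad_exp (hc δ (hτ i j)) h1
      rw [map_smul, LinearMap.smul_apply, smul_eq_zero] at h2
      have h3 := h2.resolve_left (hτinj i j hij)
      have h4 : inner ℝ (𝒟.br W X) (𝒟.br W X) = 0 := by
        rw [𝒟.inner_br, h3, inner_zero_right, neg_zero]
      exact Subtype.ext (inner_self_eq_zero.1 h4)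
    have hAsurj := LinearMap.injective_iff_surjective.1 hAinj
    rw [Submodule.isOrtho_iff_inner_eq]
    intro U hU V hV
    obtain ⟨⟨_, X, hX, rfl⟩, hXU⟩ := hAsurj ⟨U, hU⟩
    have hU' : U = 𝒟.Ad (𝒟.exp (δ • W)) (𝒟.br W X) - 𝒟.br W X := (congrArg Subtype.val hXU).symm
    obtain ⟨Y, hY, rfl⟩ := hV
    have h1 := (hF i X hX).2
    have h2 := (hF j Y hY).2
    -- `[W, X]` and `[W, Y]` are fixed by `g exp (τ i W)` and `g exp (τ j W)`; `Ad g` and `Ad (exp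
    -- (τ j W))` cancel from the inner product, leaving `exp (δ W)`.
    have h3 : inner ℝ (𝒟.br W X) (𝒟.br W Y) =
        inner ℝ (𝒟.Ad (𝒟.exp (δ • W)) (𝒟.br W X)) (𝒟.br W Y) := by
      nth_rewrite 1 [← h1, ← h2]
      rw [𝒟.Ad_mul_apply, 𝒟.Ad_mul_apply, 𝒟.inner_Ad, ← sub_add_cancel (τ i) (τ j), add_comm,
        𝒟.exp_add_smul, 𝒟.Ad_mul_apply, 𝒟.inner_Ad]
    rw [hU', inner_sub_left, h3, sub_self])
  have hle : F k ≤ centralizerLie σ S hS := by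
    intro X hX
    exact ⟨hX.1, hgen X ((Submodule.eq_bot_iff _).1 hk _ ⟨X, hX, rfl⟩)⟩
  have hmem : g * 𝒟.exp (τ k • W) ∈ identityComponent (fixedSubgroup σ.toAut) := by
    refine mul_mem hg (exp_mem_identityComponent fun t => σ.exp_mem_fixedSubgroup ?_)
    rw [map_smul, map_smul, hWσ]
  have hdim := le_finrank_fixedSpace hσ (fun Z hZ => finrank_centralizerLie_le hSσ hab hZ)
    (identityComponent_fixedSubgroup_le σ hmem)
  have heq : F k = centralizerLie σ S hS := Submodule.eq_of_le_of_finrank_le hle hdim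
  have hXF : X ∈ F k := heq ▸ hX
  have h1 := hXF.2
  rwa [𝒟.Ad_mul_apply, 𝒟.Ad_exp_smul_eq_iff.2 (hX.2 W hW)] at h1

end ExpData

/-! ### Additivity of the exponential map on commuting vectors -/

section ProductOfExponentials

variable {n : ℕ} {G : Type*} [TopologicalSpace G] [ChartedSpace (EuclideanSpace ℝ (Fin n)) G]
  [Group G] [IsTopologicalGroup G] [LieGroup (𝓡 n) ∞ G] [T2Space G]

local notation "𝔼" => EuclideanSpace ℝ (Fin n)

lemma hasDerivAt_chartExp_smul (X : 𝔼) :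
    HasDerivAt (fun t : ℝ => chartExp n G (t • X)) X 0 := by
  have hE : HasFDerivAt (chartExp n G) (ContinuousLinearMap.id ℝ 𝔼) ((0 : ℝ) • X) := by
    rw [zero_smul]
    exact hasStrictFDerivAt_chartExp.hasFDerivAt
  have hl : HasDerivAt (fun t : ℝ => t • X) X 0 := by
    have := (hasDerivAt_id (0 : ℝ)).smul_const X
    rwa [one_smul] at this
  exact HasFDerivAt.comp_hasDerivAt (l := chartExp n G) (f := fun t : ℝ => t • X) (0 : ℝ) hE hl

lemma eventually_expMap_mem_source (X : 𝔼) :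
    ∀ᶠ t : ℝ in 𝓝 0, expMap n G (t • X) ∈ (chartOne n G).source := by
  have h2 : Tendsto (fun t : ℝ => t • X) (𝓝 0) (𝓝 0) := by
    have : ContinuousAt (fun t : ℝ => t • X) 0 := by fun_prop
    have := this.tendsto
    rwa [zero_smul] at this
  exact h2.eventually (lieExp_mem_source_eventually (n := n) (G := G))

lemma expMap_add_smul (X : 𝔼) (s t : ℝ) :
    expMap n G ((s + t) • X) = expMap n G (s • X) * expMap n G (t • X) :=
  lieExp_add_smul X s t

lemma exists_expMap_eq_mul {X Y : 𝔼}
    (h : ∀ s t : ℝ, Commute (expMap n G (s • X)) (expMap n G (t • Y))) :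
    ∃ Z : 𝔼, ∀ t : ℝ, expMap n G (t • X) * expMap n G (t • Y) = expMap n G (t • Z) := by
  have hX : ContMDiff 𝓘(ℝ, ℝ) (𝓡 n) ∞ (fun t : ℝ => expMap n G (t • X)) := contMDiff_lieExp_smul X
  have hY : ContMDiff 𝓘(ℝ, ℝ) (𝓡 n) ∞ (fun t : ℝ => expMap n G (t • Y)) := contMDiff_lieExp_smul Y
  have hm : MDifferentiableAt 𝓘(ℝ, ℝ) (𝓡 n)
      (fun t : ℝ => expMap n G (t • X) * expMap n G (t • Y)) 0 :=
    (hX.mul hY).mdifferentiableAt (by simp)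
  refine ⟨_, eq_lieExp_of_hom hm (fun s t => ?_) rfl⟩
  rw [expMap_add_smul, expMap_add_smul]
  exact (h t s).mul_mul_mul_comm _ _

/-- The product of the two one-parameter groups is of the form `exp (t Z)`; the derivative of
multiplication at `(1, 1)` is addition, so `Z = X + Y`. -/
lemma expMap_add {X Y : 𝔼}
    (h : ∀ s t : ℝ, Commute (expMap n G (s • X)) (expMap n G (t • Y))) :
    expMap n G (X + Y) = expMap n G X * expMap n G Y := by
  obtain ⟨Z, hZ⟩ := exists_expMap_eq_mul h
  have hL := ((contDiffAt_localMul_left (origin_mem_target (n := n) (G := G))).differentiableAt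
    (by simp)).hasFDerivAt
  set L := fderiv ℝ (localMul G) (origin n G, origin n G)
  have hL' : HasFDerivAt (localMul G) L
      ((fun t : ℝ => (chartExp n G (t • X), chartExp n G (t • Y))) 0) := by
    simp only [zero_smul, chartExp_zero]
    exact hL
  have h1 := hL'.comp_hasDerivAt (0 : ℝ)
    ((hasDerivAt_chartExp_smul (G := G) X).prodMk (hasDerivAt_chartExp_smul (G := G) Y))
  have h2 : L (X, Y) = X + Y := by
    have e : (X, Y) = (X, (0 : 𝔼)) + ((0 : 𝔼), Y) := by simp
    have e1 : L (X, 0) = X :=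
      congrArg (fun A : 𝔼 →L[ℝ] 𝔼 => A X) (localRightField_origin (n := n) (G := G))
    have e2 : L (0, Y) = Y :=
      congrArg (fun A : 𝔼 →L[ℝ] 𝔼 => A Y) (localField_origin (n := n) (G := G))
    rw [e, map_add, e1, e2]
  rw [h2] at h1
  have h3 : Z = X + Y := by
    refine (hasDerivAt_chartExp_smul (G := G) Z).unique (h1.congr_of_eventuallyEq ?_)
    filter_upwards [eventually_expMap_mem_source (G := G) X,
      eventually_expMap_mem_source (G := G) Y] with t hX hY
    change chartOne n G (expMap n G (t • Z)) = chartOne n G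
      ((chartOne n G).symm (chartOne n G (expMap n G (t • X))) *
        (chartOne n G).symm (chartOne n G (expMap n G (t • Y))))
    rw [(chartOne n G).left_inv hX, (chartOne n G).left_inv hY, hZ]
  have h4 := hZ 1
  rw [one_smul, one_smul, one_smul, h3] at h4
  exact h4.symm

end ProductOfExponentials

/-! ### The exponential data of `G` with the inner product `-B` -/

namespace SymmetricData.InvariantForm

variable {n : ℕ} {G : Type*} [TopologicalSpace G] [ChartedSpace (EuclideanSpace ℝ (Fin n)) G]
  [Group G] [IsTopologicalGroup G] {D : SymmetricData n G}

local notation "𝔼" => EuclideanSpace ℝ (Fin n)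

/-- The real Lie algebra as a Euclidean space, with the inner product `-B`. -/
def Space (_ : D.InvariantForm) : Type := 𝔼

variable (B : D.InvariantForm)

instance : AddCommGroup B.Space := inferInstanceAs (AddCommGroup 𝔼)

instance : Module ℝ B.Space := inferInstanceAs (Module ℝ 𝔼)

instance : FiniteDimensional ℝ B.Space := inferInstanceAs (FiniteDimensional ℝ 𝔼)

lemma neg_form_add (X Y Z : RealLie n G) :
    -B.form (X + Y) Z = -B.form X Z + -B.form Y Z := by
  rw [map_add, LinearMap.add_apply, neg_add]

lemma neg_form_smul (X Y : RealLie n G) (r : ℝ) : -B.form (r • X) Y = r * -B.form X Y := by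
  rw [map_smul, LinearMap.smul_apply, smul_eq_mul, mul_neg]

lemma neg_form_nonneg (X : RealLie n G) : 0 ≤ -B.form X X := by
  by_cases h : X = 0
  · rw [h, map_zero]
    exact neg_zero.ge
  · exact (neg_pos.2 (B.neg X h)).le

/-- The inner product `-B`. -/
@[reducible]
def innerCore : InnerProductSpace.Core ℝ B.Space where
  inner X Y := -B.form X Y
  conj_inner_symm X Y := congrArg (fun t : ℝ => -t) (B.symm Y X)
  re_inner_nonneg X := B.neg_form_nonneg X
  add_left X Y Z := B.neg_form_add X Y Z
  smul_left X Y r := B.neg_form_smul X Y r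
  definite X h := by
    by_contra hX
    exact (B.neg X hX).ne (neg_eq_zero.1 h)

instance : NormedAddCommGroup B.Space := B.innerCore.toNormedAddCommGroup

instance : InnerProductSpace ℝ B.Space := .ofCore B.innerCore.toCore

/-- The identity map from the model space. -/
def toSpace : 𝔼 ≃L[ℝ] B.Space :=
  LinearEquiv.toContinuousLinearEquiv
    { toFun := fun X => X, invFun := fun X => X, map_add' := fun _ _ => rfl,
      map_smul' := fun _ _ => rfl }


lemma hasDerivAt_toSpace {f : ℝ → 𝔼} {f' : 𝔼} {t : ℝ} (h : HasDerivAt f f' t) :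
    HasDerivAt (fun t => B.toSpace (f t)) (B.toSpace f') t :=
  (B.toSpace : 𝔼 →L[ℝ] B.Space).hasFDerivAt.comp_hasDerivAt t h

variable [LieGroup (𝓡 n) ∞ G] [T2Space G]

/-- The exponential map and the adjoint representation of a Lie group with an invariant form. -/
def expData : ExpData G B.Space where
  exp X := expMap n G (B.toSpace.symm X)
  Ad :=
    { toFun := fun g => (B.toSpace : 𝔼 →L[ℝ] B.Space) ∘L adjointMap g ∘L
        (B.toSpace.symm : B.Space →L[ℝ] 𝔼)
      map_one' := by rw [adjointMap_one]; rfl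
      map_mul' := fun g h => by rw [adjointMap_mul]; rfl }
  br := LinearMap.mk₂ ℝ
    (fun X Y => B.toSpace (bracketMap n G (B.toSpace.symm X) (B.toSpace.symm Y)))
    (fun X Y Z => by simp only [map_add, LinearMap.add_apply])
    (fun c X Y => by simp only [map_smul, LinearMap.smul_apply])
    (fun X Y Z => by simp only [map_add])
    (fun c X Y => by simp only [map_smul])
  br_skew X Y := (lie_skew (L := RealLie n G) X Y).symm
  exp_add_smul X s t := by
    rw [map_smul, map_smul, map_smul]
    exact expMap_add_smul _ s t
  continuous_exp := Continuous.comp (g := expMap n G) continuous_lieExp B.toSpace.symm.continuous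
  exists_injOn := by
    obtain ⟨U, hU, hinj⟩ := exists_injOn_lieExp (n := n) (G := G)
    refine ⟨B.toSpace.symm ⁻¹' U, ?_, ?_⟩
    · exact B.toSpace.symm.continuous.continuousAt.preimage_mem_nhds (by rwa [map_zero])
    · intro X hX Y hY h
      exact B.toSpace.symm.injective (hinj hX hY h)
  image_mem_nhds U hU := by
    have h1 : B.toSpace ⁻¹' U ∈ 𝓝 (0 : 𝔼) :=
      B.toSpace.continuous.continuousAt.preimage_mem_nhds (by rwa [map_zero])
    refine mem_of_superset (lieExp_image_mem_nhds (G := G) h1) ?_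
    rintro _ ⟨X, hX, rfl⟩
    exact ⟨B.toSpace X, hX, rfl⟩
  conj_exp g X := map_lieExp (isLieAut_conj (n := n) g) _
  continuous_Ad Y := B.toSpace.continuous.comp (continuous_adjointMap _)
  hasDerivAt_Ad_zero X Y := by
    have := B.hasDerivAt_toSpace
      (hasDerivAt_adjointMap_zero (G := G) (B.toSpace.symm X) (B.toSpace.symm Y))
    exact this
  inner_Ad g X Y := congrArg (fun t : ℝ => -t) (B.invariant g X Y)
  exp_add_of_commute X Y h := by
    rw [map_add]
    refine expMap_add fun s t => ?_
    have := h s t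
    rwa [map_smul, map_smul] at this

/-- The automorphism `σ₁` with its differential. -/
def aut₁ : B.expData.Aut where
  toAut := D.σ₁
  diff := LinearMap.toContinuousLinearMap (differential n D.σ₁ : B.Space →ₗ[ℝ] B.Space)
  continuous_toAut := D.lieAut₁.smooth.continuous
  map_exp _ := map_lieExp D.lieAut₁ _
  inner_diff X Y := congrArg (fun t : ℝ => -t) (B.invariant₁ X Y)

/-- The automorphism `σ₂` with its differential. -/
def aut₂ : B.expData.Aut where
  toAut := D.σ₂
  diff := LinearMap.toContinuousLinearMap (differential n D.σ₂ : B.Space →ₗ[ℝ] B.Space)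
  continuous_toAut := D.lieAut₂.smooth.continuous
  map_exp _ := map_lieExp D.lieAut₂ _
  inner_diff X Y := congrArg (fun t : ℝ => -t) (B.invariant₂ X Y)

end SymmetricData.InvariantForm

/-! ### Finite-order automorphisms with central fixed points -/

/-- A complex Lie algebra with a conjugation whose real form is of compact type. -/
structure CompactForm (V : Type*) [LieRing V] [LieAlgebra ℂ V] where
  /-- the conjugation -/
  conj : V → V
  conj_add : ∀ u v, conj (u + v) = conj u + conj v
  conj_smul : ∀ (c : ℂ) u, conj (c • u) = star c • conj u
  conj_conj : ∀ u, conj (conj u) = u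
  conj_lie : ∀ u v : V, conj ⁅u, v⁆ = ⁅conj u, conj v⁆
  /-- the invariant form -/
  form : LinearMap.BilinForm ℂ V
  form_symm : ∀ u v, form u v = form v u
  form_lie : ∀ u v w : V, form ⁅u, v⁆ w = -form v ⁅u, w⁆
  definite : ∀ u, form u (conj u) = 0 → u = 0

namespace CompactForm

variable {V : Type*} [LieRing V] [LieAlgebra ℂ V] (𝒞 : CompactForm V)

/-- For the Hermitian form `form u (conj v)` the adjoint of `ad x` is `-ad (conj x)`. The first
hypothesis lets the two operators commute on `[x, y]`, and a normal operator with vanishing square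
on a vector kills that vector. -/
lemma lie_eq_zero_of_lie_lie {x y : V} (hc : ⁅⁅x, 𝒞.conj x⁆, ⁅x, y⁆⁆ = 0) (h : ⁅x, ⁅x, y⁆⁆ = 0) : ⁅x, y⁆ = 0 := by
  have h1 : ⁅x, ⁅𝒞.conj x, ⁅x, y⁆⁆⁆ = 0 := by
    have := lie_lie x (𝒞.conj x) ⁅x, y⁆
    rw [hc, h, lie_zero, sub_zero] at this
    exact this.symm
  have h2 : ⁅𝒞.conj x, ⁅x, y⁆⁆ = 0 := by
    refine 𝒞.definite _ ?_
    rw [𝒞.conj_lie, 𝒞.conj_conj, 𝒞.form_symm, 𝒞.form_lie, h1, map_zero, neg_zero]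
  refine 𝒞.definite _ ?_
  rw [𝒞.conj_lie, 𝒞.form_symm, 𝒞.form_lie, h2, map_zero, neg_zero]

variable {𝒞} {l : Submodule ℂ V} {θ : V →ₗ[ℂ] V}

/-- `[u, v]` has eigenvalue `a b`, and `[u, conj u]` is fixed since `|a| = 1`, hence central. So by
`lie_eq_zero_of_lie_lie`, `[u, [u, v]] = 0` implies `[u, v] = 0`: the case of eigenvalue `a b`
yields that of `b`. -/
lemma lie_eq_zero_of_eigen (hlie : ∀ u ∈ l, ∀ v ∈ l, ⁅u, v⁆ ∈ l) (hconj : ∀ u ∈ l, 𝒞.conj u ∈ l)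
    (hθlie : ∀ u v, θ ⁅u, v⁆ = ⁅θ u, θ v⁆) (hθconj : ∀ u, θ (𝒞.conj u) = 𝒞.conj (θ u))
    (hfix : ∀ u ∈ l, θ u = u → ∀ v ∈ l, ⁅u, v⁆ = 0) {a : ℂ} (ha : a * star a = 1) {b : ℂ} (k : ℕ)
    (hk : ∀ u ∈ l, ∀ v ∈ l, θ u = a • u → θ v = (a ^ k * b) • v → ⁅u, v⁆ = 0) :
    ∀ u ∈ l, ∀ v ∈ l, θ u = a • u → θ v = b • v → ⁅u, v⁆ = 0 := by
  induction k with
  | zero => simpa using hk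
  | succ k ih =>
    refine ih fun u hu v hv hθu hθv => ?_
    have hcent : ∀ w ∈ l, ⁅⁅u, 𝒞.conj u⁆, w⁆ = 0 := by
      refine hfix _ (hlie _ hu _ (hconj _ hu)) ?_
      rw [hθlie, hθconj, hθu, 𝒞.conj_smul, smul_lie, lie_smul, smul_smul, ha, one_smul]
    refine 𝒞.lie_eq_zero_of_lie_lie (hcent _ (hlie _ hu _ hv)) ?_
    refine hk u hu _ (hlie _ hu _ hv) hθu ?_
    rw [hθlie, hθu, hθv, smul_lie, lie_smul, smul_smul, pow_succ']
    ring_nf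

/-- Since `(ζ ^ i) ^ m * ζ ^ j = ζ ^ (j - i)`, the preceding lemma replaces the exponents `(i, j)`
by `(i, j - i)`. This ends at exponent `0`, where the vector is fixed and therefore central. -/
lemma lie_eq_zero_of_eigen_pow (hlie : ∀ u ∈ l, ∀ v ∈ l, ⁅u, v⁆ ∈ l)
    (hconj : ∀ u ∈ l, 𝒞.conj u ∈ l)
    (hθlie : ∀ u v, θ ⁅u, v⁆ = ⁅θ u, θ v⁆) (hθconj : ∀ u, θ (𝒞.conj u) = 𝒞.conj (θ u))
    (hfix : ∀ u ∈ l, θ u = u → ∀ v ∈ l, ⁅u, v⁆ = 0) {ζ : ℂ} (hζ : ζ * star ζ = 1) {m : ℕ}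
    (hm : ζ ^ (m + 1) = 1) (N : ℕ) : ∀ i j : ℕ, i + j ≤ N →
    ∀ u ∈ l, ∀ v ∈ l, θ u = ζ ^ i • u → θ v = ζ ^ j • v → ⁅u, v⁆ = 0 := by
  have hpow : ∀ i : ℕ, ζ ^ i * star (ζ ^ i) = 1 := fun i => by
    rw [star_pow, ← mul_pow, hζ, one_pow]
  induction N with
  | zero =>
    intro i j hij u hu v hv hθu _
    have : i = 0 := by omega
    subst this
    exact hfix u hu (by simpa using hθu) v hv
  | succ N ih =>
    -- one step of the Euclidean algorithm
    have step : ∀ i j : ℕ, i ≤ j → i + j ≤ N + 1 →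
        ∀ u ∈ l, ∀ v ∈ l, θ u = ζ ^ i • u → θ v = ζ ^ j • v → ⁅u, v⁆ = 0 := by
      intro i j hij hN
      rcases Nat.eq_zero_or_pos i with rfl | hi
      · intro u hu v hv hθu _
        exact hfix u hu (by simpa using hθu) v hv
      · refine lie_eq_zero_of_eigen hlie hconj hθlie hθconj hfix (hpow i) m ?_
        have e : (ζ ^ i) ^ m * ζ ^ j = ζ ^ (j - i) := by
          obtain ⟨d, rfl⟩ := Nat.exists_eq_add_of_le hij
          have : (ζ ^ i) ^ m * ζ ^ (i + d) = (ζ ^ (m + 1)) ^ i * ζ ^ d := by ring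
          rw [this, hm, one_pow, one_mul, Nat.add_sub_cancel_left]
        rw [e]
        exact ih i (j - i) (by omega)
    intro i j hN
    rcases le_total i j with hij | hij
    · exact step i j hij hN
    · intro u hu v hv hθu hθv
      rw [← lie_skew, step j i hij (by omega) v hv u hu hθv hθu, neg_zero]

/-- A Lie algebra of compact type is abelian if it has an automorphism of finite order with
central fixed points. -/
lemma lie_eq_zero_of_finite_order [FiniteDimensional ℂ V] (hlie : ∀ u ∈ l, ∀ v ∈ l, ⁅u, v⁆ ∈ l)
    (hconj : ∀ u ∈ l, 𝒞.conj u ∈ l) (hθlie : ∀ u v, θ ⁅u, v⁆ = ⁅θ u, θ v⁆)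
    (hθconj : ∀ u, θ (𝒞.conj u) = 𝒞.conj (θ u))
    (hfix : ∀ u ∈ l, θ u = u → ∀ v ∈ l, ⁅u, v⁆ = 0) (hθl : ∀ u ∈ l, θ u ∈ l) {m : ℕ}
    (hm : θ ^ (m + 1) = 1) : ∀ u ∈ l, ∀ v ∈ l, ⁅u, v⁆ = 0 := by
  have hζ := Complex.isPrimitiveRoot_exp (m + 1) (Nat.succ_ne_zero m)
  set ζ := Complex.exp (2 * Real.pi * Complex.I / (m + 1 : ℕ))
  have hζ1 : ζ * star ζ = 1 := by
    have : ‖ζ‖ = 1 := hζ.norm'_eq_one (Nat.succ_ne_zero m)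
    rw [Complex.star_def, Complex.mul_conj, Complex.normSq_eq_norm_sq, this]
    simp
  have key := lie_eq_zero_of_eigen_pow hlie hconj hθlie hθconj hfix hζ1 hζ.pow_eq_one
  let Θ : Module.End ℂ l := θ.restrict hθl
  have hΘ : Θ ^ (m + 1) = 1 := by
    ext u
    rw [Module.End.pow_restrict]
    simp [LinearMap.restrict_apply, hm]
  -- `X ^ (m + 1) - 1` is squarefree and annihilates `Θ`, so `𝔩` is spanned by eigenvectors.
  have hss : Θ.IsSemisimple := by
    refine Module.End.isSemisimple_of_squarefree_aeval_eq_zero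
      (p := Polynomial.X ^ (m + 1) - 1) ?_ (by simp [hΘ])
    exact (Polynomial.separable_X_pow_sub_C (1 : ℂ) (by exact_mod_cast Nat.succ_ne_zero m)
      one_ne_zero).squarefree
  have htop := hss.iSup_eigenspace_eq_top
  have hspan : ∀ p : l → Prop, (∀ a, ∀ u ∈ Θ.eigenspace a, p u) → p 0 →
      (∀ u v, p u → p v → p (u + v)) → ∀ u, p u := by
    intro p h1 h2 h3 u
    have hu : u ∈ ⨆ a, Θ.eigenspace a := htop ▸ Submodule.mem_top
    exact Submodule.iSup_induction _ (motive := p) hu h1 h2 h3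
  have hroot : ∀ a, ∀ u ∈ Θ.eigenspace a, u ≠ 0 → ∃ i : ℕ, ζ ^ i = a := by
    intro a u hu hu0
    have h1 : ∀ k : ℕ, (Θ ^ k) u = a ^ k • u := by
      intro k
      induction k with
      | zero => simp
      | succ k ih =>
        rw [pow_succ', Module.End.mul_apply, ih, map_smul, Module.End.mem_eigenspace_iff.1 hu,
          smul_smul, pow_succ]
    have h2 := h1 (m + 1)
    rw [hΘ, Module.End.one_apply] at h2
    have h3 : (a ^ (m + 1) - 1) • u = 0 := by rw [sub_smul, ← h2, one_smul, sub_self]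
    have h4 := sub_eq_zero.1 ((smul_eq_zero.1 h3).resolve_right hu0)
    obtain ⟨i, -, hi⟩ := hζ.eq_pow_of_pow_eq_one h4
    exact ⟨i, hi⟩
  suffices ∀ u v : l, ⁅(u : V), (v : V)⁆ = 0 from fun u hu v hv => this ⟨u, hu⟩ ⟨v, hv⟩
  refine hspan _ (fun a u hu => ?_) (fun v => ?_) (fun u u' h h' v => ?_)
  · refine hspan _ (fun b v hv => ?_) ?_ (fun v v' h h' => ?_)
    · by_cases hu0 : u = 0
      · simp [hu0]
      by_cases hv0 : v = 0
      · simp [hv0]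
      obtain ⟨i, rfl⟩ := hroot a u hu hu0
      obtain ⟨j, rfl⟩ := hroot b v hv hv0
      refine key (i + j) i j le_rfl u u.2 v v.2 ?_ ?_
      · exact congrArg Subtype.val (Module.End.mem_eigenspace_iff.1 hu)
      · exact congrArg Subtype.val (Module.End.mem_eigenspace_iff.1 hv)
    · simp
    · rw [Submodule.coe_add, lie_add, h, h', add_zero]
  · simp
  · rw [Submodule.coe_add, add_lie, h, h', add_zero]

end CompactForm

/-! ### Orthogonality of the roots vanishing on `𝔰`, and their orbits -/

/-- The Lie algebras `𝔰 ⊆ 𝔩 ⊆ 𝔱` of a pair of commuting automorphisms of a complex Lie algebra,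
where `𝔩` is the centralizer of `𝔰` in the fixed algebra of the involution. -/
structure CompactForm.TorusData {V : Type*} [LieRing V] [LieAlgebra ℂ V] (𝒞 : CompactForm V) where
  /-- the smaller torus -/
  s : Submodule ℂ V
  /-- the centralizer of `s` in the fixed algebra of the involution -/
  l : Submodule ℂ V
  /-- the larger torus -/
  t : Submodule ℂ V
  /-- the involution -/
  inv : V →ₗ[ℂ] V
  /-- the automorphism of finite order -/
  aut : V →ₗ[ℂ] V
  /-- the automorphism of finite order, restricted to `t` -/
  autT : t ≃ₗ[ℂ] t
  coe_autT : ∀ H, (autT H : V) = aut H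
  inv_inv : ∀ u, inv (inv u) = u
  inv_lie : ∀ u v : V, inv ⁅u, v⁆ = ⁅inv u, inv v⁆
  inv_conj : ∀ u, inv (𝒞.conj u) = 𝒞.conj (inv u)
  form_inv : ∀ u v, 𝒞.form (inv u) (inv v) = 𝒞.form u v
  aut_lie : ∀ u v : V, aut ⁅u, v⁆ = ⁅aut u, aut v⁆
  form_aut : ∀ u v, 𝒞.form (aut u) (aut v) = 𝒞.form u v
  l_le : l ≤ t
  s_le : s ≤ t
  conj_s : ∀ u ∈ s, 𝒞.conj u ∈ s
  conj_t : ∀ u ∈ t, 𝒞.conj u ∈ t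
  inv_s : ∀ u ∈ s, inv u = u
  aut_s : ∀ u ∈ s, aut u = u
  mem_l : ∀ u : V, inv u = u → (∀ v ∈ s, ⁅v, u⁆ = 0) → u ∈ l
  lie_l : ∀ u ∈ t, ∀ v ∈ l, ⁅u, v⁆ = 0
  mem_s : ∀ u ∈ l, aut u = u → u ∈ s
  /-- the vector dual to a linear form -/
  dual : Module.Dual ℂ t → t
  form_dual : ∀ α (H : t), 𝒞.form (dual α : V) H = α H

namespace CompactForm.TorusData

variable {V : Type*} [LieRing V] [LieAlgebra ℂ V] {𝒞 : CompactForm V} (𝒯 : 𝒞.TorusData)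

/-- `X` is a weight vector of weight `α`. -/
def IsWeight (α : Module.Dual ℂ 𝒯.t) (X : V) : Prop := ∀ H : 𝒯.t, ⁅(H : V), X⁆ = α H • X

/-- The roots vanishing on `𝔰`. -/
def roots : Set (Module.Dual ℂ 𝒯.t) :=
  {α | (α ≠ 0 ∧ ∃ X : V, X ≠ 0 ∧ 𝒯.IsWeight α X) ∧ ∀ H : 𝒯.t, (H : V) ∈ 𝒯.s → α H = 0}

variable {𝒯} {α β : Module.Dual ℂ 𝒯.t} {X Y : V}

/-- Invariance of the form, applied to `[H, X]` and `conj X`, gives `α H = -star (α (conj H))`: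
weights are imaginary on the real form. -/
lemma IsWeight.conj (hα : 𝒯.IsWeight α X) (hX : X ≠ 0) : 𝒯.IsWeight (-α) (𝒞.conj X) := by
  intro H
  set H' : 𝒯.t := ⟨𝒞.conj H, 𝒯.conj_t _ H.2⟩
  have h1 : ⁅(H : V), 𝒞.conj X⁆ = star (α H') • 𝒞.conj X := by
    rw [← 𝒞.conj_smul, ← hα H', 𝒞.conj_lie, 𝒞.conj_conj]
  have h2 : 𝒞.form ⁅(H : V), X⁆ (𝒞.conj X) = -𝒞.form X ⁅(H : V), 𝒞.conj X⁆ := 𝒞.form_lie _ _ _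
  rw [hα H, h1, map_smul, map_smul, LinearMap.smul_apply, smul_eq_mul, smul_eq_mul, ← neg_mul] at h2
  have h3 : α H = -star (α H') := mul_right_cancel₀ (fun h => hX (𝒞.definite X h)) h2
  rw [h1, LinearMap.neg_apply, h3, neg_neg]

lemma lie_eq_zero_of_isWeight (hα : 𝒯.IsWeight α X) (h0 : ∀ H : 𝒯.t, (H : V) ∈ 𝒯.s → α H = 0)
    {v : V} (hv : v ∈ 𝒯.s) : ⁅v, X⁆ = 0 := by
  have := hα ⟨v, 𝒯.s_le hv⟩
  rwa [h0 _ hv, zero_smul] at this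

/-- `X + inv X` lies in `𝔩`, so `𝔱` kills it, while `𝔱` acts on `conj X` by a nonzero weight; by
invariance the two are orthogonal. Then `X + inv X` is orthogonal to its own conjugate, hence zero.
-/
lemma inv_eq_neg (hα : 𝒯.IsWeight α X) (hα0 : α ≠ 0)
    (h0 : ∀ H : 𝒯.t, (H : V) ∈ 𝒯.s → α H = 0) : 𝒯.inv X = -X := by
  have hU : X + 𝒯.inv X ∈ 𝒯.l := by
    refine 𝒯.mem_l _ (by rw [map_add, 𝒯.inv_inv, add_comm]) fun v hv => ?_
    have h1 := lie_eq_zero_of_isWeight hα h0 hv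
    have h2 := 𝒯.inv_lie v X
    rw [𝒯.inv_s v hv, h1, map_zero] at h2
    rw [lie_add, h1, ← h2, add_zero]
  obtain ⟨H, hH⟩ : ∃ H, α H ≠ 0 := by
    by_contra! h
    exact hα0 (LinearMap.ext h)
  have h1 : 𝒞.form (X + 𝒯.inv X) (𝒞.conj X) = 0 := by
    have h2 := 𝒞.form_lie (𝒞.conj H) (X + 𝒯.inv X) (𝒞.conj X)
    rw [𝒯.lie_l _ (𝒯.conj_t _ H.2) _ hU, map_zero, LinearMap.zero_apply, ← 𝒞.conj_lie, hα H,
      𝒞.conj_smul, map_smul, smul_eq_mul, eq_comm, neg_eq_zero] at h2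
    exact (mul_eq_zero.1 h2).resolve_left (star_ne_zero.2 hH)
  have h2 : 𝒞.form (X + 𝒯.inv X) (𝒞.conj (X + 𝒯.inv X)) = 0 := by
    rw [𝒞.conj_add, map_add, h1, ← 𝒯.inv_conj, ← 𝒯.form_inv, 𝒯.inv_inv, map_add, 𝒯.inv_inv,
      add_comm (𝒯.inv X), h1, add_zero]
  rw [eq_neg_iff_add_eq_zero, add_comm]
  exact 𝒞.definite _ h2

lemma lie_mem_l (hα : 𝒯.IsWeight α X) (hα0 : α ≠ 0)
    (h0 : ∀ H : 𝒯.t, (H : V) ∈ 𝒯.s → α H = 0) (hβ : 𝒯.IsWeight β Y) (hβ0 : β ≠ 0)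
    (h0' : ∀ H : 𝒯.t, (H : V) ∈ 𝒯.s → β H = 0) : ⁅X, Y⁆ ∈ 𝒯.l := by
  refine 𝒯.mem_l _ ?_ fun v hv => ?_
  · rw [𝒯.inv_lie, inv_eq_neg hα hα0 h0, inv_eq_neg hβ hβ0 h0', neg_lie, lie_neg, neg_neg]
  · rw [leibniz_lie, lie_eq_zero_of_isWeight hα h0 hv, lie_eq_zero_of_isWeight hβ h0' hv, zero_lie,
      lie_zero, add_zero]

/-- The bracket has weight `α + β`, but it lies in `𝔩`, on which `𝔱` acts by zero. -/
lemma lie_eq_zero (hα : 𝒯.IsWeight α X) (hα0 : α ≠ 0)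
    (h0 : ∀ H : 𝒯.t, (H : V) ∈ 𝒯.s → α H = 0) (hβ : 𝒯.IsWeight β Y) (hβ0 : β ≠ 0)
    (h0' : ∀ H : 𝒯.t, (H : V) ∈ 𝒯.s → β H = 0) (hne : α ≠ -β) : ⁅X, Y⁆ = 0 := by
  obtain ⟨H, hH⟩ : ∃ H, α H + β H ≠ 0 := by
    by_contra! h
    exact hne (LinearMap.ext fun H => eq_neg_of_add_eq_zero_left (h H))
  have h1 := 𝒯.lie_l H H.2 _ (lie_mem_l hα hα0 h0 hβ hβ0 h0')
  rw [leibniz_lie, hα H, hβ H, smul_lie, lie_smul, ← add_smul] at h1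
  exact (smul_eq_zero.1 h1).resolve_left hH

variable (𝒯) in
lemma eq_of_form_eq {H H' : 𝒯.t} (h : ∀ K : 𝒯.t, 𝒞.form (H : V) K = 𝒞.form (H' : V) K) :
    H = H' := by
  have h1 : (H : V) - H' = 0 := by
    refine 𝒞.definite _ ?_
    have := h ⟨𝒞.conj (H - H' : 𝒯.t), 𝒯.conj_t _ (H - H').2⟩
    rw [map_sub, LinearMap.sub_apply, sub_eq_zero]
    exact this
  exact Subtype.ext (sub_eq_zero.1 h1)

lemma neg_vanish (h0 : ∀ H : 𝒯.t, (H : V) ∈ 𝒯.s → α H = 0) :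
    ∀ H : 𝒯.t, (H : V) ∈ 𝒯.s → (-α) H = 0 := fun H hH => by
  rw [LinearMap.neg_apply, h0 H hH, neg_zero]

/-- Both sides lie in `𝔱` and pair equally with `𝔱`, on which the form is nondegenerate. -/
lemma lie_conj_eq (hα : 𝒯.IsWeight α X) (hX : X ≠ 0) (hα0 : α ≠ 0)
    (h0 : ∀ H : 𝒯.t, (H : V) ∈ 𝒯.s → α H = 0) :
    ⁅X, 𝒞.conj X⁆ = 𝒞.form X (𝒞.conj X) • (𝒯.dual α : V) := by
  have hl := lie_mem_l hα hα0 h0 (hα.conj hX) (neg_ne_zero.2 hα0) (neg_vanish h0)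
  refine congrArg Subtype.val (𝒯.eq_of_form_eq (H := ⟨_, 𝒯.l_le hl⟩)
    (H' := 𝒞.form X (𝒞.conj X) • 𝒯.dual α) fun K => ?_)
  rw [Submodule.coe_smul, map_smul, LinearMap.smul_apply, 𝒯.form_dual, 𝒞.form_lie, ← lie_skew, hα K,
    map_neg, neg_neg, map_smul, 𝒞.form_symm, smul_eq_mul, smul_eq_mul, mul_comm]

lemma dual_mem_l (hα : α ∈ 𝒯.roots) : (𝒯.dual α : V) ∈ 𝒯.l := by
  obtain ⟨⟨hα0, X, hX, hα⟩, h0⟩ := hα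
  have hl := lie_mem_l hα hα0 h0 (hα.conj hX) (neg_ne_zero.2 hα0) (neg_vanish h0)
  rw [lie_conj_eq hα hX hα0 h0] at hl
  exact (𝒯.l.smul_mem_iff fun h => hX (𝒞.definite X h)).1 hl

/-- A root vector `Y` for `β` and its conjugate both commute with `X`, hence so does their bracket,
a nonzero multiple of the dual vector of `β`. -/
lemma apply_dual_eq_zero (hα : α ∈ 𝒯.roots) (hβ : β ∈ 𝒯.roots) (h1 : α ≠ β) (h2 : α ≠ -β) :
    α (𝒯.dual β) = 0 := by
  obtain ⟨⟨hα0, X, hX, hα⟩, hα1⟩ := hα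
  obtain ⟨⟨hβ0, Y, hY, hβ⟩, hβ1⟩ := hβ
  have e1 : ⁅𝒞.conj Y, X⁆ = 0 := lie_eq_zero (hβ.conj hY) (neg_ne_zero.2 hβ0) (neg_vanish hβ1) hα
    hα0 hα1 fun h => h1 (neg_injective h).symm
  have e2 : ⁅Y, X⁆ = 0 := lie_eq_zero hβ hβ0 hβ1 hα hα0 hα1 fun h => h2 (by rw [h, neg_neg])
  have e3 := lie_lie Y (𝒞.conj Y) X
  rw [e1, e2, lie_zero, lie_zero, sub_zero, lie_conj_eq hβ hY hβ0 hβ1, smul_lie, hα, smul_smul] at e3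
  have e4 := (smul_eq_zero.1 e3).resolve_right hX
  exact (mul_eq_zero.1 e4).resolve_left fun h => hY (𝒞.definite Y h)

/-- Otherwise `[X, conj X]`, which conjugation negates, would be isotropic, hence zero; then the
dual vector of `α` would vanish. -/
lemma apply_dual_self_ne_zero (hα : α ∈ 𝒯.roots) : α (𝒯.dual α) ≠ 0 := by
  obtain ⟨⟨hα0, X, hX, hα⟩, h0⟩ := hα
  intro h
  have h1 := lie_conj_eq hα hX hα0 h0
  have h2 : ⁅X, 𝒞.conj X⁆ = 0 := by
    refine 𝒞.definite _ ?_
    have h3 : 𝒞.conj ⁅X, 𝒞.conj X⁆ = -⁅X, 𝒞.conj X⁆ := by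
      rw [𝒞.conj_lie, 𝒞.conj_conj, lie_skew]
    rw [h3, map_neg, h1, map_smul, map_smul, LinearMap.smul_apply, 𝒯.form_dual, h, smul_zero,
      smul_zero, neg_zero]
  rw [h1] at h2
  have h3 := (smul_eq_zero.1 h2).resolve_left fun h => hX (𝒞.definite X h)
  refine hα0 (LinearMap.ext fun H => ?_)
  rw [← 𝒯.form_dual, h3, map_zero, LinearMap.zero_apply, LinearMap.zero_apply]

/-- No nonzero vector of the span of the dual vectors of the roots is fixed. -/
lemma eq_zero_of_fixed {v : 𝒯.t} (hv : v ∈ Submodule.span ℂ (𝒯.dual '' 𝒯.roots))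
    (hfix : 𝒯.autT v = v) : v = 0 := by
  have h1 : (v : V) ∈ 𝒯.l ∧ ∀ u : 𝒯.t, (u : V) ∈ 𝒯.s → 𝒞.form (v : V) u = 0 := by
    clear hfix
    induction hv using Submodule.span_induction with
    | mem x hx =>
      obtain ⟨α, hα, rfl⟩ := hx
      exact ⟨dual_mem_l hα, fun u hu => by rw [𝒯.form_dual, hα.2 u hu]⟩
    | zero => exact ⟨𝒯.l.zero_mem, fun u _ => by simp⟩
    | add x y _ _ hx hy =>
      refine ⟨𝒯.l.add_mem hx.1 hy.1, fun u hu => ?_⟩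
      rw [Submodule.coe_add, map_add, LinearMap.add_apply, hx.2 u hu, hy.2 u hu, add_zero]
    | smul c x _ hx =>
      refine ⟨𝒯.l.smul_mem c hx.1, fun u hu => ?_⟩
      rw [Submodule.coe_smul, map_smul, LinearMap.smul_apply, hx.2 u hu, smul_zero]
  -- Now `v` lies in `𝔰` and is orthogonal to `𝔰`, which is stable under conjugation.
  have h2 : (v : V) ∈ 𝒯.s := 𝒯.mem_s _ h1.1 (by rw [← 𝒯.coe_autT, hfix])
  have h3 := 𝒯.conj_s _ h2
  exact Subtype.ext (𝒞.definite _ (h1.2 ⟨_, 𝒯.s_le h3⟩ h3))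

variable (𝒯) in
/-- The action of the automorphism on linear forms. -/
def act (α : Module.Dual ℂ 𝒯.t) : Module.Dual ℂ 𝒯.t := α ∘ₗ 𝒯.autT.symm.toLinearMap

lemma act_mem_roots (hα : α ∈ 𝒯.roots) : 𝒯.act α ∈ 𝒯.roots := by
  obtain ⟨⟨hα0, X, hX, hα⟩, h0⟩ := hα
  have hsymm : ∀ H : 𝒯.t, 𝒯.aut (𝒯.autT.symm H) = H := fun H => by
    rw [← 𝒯.coe_autT, LinearEquiv.apply_symm_apply]
  refine ⟨⟨fun h => hα0 (LinearMap.ext fun H => ?_), 𝒯.aut X, fun h => hX ?_, fun H => ?_⟩,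
    fun H hH => h0 _ ?_⟩
  · have := congrArg (fun β : Module.Dual ℂ 𝒯.t => β (𝒯.autT H)) h
    simpa [act] using this
  · refine 𝒞.definite X ?_
    rw [← 𝒯.form_aut, h, map_zero, LinearMap.zero_apply]
  · have := 𝒯.aut_lie (𝒯.autT.symm H) X
    rw [hα, hsymm, map_smul] at this
    exact this.symm
  · have h1 : 𝒯.autT.symm H = H := by
      rw [LinearEquiv.symm_apply_eq]
      exact Subtype.ext (by rw [𝒯.coe_autT, 𝒯.aut_s _ hH])
    change ((𝒯.autT.symm H : 𝒯.t) : V) ∈ 𝒯.s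
    rwa [h1]

lemma dual_act : 𝒯.dual (𝒯.act α) = 𝒯.autT (𝒯.dual α) := by
  refine 𝒯.eq_of_form_eq fun K => ?_
  rw [𝒯.form_dual, 𝒯.coe_autT]
  have : (K : V) = 𝒯.aut (𝒯.autT.symm K) := by
    rw [← 𝒯.coe_autT, LinearEquiv.apply_symm_apply]
  rw [this, 𝒯.form_aut, 𝒯.form_dual]
  rfl

lemma act_injective : Function.Injective 𝒯.act := by
  intro α β h
  ext H
  have := congrArg (fun γ : Module.Dual ℂ 𝒯.t => γ (𝒯.autT H)) h
  simpa [act] using this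

lemma iterate_act_neg (k : ℕ) : 𝒯.act^[k] (-α) = -𝒯.act^[k] α := by
  induction k with
  | zero => rfl
  | succ k ih =>
    rw [Function.iterate_succ_apply', Function.iterate_succ_apply', ih]
    rfl

lemma iterate_act_mem_roots (hα : α ∈ 𝒯.roots) (k : ℕ) : 𝒯.act^[k] α ∈ 𝒯.roots := by
  induction k with
  | zero => exact hα
  | succ k ih =>
    rw [Function.iterate_succ_apply']
    exact act_mem_roots ih

/-- The orbit of a root vanishing on `𝔰` under an automorphism of finite order. -/
theorem exists_length (hα : α ∈ 𝒯.roots) {N : ℕ} (hN : 0 < N) (hper : 𝒯.act^[N] α = α) :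
    ∃ ℓ : ℕ, 1 ≤ ℓ ∧
      IsGreatest {m : ℕ | LinearIndependent ℝ (fun i : Fin m => 𝒯.act^[(i : ℕ)] α)} ℓ ∧
      LinearIndependent ℂ (fun i : Fin ℓ => 𝒯.act^[(i : ℕ)] α) ∧ 𝒯.act^[ℓ] α = -α := by
  classical
  have hex : ∃ k, 0 < k ∧ (𝒯.act^[k] α = α ∨ 𝒯.act^[k] α = -α) := ⟨N, hN, Or.inl hper⟩
  -- The sought length is the first return of the orbit to `α` up to sign.
  set k := Nat.find hex with hk
  obtain ⟨hk0, hkα⟩ := Nat.find_spec hex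
  rw [← hk] at hk0 hkα
  have hmin : ∀ j, 0 < j → j < k → 𝒯.act^[j] α ≠ α ∧ 𝒯.act^[j] α ≠ -α := by
    intro j hj hjk
    have := Nat.find_min hex hjk
    exact ⟨fun h => this ⟨hj, Or.inl h⟩, fun h => this ⟨hj, Or.inr h⟩⟩
  have hlt : ∀ i j, i < j → j < k →
      𝒯.act^[j] α ≠ 𝒯.act^[i] α ∧ 𝒯.act^[j] α ≠ -𝒯.act^[i] α := by
    intro i j hij hjk
    obtain ⟨d, rfl⟩ := Nat.exists_eq_add_of_lt hij
    have h1 := hmin (d + 1) (by omega) (by omega)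
    rw [add_assoc, Function.iterate_add_apply]
    refine ⟨fun h => h1.1 (act_injective.iterate i h), fun h => h1.2 (act_injective.iterate i ?_)⟩
    rw [h, iterate_act_neg]
  have horth : ∀ i j, i < k → j < k → i ≠ j → (𝒯.act^[i] α) (𝒯.dual (𝒯.act^[j] α)) = 0 := by
    intro i j hi hj hij
    rcases lt_or_gt_of_ne hij with h | h
    · refine apply_dual_eq_zero (iterate_act_mem_roots hα i) (iterate_act_mem_roots hα j)
        (hlt i j h hj).1.symm fun h' => (hlt i j h hj).2 ?_
      rw [h', neg_neg]
    · exact apply_dual_eq_zero (iterate_act_mem_roots hα i) (iterate_act_mem_roots hα j)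
        (hlt j i h hi).1 (hlt j i h hi).2
  have hneg : 𝒯.act^[k] α = -α := by
    refine hkα.resolve_left fun h => ?_
    -- If the orbit returned to `α` itself, this sum would be permuted cyclically, hence fixed and
    -- zero; but by orthogonality `α v = α (𝒯.dual α) ≠ 0`.
    set v : 𝒯.t := ∑ i ∈ Finset.range k, 𝒯.dual (𝒯.act^[i] α) with hv
    have hv0 : v = 0 := by
      refine eq_zero_of_fixed (Submodule.sum_mem _ fun i _ => Submodule.subset_span
        ⟨_, iterate_act_mem_roots hα i, rfl⟩) ?_
      have h1 : 𝒯.autT v = ∑ i ∈ Finset.range k, 𝒯.dual (𝒯.act^[i + 1] α) := by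
        rw [hv, map_sum]
        refine Finset.sum_congr rfl fun i _ => ?_
        rw [Function.iterate_succ_apply', dual_act]
      have h2 := Finset.sum_range_succ' (fun i => 𝒯.dual (𝒯.act^[i] α)) k
      rw [Finset.sum_range_succ, h, Function.iterate_zero_apply] at h2
      rw [h1]
      exact (add_right_cancel h2).symm
    have h1 : α v = α (𝒯.dual α) := by
      rw [hv, map_sum, Finset.sum_eq_single 0]
      · rfl
      · intro i hi hi0
        exact horth 0 i hk0 (Finset.mem_range.1 hi) (Ne.symm hi0)
      · intro h0
        exact absurd (Finset.mem_range.2 hk0) h0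
    rw [hv0, map_zero] at h1
    exact apply_dual_self_ne_zero hα h1.symm
  have hLI : LinearIndependent ℂ (fun i : Fin k => 𝒯.act^[(i : ℕ)] α) := by
    rw [Fintype.linearIndependent_iff]
    intro c hc j
    have h1 := congrArg (fun β : Module.Dual ℂ 𝒯.t => β (𝒯.dual (𝒯.act^[(j : ℕ)] α))) hc
    simp only [LinearMap.sum_apply, LinearMap.smul_apply, LinearMap.zero_apply] at h1
    rw [Finset.sum_eq_single j] at h1
    · exact (smul_eq_zero.1 h1).resolve_right
        (apply_dual_self_ne_zero (iterate_act_mem_roots hα j))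
    · intro i _ hij
      rw [horth i j i.2 j.2 (fun h => hij (Fin.ext h)), smul_zero]
    · exact fun h => absurd (Finset.mem_univ j) h
  refine ⟨k, hk0, ⟨?_, fun m hm => ?_⟩, hLI, hneg⟩
  · exact hLI.restrict_scalars (R := ℝ) (smul_left_injective ℝ one_ne_zero)
  · by_contra! hlt
    have hm := Fintype.linearIndependent_iff.1 hm
    have h0m : 0 < m := by omega
    -- A longer family contains both `α` and `act^[k] α = -α`, whose sum is zero.
    have h1 := hm (fun i => if (i : ℕ) = 0 ∨ (i : ℕ) = k then 1 else 0) ?_ ⟨0, h0m⟩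
    · simp at h1
    · have hne : (⟨0, h0m⟩ : Fin m) ≠ ⟨k, hlt⟩ := fun h => hk0.ne (Fin.mk.inj_iff.1 h)
      rw [Finset.sum_eq_add (⟨0, h0m⟩ : Fin m) ⟨k, hlt⟩ hne]
      · simp [hneg]
      · intro i _ hi
        rw [if_neg, zero_smul]
        rintro (h | h)
        · exact hi.1 (Fin.ext h)
        · exact hi.2 (Fin.ext h)
      · simp
      · simp

end CompactForm.TorusData

/-! ### Passage from a real Lie algebra to its complexification -/

namespace Complexification

variable {L : Type*} [LieRing L] [LieAlgebra ℝ L]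

/-- The real part. -/
def re : ℂ ⊗[ℝ] L →ₗ[ℝ] L := (TensorProduct.lid ℝ L).toLinearMap ∘ₗ LinearMap.rTensor L Complex.reLm

/-- The imaginary part. -/
def im : ℂ ⊗[ℝ] L →ₗ[ℝ] L := (TensorProduct.lid ℝ L).toLinearMap ∘ₗ LinearMap.rTensor L Complex.imLm

@[simp] lemma re_tmul (c : ℂ) (X : L) : re (c ⊗ₜ[ℝ] X) = c.re • X := rfl

@[simp] lemma im_tmul (c : ℂ) (X : L) : im (c ⊗ₜ[ℝ] X) = c.im • X := rfl

lemma re_add_im (z : ℂ ⊗[ℝ] L) : (1 : ℂ) ⊗ₜ[ℝ] re z + Complex.I ⊗ₜ[ℝ] im z = z := by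
  induction z using TensorProduct.induction_on with
  | zero => simp
  | tmul c X =>
    rw [re_tmul, im_tmul, ← TensorProduct.smul_tmul, ← TensorProduct.smul_tmul,
      ← TensorProduct.add_tmul]
    congr 1
    apply Complex.ext <;> simp
  | add z w hz hw =>
    nth_rewrite 3 [← hz]
    nth_rewrite 3 [← hw]
    rw [map_add, map_add, TensorProduct.tmul_add, TensorProduct.tmul_add]
    abel

lemma ext_re_im {z w : ℂ ⊗[ℝ] L} (h1 : re z = re w) (h2 : im z = im w) : z = w := by
  rw [← re_add_im z, ← re_add_im w, h1, h2]

lemma re_baseChange (f : L →ₗ[ℝ] L) (z : ℂ ⊗[ℝ] L) : re (f.baseChange ℂ z) = f (re z) := by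
  induction z using TensorProduct.induction_on with
  | zero => simp
  | tmul c X => simp
  | add z w hz hw => simp only [map_add, hz, hw]

lemma im_baseChange (f : L →ₗ[ℝ] L) (z : ℂ ⊗[ℝ] L) : im (f.baseChange ℂ z) = f (im z) := by
  induction z using TensorProduct.induction_on with
  | zero => simp
  | tmul c X => simp
  | add z w hz hw => simp only [map_add, hz, hw]

@[simp] lemma lie_zero' (z : ℂ ⊗[ℝ] L) : ⁅z, (0 : ℂ ⊗[ℝ] L)⁆ = 0 := lie_zero z

@[simp] lemma zero_lie' (z : ℂ ⊗[ℝ] L) : ⁅(0 : ℂ ⊗[ℝ] L), z⁆ = 0 := zero_lie z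

lemma lie_add' (z w v : ℂ ⊗[ℝ] L) : ⁅z, w + v⁆ = ⁅z, w⁆ + ⁅z, v⁆ := lie_add z w v

lemma add_lie' (z w v : ℂ ⊗[ℝ] L) : ⁅z + w, v⁆ = ⁅z, v⁆ + ⁅w, v⁆ := add_lie z w v

lemma re_lie (X : L) (z : ℂ ⊗[ℝ] L) : re ⁅(1 : ℂ) ⊗ₜ[ℝ] X, z⁆ = ⁅X, re z⁆ := by
  induction z using TensorProduct.induction_on with
  | zero => simp
  | tmul c Y => simp
  | add z w hz hw => simp only [lie_add', lie_add, map_add, hz, hw]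

lemma im_lie (X : L) (z : ℂ ⊗[ℝ] L) : im ⁅(1 : ℂ) ⊗ₜ[ℝ] X, z⁆ = ⁅X, im z⁆ := by
  induction z using TensorProduct.induction_on with
  | zero => simp
  | tmul c Y => simp
  | add z w hz hw => simp only [lie_add', lie_add, map_add, hz, hw]

lemma mem_baseChange_iff {W : Submodule ℝ L} {z : ℂ ⊗[ℝ] L} :
    z ∈ W.baseChange ℂ ↔ re z ∈ W ∧ im z ∈ W := by
  constructor
  · intro hz
    obtain ⟨X, hX, Y, hY, rfl⟩ := SymmetricData.InvariantForm.exists_re_im W hz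
    simp [hX, hY]
  · rintro ⟨h1, h2⟩
    rw [← re_add_im z]
    exact add_mem (Submodule.tmul_mem_baseChange_of_mem _ h1)
      (Submodule.tmul_mem_baseChange_of_mem _ h2)

/-- The complex conjugation. -/
def conj : ℂ ⊗[ℝ] L →ₗ[ℝ] ℂ ⊗[ℝ] L := LinearMap.rTensor L Complex.conjAe.toLinearMap

@[simp] lemma conj_tmul (c : ℂ) (X : L) : conj (c ⊗ₜ[ℝ] X) = star c ⊗ₜ[ℝ] X := rfl

lemma conj_smul (c : ℂ) (z : ℂ ⊗[ℝ] L) : conj (c • z) = star c • conj z := by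
  induction z using TensorProduct.induction_on with
  | zero => simp
  | tmul d X => simp [TensorProduct.smul_tmul']
  | add z w hz hw => simp only [smul_add, map_add, hz, hw]

lemma conj_conj (z : ℂ ⊗[ℝ] L) : conj (conj z) = z := by
  induction z using TensorProduct.induction_on with
  | zero => simp
  | tmul d X => simp
  | add z w hz hw => simp only [map_add, hz, hw]

lemma conj_lie (z w : ℂ ⊗[ℝ] L) : conj ⁅z, w⁆ = ⁅conj z, conj w⁆ := by
  induction z using TensorProduct.induction_on with
  | zero => simp
  | tmul c X =>
    induction w using TensorProduct.induction_on with
    | zero => simp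
    | tmul d Y => simp
    | add z w hz hw => simp only [lie_add', map_add, hz, hw]
  | add z z' hz hz' => simp only [add_lie', map_add, hz, hz']

lemma re_conj (z : ℂ ⊗[ℝ] L) : re (conj z) = re z := by
  induction z using TensorProduct.induction_on with
  | zero => simp
  | tmul d X => simp
  | add z w hz hw => simp only [map_add, hz, hw]

lemma im_conj (z : ℂ ⊗[ℝ] L) : im (conj z) = -im z := by
  induction z using TensorProduct.induction_on with
  | zero => simp
  | tmul d X => simp
  | add z w hz hw => simp only [map_add, hz, hw, neg_add]

lemma conj_mem_baseChange {W : Submodule ℝ L} {z : ℂ ⊗[ℝ] L} (hz : z ∈ W.baseChange ℂ) :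
    conj z ∈ W.baseChange ℂ := by
  rw [mem_baseChange_iff] at hz ⊢
  rw [re_conj, im_conj]
  exact ⟨hz.1, neg_mem hz.2⟩

lemma baseChange_conj (f : L →ₗ[ℝ] L) (z : ℂ ⊗[ℝ] L) :
    f.baseChange ℂ (conj z) = conj (f.baseChange ℂ z) := by
  apply ext_re_im
  · rw [re_baseChange, re_conj, re_conj, re_baseChange]
  · rw [im_baseChange, im_conj, im_conj, im_baseChange, map_neg]

lemma baseChange_lie {f : L →ₗ[ℝ] L} (hf : ∀ X Y, f ⁅X, Y⁆ = ⁅f X, f Y⁆) (z w : ℂ ⊗[ℝ] L) :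
    f.baseChange ℂ ⁅z, w⁆ = ⁅f.baseChange ℂ z, f.baseChange ℂ w⁆ := by
  induction z using TensorProduct.induction_on with
  | zero => simp
  | tmul c X =>
    induction w using TensorProduct.induction_on with
    | zero => simp
    | tmul d Y => simp [hf]
    | add z w hz hw => simp only [lie_add', map_add, hz, hw]
  | add z z' hz hz' => simp only [add_lie', map_add, hz, hz']

lemma lie_eq_zero_of_real {W W' : Submodule ℝ L} (h : ∀ X ∈ W, ∀ Y ∈ W', ⁅X, Y⁆ = 0)
    {z w : ℂ ⊗[ℝ] L} (hz : z ∈ W.baseChange ℂ) (hw : w ∈ W'.baseChange ℂ) : ⁅z, w⁆ = 0 := by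
  rw [mem_baseChange_iff] at hz hw
  rw [← re_add_im z, ← re_add_im w]
  simp only [add_lie', lie_add', LieAlgebra.ExtendScalars.bracket_tmul, TensorProduct.tmul_zero,
    add_zero, h _ hz.1 _ hw.1, h _ hz.1 _ hw.2, h _ hz.2 _ hw.1, h _ hz.2 _ hw.2]

lemma form_baseChange {B : LinearMap.BilinForm ℝ L} {f : L →ₗ[ℝ] L}
    (hf : ∀ X Y, B (f X) (f Y) = B X Y) (z w : ℂ ⊗[ℝ] L) :
    B.baseChange ℂ (f.baseChange ℂ z) (f.baseChange ℂ w) = B.baseChange ℂ z w := by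
  induction z using TensorProduct.induction_on with
  | zero => simp
  | tmul c X =>
    induction w using TensorProduct.induction_on with
    | zero => simp
    | tmul d Y => simp [hf]
    | add z w hz hw => simp only [map_add, hz, hw]
  | add z z' hz hz' => simp only [map_add, LinearMap.add_apply, hz, hz']

lemma form_lie {B : LinearMap.BilinForm ℝ L} (hB : ∀ X Y Z : L, B ⁅X, Y⁆ Z = -B Y ⁅X, Z⁆)
    (z w v : ℂ ⊗[ℝ] L) : B.baseChange ℂ ⁅z, w⁆ v = -B.baseChange ℂ w ⁅z, v⁆ := by
  induction z using TensorProduct.induction_on with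
  | zero => simp
  | tmul c X =>
    induction w using TensorProduct.induction_on with
    | zero => simp
    | tmul d Y =>
      induction v using TensorProduct.induction_on with
      | zero => simp
      | tmul e Z =>
        simp only [LieAlgebra.ExtendScalars.bracket_tmul, LinearMap.BilinForm.baseChange_tmul, hB,
          neg_smul, neg_inj]
        congr 1
        ring
      | add z w hz hw => simp only [lie_add', map_add, hz, hw, neg_add]
    | add z w hz hw => simp only [lie_add', map_add, LinearMap.add_apply, hz, hw, neg_add]
  | add z z' hz hz' => simp only [add_lie', map_add, LinearMap.add_apply, hz, hz', neg_add]

/-- The mixed terms cancel by symmetry; this carries definiteness over to the complexification. -/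
lemma form_conj_self (B : LinearMap.BilinForm ℝ L) (hB : ∀ X Y, B X Y = B Y X) (z : ℂ ⊗[ℝ] L) :
    B.baseChange ℂ z (conj z) = ((B (re z) (re z) + B (im z) (im z) : ℝ) : ℂ) := by
  have h : conj z = (1 : ℂ) ⊗ₜ[ℝ] re z + (-Complex.I) ⊗ₜ[ℝ] im z := by
    nth_rewrite 1 [← re_add_im z]
    simp
  rw [h]
  nth_rewrite 1 [← re_add_im z]
  simp only [map_add, LinearMap.add_apply, LinearMap.BilinForm.baseChange_tmul, hB (im z) (re z)]
  simp only [Complex.real_smul, Complex.ofReal_add]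
  linear_combination (-(B (im z) (im z)) : ℂ) * Complex.I_sq

/-- The complexification of a real Lie algebra with a negative definite invariant form. -/
def compactForm (B : LinearMap.BilinForm ℝ L) (hB : ∀ X Y, B X Y = B Y X)
    (hneg : ∀ X, X ≠ 0 → B X X < 0) (hinv : ∀ X Y Z : L, B ⁅X, Y⁆ Z = -B Y ⁅X, Z⁆) :
    CompactForm (ℂ ⊗[ℝ] L) where
  conj := conj
  conj_add := map_add conj
  conj_smul := conj_smul
  conj_conj := conj_conj
  conj_lie := conj_lie
  form := B.baseChange ℂ
  form_symm := (LinearMap.BilinForm.IsSymm.baseChange ℂ ⟨hB⟩).eq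
  form_lie := form_lie hinv
  definite z hz := by
    rw [form_conj_self B hB, Complex.ofReal_eq_zero] at hz
    have hle : ∀ X, B X X ≤ 0 := fun X => by
      by_cases h : X = 0
      · simp [h]
      · exact (hneg X h).le
    have hzero : ∀ X, 0 ≤ B X X → X = 0 := fun X hX => by
      by_contra h
      exact (hneg X h).not_ge hX
    refine ext_re_im ?_ ?_
    · rw [map_zero]
      exact hzero _ (by linarith [hle (im z)])
    · rw [map_zero]
      exact hzero _ (by linarith [hle (re z)])

/-- A real Lie algebra of compact type is abelian if it has an automorphism of finite order with
central fixed points. -/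
lemma lie_eq_zero_of_finite_order [FiniteDimensional ℝ L] {B : LinearMap.BilinForm ℝ L}
    (hB : ∀ X Y, B X Y = B Y X)
    (hneg : ∀ X, X ≠ 0 → B X X < 0) (hinv : ∀ X Y Z : L, B ⁅X, Y⁆ Z = -B Y ⁅X, Z⁆)
    {W : Submodule ℝ L} {θ : L →ₗ[ℝ] L} (hlie : ∀ X ∈ W, ∀ Y ∈ W, ⁅X, Y⁆ ∈ W)
    (hθlie : ∀ X Y, θ ⁅X, Y⁆ = ⁅θ X, θ Y⁆) (hfix : ∀ X ∈ W, θ X = X → ∀ Y ∈ W, ⁅X, Y⁆ = 0)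
    (hθW : ∀ X ∈ W, θ X ∈ W) {m : ℕ} (hm : θ ^ (m + 1) = 1) :
    ∀ X ∈ W, ∀ Y ∈ W, ⁅X, Y⁆ = 0 := by
  have h := CompactForm.lie_eq_zero_of_finite_order (𝒞 := compactForm B hB hneg hinv)
    (l := W.baseChange ℂ) (θ := θ.baseChange ℂ) ?_ (fun u hu => conj_mem_baseChange hu)
    (baseChange_lie hθlie) (baseChange_conj θ) ?_ ?_ (m := m) ?_
  · intro X hX Y hY
    have h1 := h _ (Submodule.tmul_mem_baseChange_of_mem (1 : ℂ) hX) _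
      (Submodule.tmul_mem_baseChange_of_mem (1 : ℂ) hY)
    have h2 := congrArg re h1
    simpa using h2
  · intro u hu v hv
    rw [mem_baseChange_iff] at hu hv
    rw [← re_add_im u, ← re_add_im v]
    simp only [add_lie', lie_add', LieAlgebra.ExtendScalars.bracket_tmul]
    refine add_mem (add_mem ?_ ?_) (add_mem ?_ ?_) <;>
      refine Submodule.tmul_mem_baseChange_of_mem _ (hlie _ ?_ _ ?_)
    exacts [hu.1, hv.1, hu.2, hv.1, hu.1, hv.2, hu.2, hv.2]
  · intro u hu hθu v hv
    rw [mem_baseChange_iff] at hu hv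
    have h1 : θ (re u) = re u := by rw [← re_baseChange, hθu]
    have h2 : θ (im u) = im u := by rw [← im_baseChange, hθu]
    rw [← re_add_im u, ← re_add_im v]
    simp only [add_lie', lie_add', LieAlgebra.ExtendScalars.bracket_tmul, TensorProduct.tmul_zero,
    add_zero, hfix _ hu.1 h1 _ hv.1, hfix _ hu.1 h1 _ hv.2, hfix _ hu.2 h2 _ hv.1,
      hfix _ hu.2 h2 _ hv.2]
  · intro u hu
    rw [mem_baseChange_iff] at hu ⊢
    rw [re_baseChange, im_baseChange]
    exact ⟨hθW _ hu.1, hθW _ hu.2⟩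
  · rw [← LinearMap.baseChange_pow, hm, LinearMap.baseChange_one]

end Complexification

/-! ### The relations between `𝔩`, `S` and the centralizer of `T₁` -/

namespace ExpData

variable {G E : Type*} [Group G] [TopologicalSpace G] [NormedAddCommGroup E]
    [InnerProductSpace ℝ E] {𝒟 : ExpData G E} {σ τ : 𝒟.Aut} {S : Subgroup G}
    {hS : ∀ x ∈ S, ∀ y ∈ S, x * y = y * x}

lemma Aut.diff_diff (hσ : Function.Involutive σ.toAut) (X : E) : σ.diff (σ.diff X) = X := by
  refine 𝒟.eq_of_exp_smul_eq fun t => ?_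
  rw [← map_smul, ← map_smul, ← σ.map_exp, ← σ.map_exp, hσ]

lemma Aut.diff_comm (h : Commute σ.toAut τ.toAut) (X : E) :
    σ.diff (τ.diff X) = τ.diff (σ.diff X) := by
  refine 𝒟.eq_of_exp_smul_eq fun t => ?_
  simp only [← map_smul, ← σ.map_exp, ← τ.map_exp]
  exact congrArg (fun f : MulAut G => f (𝒟.exp (t • X))) h.eq

lemma Aut.diff_pow_eq {m : ℕ} (h : τ.toAut ^ m = 1) (X : E) : (τ.diff ^ m) X = X := by
  have key : ∀ (k : ℕ) (Y : E), (τ.toAut ^ k) (𝒟.exp Y) = 𝒟.exp ((τ.diff ^ k) Y) := by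
    intro k
    induction k with
    | zero => intro Y; simp
    | succ k ih =>
      intro Y
      rw [pow_succ, MulAut.mul_apply, τ.map_exp, ih, pow_succ]
      rfl
  refine 𝒟.eq_of_exp_smul_eq fun t => ?_
  rw [← map_smul, ← key, h, MulAut.one_apply]

lemma br_mem_centralizerLie {X Y : E} (hX : X ∈ centralizerLie σ S hS)
    (hY : Y ∈ centralizerLie σ S hS) : 𝒟.br X Y ∈ centralizerLie σ S hS := by
  refine ⟨diff_br_of_eq hX.1 hY.1, fun Z hZ => ?_⟩
  have h := 𝒟.hasDerivAt_Ad_zero Z (𝒟.br X Y)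
  simp only [𝒟.Ad_br, 𝒟.Ad_exp_smul_eq_iff.2 (hX.2 Z hZ), 𝒟.Ad_exp_smul_eq_iff.2 (hY.2 Z hZ)] at h
  exact h.unique (hasDerivAt_const _ _)

lemma diff_mem_centralizerLie (hcomm : Commute σ.toAut τ.toAut)
    (hSτ : S ≤ fixedSubgroup τ.toAut) {X : E} (hX : X ∈ centralizerLie σ S hS) :
    τ.diff X ∈ centralizerLie σ S hS := by
  refine ⟨by rw [Aut.diff_comm hcomm, hX.1], fun Z hZ => ?_⟩
  have hZτ : τ.diff Z = Z := τ.diff_eq_of_forall fun t => hSτ (hZ t)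
  have := τ.diff_br Z X
  rwa [hX.2 Z hZ, hZτ, map_zero, eq_comm] at this

lemma lieOf_le_centralizerLie (hSσ : S ≤ fixedSubgroup σ.toAut) :
    𝒟.lieOf S hS ≤ centralizerLie σ S hS := fun _ hX =>
  ⟨σ.diff_eq_of_forall fun t => hSσ (hX t), fun _ hY => br_eq_zero_of_mem_lieOf hY hX⟩

variable [FiniteDimensional ℝ E] [IsTopologicalGroup G] [CompactSpace G] [T2Space G]

lemma commute_exp_of_mem_centralizerLie (hST : IsTorus S) {X : E}
    (hX : X ∈ centralizerLie σ S hS) (t : ℝ) : ∀ x ∈ S, Commute (𝒟.exp (t • X)) x := by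
  refine commute_of_Ad_eq (𝒟 := 𝒟) (hS := hS) hST.isCompact.isClosed hST.isConnected.isPreconnected
    fun Y hY => ?_
  exact 𝒟.Ad_exp_smul_eq_iff.2 (𝒟.br_comm_zero (hX.2 Y hY)) t

lemma mem_lieOf_of_diff_eq
    (hmax : IsMaximalTorus (identityComponent (fixedSubgroup σ.toAut ⊓ fixedSubgroup τ.toAut)) S)
    {X : E} (hX : X ∈ centralizerLie σ S hS) (hτ : τ.diff X = X) : X ∈ 𝒟.lieOf S hS := by
  refine mem_lieOf_of_maximal ?_ hmax (fun t => ⟨?_, ?_⟩)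
    (commute_exp_of_mem_centralizerLie hmax.prop.1 hX)
  · exact (isClosed_fixedSubgroup σ.continuous_toAut).inter
      (isClosed_fixedSubgroup τ.continuous_toAut)
  · exact σ.exp_mem_fixedSubgroup (by rw [map_smul, hX.1])
  · exact τ.exp_mem_fixedSubgroup (by rw [map_smul, hτ])

/-- An element of `T₁` fixes the Lie algebra of `S`, hence also `𝔩` by
`Ad_eq_of_mem_centralizerLie`, so it commutes with `exp 𝔩`. This yields `𝔩 ⊆ 𝔱`. -/
lemma exp_mem_centralizer (hσ : Function.Involutive σ.toAut) (hSσ : S ≤ fixedSubgroup σ.toAut)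
    (hab : ∀ X ∈ centralizerLie σ S hS, ∀ Y ∈ centralizerLie σ S hS, 𝒟.br X Y = 0) {X : E}
    (hX : X ∈ centralizerLie σ S hS) (t : ℝ) :
    𝒟.exp (t • X) ∈ Subgroup.centralizer ((Subgroup.centralizer (S : Set G) ⊓
      identityComponent (fixedSubgroup σ.toAut) : Subgroup G) : Set G) := by
  rw [Subgroup.mem_centralizer_iff]
  rintro g ⟨hgS, hg⟩
  have h1 : ∀ Y ∈ 𝒟.lieOf S hS, 𝒟.Ad g Y = Y := fun Y hY =>
    𝒟.commute_exp_iff.1 fun t => (Subgroup.mem_centralizer_iff.1 hgS _ (hY t)).symm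
  exact 𝒟.commute_exp_iff.2 (Ad_eq_of_mem_centralizerLie (Aut.diff_diff hσ) hSσ hab hg h1 hX) t

/-- `exp (t Y)` commutes with `S` and lies in `K₁`, that is, in `T₁`. This yields `[𝔱, 𝔩] = 0`. -/
lemma br_eq_zero_of_exp_mem_centralizer (hST : IsTorus S) {X Y : E}
    (hX : ∀ t : ℝ, 𝒟.exp (t • X) ∈ Subgroup.centralizer ((Subgroup.centralizer (S : Set G) ⊓
      identityComponent (fixedSubgroup σ.toAut) : Subgroup G) : Set G))
    (hY : Y ∈ centralizerLie σ S hS) : 𝒟.br X Y = 0 := by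
  refine 𝒟.br_eq_zero_iff.2 fun s t => (Subgroup.mem_centralizer_iff.1 (hX s) _ ⟨?_, ?_⟩).symm
  · exact Subgroup.mem_centralizer_iff.2 fun x hx =>
      (commute_exp_of_mem_centralizerLie hST hY t x hx).symm
  · refine exp_mem_identityComponent fun u => σ.exp_mem_fixedSubgroup ?_
    rw [map_smul, map_smul, hY.1]

end ExpData

/-! ### The Lie algebras of `S`, `Z_{K₁}(S)` and `T` -/

namespace SymmetricData.InvariantForm

variable {n : ℕ} {G : Type*} [TopologicalSpace G] [ChartedSpace (EuclideanSpace ℝ (Fin n)) G]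
  [Group G] [IsTopologicalGroup G] {D : SymmetricData n G} (B : D.InvariantForm)
  [LieGroup (𝓡 n) ∞ G] [T2Space G]

/-- The identity map to the Euclidean space `(𝔤_ℝ, -B)`. -/
def ofLie : RealLie n G →ₗ[ℝ] B.Space where
  toFun X := X
  map_add' _ _ := rfl
  map_smul' _ _ := rfl

/-- The centralizer of the Lie algebra of `S` in the fixed algebra of `σ₁`. -/
def centralizerS : Submodule ℝ (RealLie n G) :=
  (ExpData.centralizerLie B.aut₁ D.S D.maximal.prop.1.comm).comap B.ofLie

lemma isVelocityIn_iff_exp {H : Subgroup G} {X : RealLie n G} :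
    IsVelocityIn n H X ↔ ∀ t : ℝ, B.expData.exp (t • B.ofLie X) ∈ H :=
  isVelocityIn_iff

/-- The velocities of a commutative group already form a subspace, so the span in `realLieOf` adds
nothing. -/
lemma mem_realLieOf_S {X : RealLie n G} :
    X ∈ realLieOf n D.S ↔ B.ofLie X ∈ B.expData.lieOf D.S D.maximal.prop.1.comm := by
  constructor
  · intro hX
    have : realLieOf n D.S ≤ (B.expData.lieOf D.S D.maximal.prop.1.comm).comap B.ofLie :=
      Submodule.span_le.2 fun X hX => B.isVelocityIn_iff_exp.1 hX
    exact this hX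
  · intro hX
    exact Submodule.subset_span (B.isVelocityIn_iff_exp.2 hX)

lemma S_le₁ : D.S ≤ fixedSubgroup D.σ₁ :=
  D.maximal.prop.2.trans ((identityComponent_le_self _).trans inf_le_left)

lemma S_le₂ : D.S ≤ fixedSubgroup D.σ₂ :=
  D.maximal.prop.2.trans ((identityComponent_le_self _).trans inf_le_right)

lemma form_lie (X Y Z : RealLie n G) : B.form ⁅X, Y⁆ Z = -B.form Y ⁅X, Z⁆ := by
  have h : -B.form ⁅X, Y⁆ Z = - -B.form Y ⁅X, Z⁆ :=
    B.expData.inner_br (B.ofLie X) (B.ofLie Y) (B.ofLie Z)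
  exact neg_injective h

lemma differential₁_lie (B : D.InvariantForm) (X Y : RealLie n G) :
    differential n D.σ₁ ⁅X, Y⁆ = ⁅differential n D.σ₁ X, differential n D.σ₁ Y⁆ :=
  B.aut₁.diff_br (B.ofLie X) (B.ofLie Y)

lemma differential₂_lie (B : D.InvariantForm) (X Y : RealLie n G) :
    differential n D.σ₂ ⁅X, Y⁆ = ⁅differential n D.σ₂ X, differential n D.σ₂ Y⁆ :=
  B.aut₂.diff_br (B.ofLie X) (B.ofLie Y)

lemma differential₂_pow (B : D.InvariantForm) {m : ℕ} (hm : D.σ₂ ^ m = 1) : differential n D.σ₂ ^ m = 1 := by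
  ext1 X
  have h := ExpData.Aut.diff_pow_eq (τ := B.aut₂) hm (B.ofLie X)
  have key : ∀ (k : ℕ) (X : RealLie n G),
      B.ofLie ((differential n D.σ₂ ^ k) X) = (B.aut₂.diff ^ k) (B.ofLie X) := by
    intro k
    induction k with
    | zero => intro X; rfl
    | succ k ih =>
      intro X
      rw [pow_succ, pow_succ]
      exact ih (differential n D.σ₂ X)
  exact (key m X).trans h

variable [CompactSpace G]

lemma mem_realLieOf_S_of_fixed {X : RealLie n G} (hX : X ∈ B.centralizerS)
    (h : differential n D.σ₂ X = X) : X ∈ realLieOf n D.S :=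
  B.mem_realLieOf_S.2 (ExpData.mem_lieOf_of_diff_eq (σ := B.aut₁) (τ := B.aut₂) D.maximal hX h)

/-- The `σ₂`-fixed vectors of `𝔩` lie in the Lie algebra of `S`, which commutes with `𝔩` by
definition of `𝔩`; so the finite-order criterion applies. -/
lemma centralizerS_abelian : ∀ X ∈ B.centralizerS, ∀ Y ∈ B.centralizerS, ⁅X, Y⁆ = 0 := by
  have : FiniteDimensional ℝ (RealLie n G) :=
    inferInstanceAs (FiniteDimensional ℝ (EuclideanSpace ℝ (Fin n)))
  obtain ⟨m, hm, hpow⟩ := isOfFinOrder_iff_pow_eq_one.1 D.finOrder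
  obtain ⟨m, rfl⟩ := Nat.exists_eq_succ_of_ne_zero hm.ne'
  refine Complexification.lie_eq_zero_of_finite_order (θ := differential n D.σ₂) (m := m) B.symm
    B.neg B.form_lie (fun X hX Y hY => ?_) B.differential₂_lie (fun X hX h Y hY => ?_)
    (fun X hX => ?_) (B.differential₂_pow hpow)
  · exact ExpData.br_mem_centralizerLie (σ := B.aut₁) hX hY
  · exact hY.2 _ (B.mem_realLieOf_S.1 (B.mem_realLieOf_S_of_fixed hX h))
  · exact ExpData.diff_mem_centralizerLie (σ := B.aut₁) (τ := B.aut₂) D.comm S_le₂ hX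

lemma centralizerS_le : B.centralizerS ≤ realLieOf n D.T := fun _ hX =>
  Submodule.subset_span (B.isVelocityIn_iff_exp.2 fun t =>
    ExpData.exp_mem_centralizer (σ := B.aut₁) D.involutive S_le₁ B.centralizerS_abelian hX t)

lemma realLieOf_S_le : realLieOf n D.S ≤ B.centralizerS := fun _ hX =>
  ExpData.lieOf_le_centralizerLie (σ := B.aut₁) S_le₁ (B.mem_realLieOf_S.1 hX)

lemma lie_centralizerS : ∀ X ∈ realLieOf n D.T, ∀ Y ∈ B.centralizerS, ⁅X, Y⁆ = 0 := by
  intro X hX Y hY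
  induction hX using Submodule.span_induction with
  | mem X hX =>
    exact ExpData.br_eq_zero_of_exp_mem_centralizer (σ := B.aut₁) D.maximal.prop.1
      (B.isVelocityIn_iff_exp.1 hX) hY
  | zero => exact zero_lie Y
  | add X X' _ _ h h' => rw [add_lie, h, h', add_zero]
  | smul c X _ h => rw [smul_lie, h, smul_zero]

open Complexification in
/-- The Lie algebras `𝔰` and `𝔱` of the tori `S` and `T`. -/
def torusData : (compactForm B.form B.symm B.neg B.form_lie).TorusData where
  s := D.s
  l := B.centralizerS.baseChange ℂ
  t := D.t
  inv := (differential n D.σ₁).baseChange ℂ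
  aut := (differential n D.σ₂).baseChange ℂ
  autT := D.σ₂t
  coe_autT _ := rfl
  inv_inv u := by
    have h : ∀ X : RealLie n G, differential n D.σ₁ (differential n D.σ₁ X) = X := fun X =>
      ExpData.Aut.diff_diff (σ := B.aut₁) D.involutive (B.ofLie X)
    apply ext_re_im
    · rw [re_baseChange, re_baseChange, h]
    · rw [im_baseChange, im_baseChange, h]
  inv_lie := baseChange_lie B.differential₁_lie
  inv_conj := baseChange_conj _
  form_inv := form_baseChange B.invariant₁
  aut_lie := baseChange_lie B.differential₂_lie
  form_aut := form_baseChange B.invariant₂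
  l_le u hu := by
    obtain ⟨h1, h2⟩ := mem_baseChange_iff.1 hu
    exact mem_baseChange_iff.2 ⟨B.centralizerS_le h1, B.centralizerS_le h2⟩
  s_le u hu := by
    obtain ⟨h1, h2⟩ := mem_baseChange_iff.1 hu
    exact mem_baseChange_iff.2 ⟨B.centralizerS_le (B.realLieOf_S_le h1),
      B.centralizerS_le (B.realLieOf_S_le h2)⟩
  conj_s _ := conj_mem_baseChange
  conj_t _ := conj_mem_baseChange
  inv_s u hu := by
    obtain ⟨h1, h2⟩ := mem_baseChange_iff.1 hu
    apply ext_re_im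
    · rw [re_baseChange]
      exact (B.realLieOf_S_le h1).1
    · rw [im_baseChange]
      exact (B.realLieOf_S_le h2).1
  aut_s u hu := by
    obtain ⟨h1, h2⟩ := mem_baseChange_iff.1 hu
    have h : ∀ X ∈ realLieOf n D.S, differential n D.σ₂ X = X := fun X hX =>
      B.aut₂.diff_eq_of_forall fun t => S_le₂ (B.mem_realLieOf_S.1 hX t)
    apply ext_re_im
    · rw [re_baseChange, h _ h1]
    · rw [im_baseChange, h _ h2]
  mem_l u hu hs := by
    have hs' : ∀ X ∈ realLieOf n D.S, ⁅(1 : ℂ) ⊗ₜ[ℝ] X, u⁆ = 0 := fun X hX =>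
      hs _ (Submodule.tmul_mem_baseChange_of_mem _ hX)
    have hre : ∀ X ∈ realLieOf n D.S, ⁅X, re u⁆ = 0 := fun X hX => by
      rw [← re_lie, hs' X hX, map_zero]
    have him : ∀ X ∈ realLieOf n D.S, ⁅X, im u⁆ = 0 := fun X hX => by
      rw [← im_lie, hs' X hX, map_zero]
    refine mem_baseChange_iff.2 ⟨⟨?_, fun Y hY => ?_⟩, ⟨?_, fun Y hY => ?_⟩⟩
    · change differential n D.σ₁ (re u) = re u
      rw [← re_baseChange, hu]
    · exact hre Y (B.mem_realLieOf_S.2 hY)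
    · change differential n D.σ₁ (im u) = im u
      rw [← im_baseChange, hu]
    · exact him Y (B.mem_realLieOf_S.2 hY)
  lie_l _ hu _ hv := lie_eq_zero_of_real B.lie_centralizerS hu hv
  mem_s u hu hfix := by
    obtain ⟨h1, h2⟩ := mem_baseChange_iff.1 hu
    refine mem_baseChange_iff.2 ⟨B.mem_realLieOf_S_of_fixed h1 ?_,
      B.mem_realLieOf_S_of_fixed h2 ?_⟩
    · rw [← re_baseChange, hfix]
    · rw [← im_baseChange, hfix]
  dual := B.dualVector
  form_dual := B.formT_dualVector

lemma iterate_σ₂dual (B : D.InvariantForm) {m : ℕ} (hm : D.σ₂ ^ m = 1) (α : Module.Dual ℂ D.t) :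
    D.σ₂dual^[m] α = α := by
  have h1 : ∀ (k : ℕ) (H : D.t), (D.σ₂dual^[k] α) ((D.σ₂t)^[k] H) = α H := by
    intro k
    induction k with
    | zero => intro H; rfl
    | succ k ih =>
      intro H
      rw [Function.iterate_succ_apply', Function.iterate_succ_apply', ← ih H]
      simp [σ₂dual]
  have h2 : ∀ (k : ℕ) (H : D.t), (((D.σ₂t)^[k] H : D.t) : ComplexLie n G) =
      ((differential n D.σ₂ ^ k).baseChange ℂ) H := by
    intro k
    induction k with
    | zero => intro H; simp
    | succ k ih =>
      intro H
      rw [Function.iterate_succ_apply', pow_succ', LinearMap.baseChange_mul, Module.End.mul_apply,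
        ← ih H]
      rfl
  have h3 : ∀ H : D.t, (D.σ₂t)^[m] H = H := fun H => Subtype.ext (by
    rw [h2, B.differential₂_pow hm, LinearMap.baseChange_one, Module.End.one_apply])
  ext H
  rw [← h1 m H, h3]

end SymmetricData.InvariantForm

end LieTorus

end

theorem mainTheorem10 (n : ℕ) (G : Type*) [TopologicalSpace G]
    [ChartedSpace (EuclideanSpace ℝ (Fin n)) G] [Group G] [IsTopologicalGroup G]
    [LieGroup (𝓡 n) ∞ G] [T2Space G] [CompactSpace G] [ConnectedSpace G]
    (D : LieTorus.SymmetricData n G) (B : D.InvariantForm)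
    (P : Set (Module.Dual ℂ D.t)) (hP : D.Ω = P ∪ -P) (hdisj : Disjoint P (-P)) :
    (∀ α ∈ D.Ω, ∃ ℓ : ℕ, 1 ≤ ℓ ∧
      IsGreatest {m : ℕ | LinearIndependent ℝ (fun i : Fin m => D.σ₂dual^[(i : ℕ)] α)} ℓ ∧
      LinearIndependent ℂ (fun i : Fin ℓ => D.σ₂dual^[(i : ℕ)] α) ∧
      D.σ₂dual^[ℓ] α = -α) ∧
    (∀ v ∈ Submodule.span ℂ (B.dualVector '' P), D.σ₂t v = v → v = 0) := by
  obtain ⟨m, hm, hpow⟩ := isOfFinOrder_iff_pow_eq_one.1 D.finOrder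
  refine ⟨fun α hα => ?_, fun v hv hfix => ?_⟩
  · exact LieTorus.CompactForm.TorusData.exists_length (𝒯 := B.torusData) hα hm
      (LieTorus.SymmetricData.InvariantForm.iterate_σ₂dual B hpow α)
  -- The span over `P` is contained in the span over all of `Ω`, where fixed vectors already vanish.
  · have hle : B.dualVector '' P ⊆ B.dualVector '' D.Ω :=
      Set.image_mono (hP ▸ Set.subset_union_left)
    exact LieTorus.CompactForm.TorusData.eq_zero_of_fixed (𝒯 := B.torusData)
      (Submodule.span_mono hle hv) hfix
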